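/- Let $I$ be a finite set and $\Omega=(\Omega_{ij})_{i,j\in I}$ an integer matrix with $\Omega_{ii}>0$, $\Omega_{ij}\le 0$ and $\frac{\Omega_{ij}+\Omega_{ji}}{\Omega_{ii}}\in\mathbb Z_{\le 0}$ for $i\neq j$, and $\gcd_i \Omega_{ii}=1$. On $\mathbb Z[I]$ let $\langle\cdot,\cdot\rangle$ be the bilinear form with $\langle i,j\rangle=\Omega_{ij}$ and put $\mu\cdot\nu=\langle \mu,\nu\rangle+\langle \nu,\mu\rangle$, $\{\mu,\nu\}=v^{\mu\cdot\nu}t^{\langle\nu,\mu\rangle-\langle\mu,\nu\rangle}$. Put $v_i=v^{i\cdot i/2}$, $t_i=t^{i\cdot i/2}$, $[n]_{q,s}=\frac{(qs)^n-(qs^{-1})^{-n}}{qs-(qs^{-1})^{-1}}$, $[n]^!_{q,s}=\prod_{k=1}^n[k]_{q,s}$, and $x^{(n)}=x^n/[n]^!_{v_i,t_i}$ for $x=E_i,F_i$. Let $\mathbf U=U_{v,t}$ be the unital $\mathbb Q(v,t)$-algebra generated by $E_i,F_i,K_i^{\pm1},K_i'^{\pm1}$ $(i\in I)$ with the relations: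 all $K_i^{\pm1},K_j'^{\pm1}$ commute and $K_iK_i^{-1}=K_i'K_i'^{-1}=1$; $$K_iE_jK_i^{-1}=v^{i\cdot j}t^{\langle j,i\rangle-\langle i,j\rangle}E_j,\quad K'_iE_jK_i'^{-1}=v^{-i\cdot j}t^{\langle j,i\rangle-\langle i,j\rangle}E_j,$$ $$K'_iF_jK_i'^{-1}=v^{i\cdot j}t^{\langle i,j\rangle-\langle j,i\rangle}F_j,\quad K_iF_jK_i^{-1}=v^{-i\cdot j}t^{\langle i,j\rangle-\langle j,i\rangle}F_j,$$ $$E_iF_j-F_jE_i=\delta_{ij}\frac{K_i-K_i'}{v_i-v_i^{-1}},$$ and, for $i\ne j$, the sums being over $p,p'\ge0$ with $p+p'=1-2\frac{i\cdot j}{i\cdot i}$, $$\sum(-1)^pt_i^{-p(p'-2\frac{\langle i,j\rangle}{i\cdot i}+2\frac{\langle j,i\rangle}{i\cdot i})}E_i^{(p)}E_jE_i^{(p')}=0,\quad \sum(-1)^pt_i^{-p(p'-2\frac{\langle i,j\rangle}{i\cdot i}+2\frac{\langle j,i\rangle}{i\cdot i})}F_i^{(p')}F_jF_i^{(p)}=0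 .$$ Let $\Delta:\mathbf U\to\mathbf U\otimes\mathbf U$ and $\varepsilon:\mathbf U\to\mathbb Q(v,t)$ be the algebra homomorphisms for which $K_i^{\pm1},K_i'^{\pm1}$ are group-like, $\Delta(E_i)=E_i\otimes1+K_i\otimes E_i$, $\Delta(F_i)=1\otimes F_i+F_i\otimes K_i'$ and $\varepsilon(E_i)=\varepsilon(F_i)=0$. Let $\bar{\ }$ be the ring involution of $\mathbf U$ fixing $E_i,F_i$, exchanging $K_i$ and $K'_i$, and semilinear over $v\mapsto v^{-1}$, $t\mapsto t$; put $\overline\Delta(u)=(\bar{\ }\otimes\bar{\ })(\Delta(\bar u))$. Let $\mathbf U^+$ and $\mathbf U^-$ be the subalgebras generated by the $E_i$ and by the $F_i$, $\mathbf U^0$ the one generated by all $K_i^{\pm1},K_i'^{\pm1}$, and $\mathbf U_{\ge0}$, $\mathbf U_{\le0}$ those generated by the $E_i,K_i^{\pm1}$ and by the $F_i,K_i'^{\pm1}$. For $\nu\in\mathbb N[I]$ let $\mathbf U^+_\nu$ and $\mathbf U^-_{-\nu}$ be the spans of the monomials of degree $\nu$ in the $E_i$ and in the $F_i$, and put $\operatorname{tr}\nu=\sum_i\nu_i$.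 Let $(\mathbf U\otimes\mathbf U)^\wedge$ be the completion of $\mathbf U\otimes\mathbf U$ with respect to $$\mathcal H_N=\Bigl(\mathbf U^+\mathbf U^0\sum_{\operatorname{tr}\nu\ge N}\mathbf U^-_{-\nu}\Bigr)\otimes\mathbf U+\mathbf U\otimes\Bigl(\mathbf U^-\mathbf U^0\sum_{\operatorname{tr}\nu\ge N}\mathbf U^+_{\nu}\Bigr),$$ a topological ring. Consider skew-Hopf pairings $(\,,)_\phi:\mathbf U_{\ge0}\times\mathbf U_{\le0}\to\mathbb Q(v,t)$, that is, bilinear maps with $(1,y)_\phi=\varepsilon(y)$, $(x,1)_\phi=\varepsilon(x)$, $(x,yy')_\phi=(\Delta(x),y\otimes y')_\phi$, $(xx',y)_\phi=(x\otimes x',\Delta^{op}(y))_\phi$, such that $(E_i,F_j)_\phi=\delta_{ij}(v_i^{-1}-v_i)^{-1}$ and $(K_\mu x,K'_\nu y)_\phi=\{\mu,\nu\}\{\mu,\beta\}\{\alpha,\nu\}(x,y)_\phi$ for $\mu,\nu\in\mathbb Z[I]$, $x\in\mathbf U^+_\alpha$, $y\in\mathbf U^-_{-\beta}$. Such a pairing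 exists. Let $(\,,)_\phi$ be such a pairing, and for every $\nu\in\mathbb N[I]$ let $\mathbf B_\nu$ be a (finite) basis of $\mathbf U^-_{-\nu}$ and $\{b^*\mid b\in\mathbf B_\nu\}$ a basis of $\mathbf U^+_\nu$ dual to it, $(b^*,b')_\phi=\delta_{b,b'}$. Put $\Theta_\nu=\sum_{b\in\mathbf B_\nu}b\otimes b^*$. Then $\Theta_0=1\otimes1$, the series $\Theta=\sum_{\nu\in\mathbb N[I]}\Theta_\nu$ converges in $(\mathbf U\otimes\mathbf U)^\wedge$, and $$\Delta(u)\,\Theta=\Theta\,\overline\Delta(u)\qquad\text{in }(\mathbf U\otimes\mathbf U)^\wedge\text{ for all }u\in\mathbf U .$$ -/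

import Mathlib

open scoped TensorProduct

namespace TwoParam

universe u

/-- The field `ℚ(v,t)`, realised as `ℚ(t)(v)`. -/
def QVT : Type := RatFunc (RatFunc ℚ)

noncomputable instance : Field QVT := inferInstanceAs (Field (RatFunc (RatFunc ℚ)))

noncomputable def vv : QVT := (RatFunc.X : RatFunc (RatFunc ℚ))

noncomputable def tt : QVT := (RatFunc.C (RatFunc.X : RatFunc ℚ) : RatFunc (RatFunc ℚ))

theorem vv_ne_zero : vv ≠ 0 := RatFunc.X_ne_zero

theorem tt_ne_zero : tt ≠ 0 :=
  (map_ne_zero (RatFunc.C : RatFunc ℚ →+* RatFunc (RatFunc ℚ))).mpr RatFunc.X_ne_zero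

theorem vv_pow_ne_one {n : ℕ} (hn : 0 < n) : vv ^ n ≠ 1 := by
  intro h
  have h' : (RatFunc.X : RatFunc (RatFunc ℚ)) ^ n = 1 := h
  rw [← RatFunc.algebraMap_X, ← map_pow, ← map_one (algebraMap (Polynomial (RatFunc ℚ)) (RatFunc (RatFunc ℚ)))] at h'
  have h2 := congrArg Polynomial.natDegree (RatFunc.algebraMap_injective _ h')
  simp at h2
  omega

theorem evalInv_injective : Function.Injective
    (Polynomial.aeval (R := RatFunc ℚ) ((RatFunc.X : RatFunc (RatFunc ℚ))⁻¹)) := by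
  rw [← transcendental_iff_injective, Transcendental, IsAlgebraic.inv_iff]
  exact RatFunc.transcendental_X

/-- The bar involution of `ℚ(v,t)`: `v ↦ v⁻¹`, `t ↦ t`. -/
noncomputable def barQ : QVT →+* QVT :=
  RatFunc.liftRingHom (R := RatFunc ℚ) (L := RatFunc (RatFunc ℚ))
    (Polynomial.aeval (R := RatFunc ℚ) ((RatFunc.X : RatFunc (RatFunc ℚ))⁻¹)).toRingHom
    (nonZeroDivisors_le_comap_nonZeroDivisors_of_injective _ evalInv_injective)

theorem barQ_vv : barQ vv = vv⁻¹ := by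
  have : barQ vv = RatFunc.liftRingHom (R := RatFunc ℚ) (L := RatFunc (RatFunc ℚ))
    (Polynomial.aeval (R := RatFunc ℚ) ((RatFunc.X : RatFunc (RatFunc ℚ))⁻¹)).toRingHom
    (nonZeroDivisors_le_comap_nonZeroDivisors_of_injective _ evalInv_injective)
      (algebraMap (Polynomial (RatFunc ℚ)) (RatFunc (RatFunc ℚ)) Polynomial.X) := by rw [RatFunc.algebraMap_X]; rfl
  rw [this, RatFunc.liftRingHom_algebraMap]
  exact Polynomial.aeval_X (R := RatFunc ℚ) ((RatFunc.X : RatFunc (RatFunc ℚ))⁻¹)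

theorem barQ_tt : barQ tt = tt := by
  have : barQ tt = RatFunc.liftRingHom (R := RatFunc ℚ) (L := RatFunc (RatFunc ℚ))
    (Polynomial.aeval (R := RatFunc ℚ) ((RatFunc.X : RatFunc (RatFunc ℚ))⁻¹)).toRingHom
    (nonZeroDivisors_le_comap_nonZeroDivisors_of_injective _ evalInv_injective)
      (algebraMap (Polynomial (RatFunc ℚ)) (RatFunc (RatFunc ℚ)) (Polynomial.C RatFunc.X)) := by rw [RatFunc.algebraMap_C]; rfl
  rw [this, RatFunc.liftRingHom_algebraMap]
  exact Polynomial.aeval_C (R := RatFunc ℚ) ((RatFunc.X : RatFunc (RatFunc ℚ))⁻¹) RatFunc.X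

/-- The quantum integer `[n]_{q,s}`. -/
noncomputable def qInt (q s : QVT) (n : ℕ) : QVT :=
  ((q * s) ^ n - ((q * s⁻¹)⁻¹) ^ n) / (q * s - (q * s⁻¹)⁻¹)

/-- The quantum factorial `[n]!_{q,s}`. -/
noncomputable def qFact (q s : QVT) (n : ℕ) : QVT :=
  ∏ k ∈ Finset.Icc 1 n, qInt q s k

/-- The one-parameter quantum integer. -/
noncomputable def bal (q : QVT) (n : ℕ) : QVT := (q ^ n - (q⁻¹) ^ n) / (q - q⁻¹)

noncomputable def balFact (q : QVT) (n : ℕ) : QVT := ∏ k ∈ Finset.Icc 1 n, bal q k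

theorem balFact_succ (q : QVT) (n : ℕ) : balFact q (n + 1) = balFact q n * bal q (n + 1) := by
  rw [balFact, balFact, Finset.prod_Icc_succ_top (by omega)]

theorem qFact_succ (q s : QVT) (n : ℕ) : qFact q s (n + 1) = qFact q s n * qInt q s (n + 1) := by
  rw [qFact, qFact, Finset.prod_Icc_succ_top (by omega)]

theorem bal_inv (q : QVT) (n : ℕ) : bal q⁻¹ n = bal q n := by
  unfold bal
  rw [inv_inv, ← neg_sub, ← neg_sub q, neg_div_neg_eq]

theorem balFact_inv (q : QVT) (n : ℕ) : balFact q⁻¹ n = balFact q n := by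
  simp only [balFact, bal_inv]

theorem qInt_succ (q s : QVT) (hs : s ≠ 0) (n : ℕ) :
    qInt q s (n + 1) = s ^ n * bal q (n + 1) := by
  unfold qInt bal
  have h1 : (q * s) ^ (n + 1) - ((q * s⁻¹)⁻¹) ^ (n + 1)
      = s * (s ^ n * (q ^ (n + 1) - (q⁻¹) ^ (n + 1))) := by
    rw [mul_inv, inv_inv, mul_pow, mul_pow]; ring
  have h2 : q * s - (q * s⁻¹)⁻¹ = s * (q - q⁻¹) := by
    rw [mul_inv, inv_inv]; ring
  rw [h1, h2, mul_div_mul_left _ _ hs, mul_div_assoc]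

theorem qFact_eq (q s : QVT) (hs : s ≠ 0) (n : ℕ) :
    qFact q s n = s ^ (n.choose 2) * balFact q n := by
  induction n with
  | zero => simp [qFact, balFact]
  | succ n ih =>
    rw [qFact_succ, balFact_succ, ih, qInt_succ q s hs, Nat.choose_succ_succ' n 1, Nat.choose_one_right,
      pow_add]
    ring

/-- The coefficients of the product of the commuting operators `R - c q^(2k) L`. -/
noncomputable def gaussCoeff (c q : QVT) : ℕ → ℕ → QVT
  | 0, 0 => 1
  | 0, _ + 1 => 0
  | m + 1, 0 => gaussCoeff c q m 0
  | m + 1, p + 1 => gaussCoeff c q m (p + 1) - c * q ^ (2 * m) * gaussCoeff c q m p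

theorem gaussCoeff_of_lt (c q : QVT) : ∀ {m p : ℕ}, m < p → gaussCoeff c q m p = 0
  | 0, p + 1, _ => rfl
  | m + 1, p + 1, h => by
    rw [gaussCoeff, gaussCoeff_of_lt c q (show m < p + 1 by omega),
      gaussCoeff_of_lt c q (show m < p by omega)]
    ring

theorem gaussCoeff_zero (c q : QVT) : ∀ m : ℕ, gaussCoeff c q m 0 = 1
  | 0 => rfl
  | m + 1 => by rw [gaussCoeff, gaussCoeff_zero c q m]

theorem gaussCoeff_eq (c q : QVT) (hq0 : q ≠ 0) (hq : ∀ n, 0 < n → bal q n ≠ 0) :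
    ∀ p r : ℕ, gaussCoeff c q (p + r) p * (balFact q p * balFact q r) =
      (-c) ^ p * q ^ ((p : ℤ) * ((p : ℤ) + r - 1)) * balFact q (p + r) := by
  have hq2 : q - q⁻¹ ≠ 0 := by
    intro h
    exact hq 1 one_pos (by simp [bal, h])
  intro p
  induction p with
  | zero => intro r; simp [gaussCoeff_zero, balFact]
  | succ p ihp =>
    intro r
    induction r with
    | zero =>
      have h1 := ihp 0
      simp only [add_zero] at h1
      rw [show p + 1 + 0 = p + 1 from rfl, gaussCoeff, gaussCoeff_of_lt c q (Nat.lt_succ_self p)]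
      have hb : balFact q p ≠ 0 := Finset.prod_ne_zero_iff.mpr
        fun k hk => hq k (Finset.mem_Icc.mp hk).1
      have h2 : gaussCoeff c q p p = (-c) ^ p * q ^ ((p : ℤ) * ((p : ℤ) + (0 : ℕ) - 1)) := by
        have h0 : balFact q 0 = 1 := by simp [balFact]
        rw [h0, mul_one] at h1
        exact mul_right_cancel₀ hb h1
      rw [h2]
      have h0 : balFact q 0 = 1 := by simp [balFact]
      have e : q ^ (((p + 1 : ℕ) : ℤ) * (((p + 1 : ℕ) : ℤ) + (0 : ℕ) - 1))
          = q ^ (2 * p) * q ^ ((p : ℤ) * ((p : ℤ) + (0 : ℕ) - 1)) := by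
        rw [← zpow_natCast, ← zpow_add₀ hq0]
        congr 1
        push_cast
        ring
      rw [e, h0]
      ring
    | succ r ihr =>
      have h1 := ihp (r + 1)
      rw [show p + 1 + (r + 1) = (p + 1 + r) + 1 from rfl, gaussCoeff]
      rw [show p + (r + 1) = p + 1 + r by omega] at h1
      set m := p + 1 + r with hm
      have e1 : q ^ (((p + 1 : ℕ) : ℤ) * (((p + 1 : ℕ) : ℤ) + (r + 1 : ℕ) - 1))
          = q ^ (((p + 1 : ℕ) : ℤ) * (((p + 1 : ℕ) : ℤ) + r - 1)) * q ^ (p + 1) := by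
        rw [← zpow_natCast, ← zpow_add₀ hq0]
        congr 1
        push_cast
        ring
      have e2 : q ^ (2 * m) * q ^ ((p : ℤ) * ((p : ℤ) + (r + 1 : ℕ) - 1))
          = q ^ (((p + 1 : ℕ) : ℤ) * (((p + 1 : ℕ) : ℤ) + r - 1)) * q ^ (m + 1) := by
        rw [← zpow_natCast, ← zpow_natCast, ← zpow_add₀ hq0, ← zpow_add₀ hq0]
        congr 1
        push_cast [hm]
        ring
      have key : bal q (m + 1) * q ^ (p + 1) = bal q (r + 1) + q ^ (m + 1) * bal q (p + 1) := by
        have hi : q * q⁻¹ = 1 := mul_inv_cancel₀ hq0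
        unfold bal
        rw [div_mul_eq_mul_div, mul_div_assoc', ← add_div]
        congr 1
        have ha : (q⁻¹) ^ (m + 1) * q ^ (p + 1) = (q⁻¹) ^ (r + 1) := by
          rw [show m + 1 = (r + 1) + (p + 1) by omega, pow_add, mul_assoc, ← mul_pow,
            mul_comm q⁻¹ q, hi, one_pow, mul_one]
        have hb : q ^ (m + 1) * (q⁻¹) ^ (p + 1) = q ^ (r + 1) := by
          rw [show m + 1 = (r + 1) + (p + 1) by omega, pow_add, mul_assoc, ← mul_pow,
            hi, one_pow, mul_one]
        rw [sub_mul, mul_sub, ha, hb]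
        ring
      rw [e1, balFact_succ q m]
      have h3 : (gaussCoeff c q m (p + 1) - c * q ^ (2 * m) * gaussCoeff c q m p) *
          (balFact q (p + 1) * balFact q (r + 1)) =
          (gaussCoeff c q m (p + 1) * (balFact q (p + 1) * balFact q r)) * bal q (r + 1)
          - c * q ^ (2 * m) * (gaussCoeff c q m p * (balFact q p * balFact q (r + 1)))
            * bal q (p + 1) := by
        rw [balFact_succ q r, balFact_succ q p]; ring
      rw [h3, ihr, h1]
      have h4 : c * q ^ (2 * m) * ((-c) ^ p * q ^ ((p : ℤ) * ((p : ℤ) + (r + 1 : ℕ) - 1)) *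
          balFact q m) * bal q (p + 1)
          = c * (-c) ^ p * (q ^ (2 * m) * q ^ ((p : ℤ) * ((p : ℤ) + (r + 1 : ℕ) - 1))) *
          balFact q m * bal q (p + 1) := by ring
      rw [h4, e2]
      linear_combination ((-c) ^ (p + 1) *
        q ^ (((p + 1 : ℕ) : ℤ) * (((p + 1 : ℕ) : ℤ) + r - 1)) * balFact q m) * (-key)

section Iterate

variable {A : Type*} [Ring A] [Algebra QVT A]

/-- Iterated twisted commutators `z ↦ z x - c q^(2m) x z`. -/
noncomputable def twist (c q : QVT) (x y : A) : ℕ → A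
  | 0 => y
  | m + 1 => twist c q x y m * x - (c * q ^ (2 * m)) • (x * twist c q x y m)

theorem twist_eq (c q : QVT) (x y : A) (m : ℕ) :
    twist c q x y m = ∑ p ∈ Finset.range (m + 1), gaussCoeff c q m p • (x ^ p * y * x ^ (m - p)) := by
  induction m with
  | zero => simp [twist, gaussCoeff]
  | succ m ih =>
    rw [twist, Finset.sum_range_succ']
    simp only [gaussCoeff, sub_smul, Finset.sum_sub_distrib]
    have h1 : twist c q x y m * x =
        ∑ p ∈ Finset.range (m + 1), gaussCoeff c q m (p + 1) • (x ^ (p + 1) * y * x ^ (m + 1 - (p + 1)))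
        + gaussCoeff c q m 0 • (x ^ 0 * y * x ^ (m + 1 - 0)) := by
      rw [← Finset.sum_range_succ' (fun p => gaussCoeff c q m p • (x ^ p * y * x ^ (m + 1 - p))),
        Finset.sum_range_succ, gaussCoeff_of_lt c q (Nat.lt_succ_self m), zero_smul, add_zero, ih,
        Finset.sum_mul]
      refine Finset.sum_congr rfl fun p hp => ?_
      have hp' : p ≤ m := by simpa [Nat.lt_succ_iff] using hp
      rw [smul_mul_assoc, mul_assoc _ _ x, ← pow_succ, show m + 1 - p = m - p + 1 by omega]
    have h2 : (c * q ^ (2 * m)) • (x * twist c q x y m) =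
        ∑ p ∈ Finset.range (m + 1), (c * q ^ (2 * m) * gaussCoeff c q m p) •
          (x ^ (p + 1) * y * x ^ (m + 1 - (p + 1))) := by
      rw [ih, Finset.mul_sum, Finset.smul_sum]
      refine Finset.sum_congr rfl fun p hp => ?_
      rw [mul_smul_comm, smul_smul, pow_succ' x p, Nat.add_sub_add_right, mul_assoc x, mul_assoc x]
    rw [h1, h2]
    abel

/-- The Serre expression in normalised form. -/
noncomputable def normSerre (s q : QVT) (N : ℕ) (x y : A) : A :=
  ∑ p ∈ Finset.HasAntidiagonal.antidiagonal N,
    ((-1) ^ p.1 * s ^ p.1 * (balFact q p.1 * balFact q p.2)⁻¹) • (x ^ p.1 * y * x ^ p.2)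

theorem twist_eq_normSerre (c s q : QVT) (hq0 : q ≠ 0) (hq : ∀ n, 0 < n → bal q n ≠ 0) (N : ℕ)
    (hc : c * q ^ ((N : ℤ) - 1) = s) (x y : A) :
    twist c q x y N = balFact q N • normSerre s q N x y := by
  rw [twist_eq, normSerre, Finset.smul_sum,
    Finset.Nat.sum_antidiagonal_eq_sum_range_succ_mk]
  refine Finset.sum_congr rfl fun p hp => ?_
  have hp' : p ≤ N := by simpa [Nat.lt_succ_iff] using hp
  rw [smul_smul]
  congr 1
  obtain ⟨r, rfl⟩ := Nat.exists_eq_add_of_le hp'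
  have hb : ∀ n, balFact q n ≠ 0 := fun n => Finset.prod_ne_zero_iff.mpr
        fun k hk => hq k (Finset.mem_Icc.mp hk).1
  have h := gaussCoeff_eq c q hq0 hq p r
  rw [Nat.add_sub_cancel_left]
  have hs : s ^ p = c ^ p * q ^ ((p : ℤ) * ((p : ℤ) + r - 1)) := by
    rw [← hc, mul_pow, ← zpow_natCast (q ^ _), ← zpow_mul]
    congr 2
    push_cast
    ring
  rw [hs, ← mul_inv_cancel_right₀ (mul_ne_zero (hb p) (hb r)) (gaussCoeff c q (p + r) p), h,
    neg_pow c]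
  ring

theorem normSerre_add (s q w : QVT) (hs : s ≠ 0) (hq0 : q ≠ 0)
    (hq : ∀ n, 0 < n → bal q n ≠ 0) (N : ℕ) (hw : w * q ^ ((N : ℤ) - 1) = 1)
    (x₁ x₂ y₁ y₂ : A) (hxx : x₂ * x₁ = q ^ 2 • (x₁ * x₂)) (hxy : x₂ * y₁ = (w * s⁻¹) • (y₁ * x₂))
    (hyx : y₂ * x₁ = (w * s) • (x₁ * y₂)) :
    normSerre s q N (x₁ + x₂) (y₁ + y₂) = normSerre s q N x₁ y₁ + normSerre s q N x₂ y₂ := by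
  have hw0 : w ≠ 0 := by rintro rfl; simp at hw
  have hb : balFact q N ≠ 0 := Finset.prod_ne_zero_iff.mpr
        fun k hk => hq k (Finset.mem_Icc.mp hk).1
  have hadd : ∀ x : A, normSerre s q N x (y₁ + y₂) = normSerre s q N x y₁ + normSerre s q N x y₂ := by
    intro x
    simp only [normSerre, mul_add, add_mul, smul_add, Finset.sum_add_distrib]
  have hup : ∀ m, twist (w * s) q x₂ y₂ m * x₁ = (w * s * q ^ (2 * m)) • (x₁ * twist (w * s) q x₂ y₂ m) := by
    intro m
    induction m with
    | zero => simpa [twist] using hyx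
    | succ m ih =>
      rw [twist]
      set z := twist (w * s) q x₂ y₂ m
      have e1 : z * x₂ * x₁ = (w * s * q ^ (2 * (m + 1))) • (x₁ * (z * x₂)) := by
        rw [mul_assoc, hxx, mul_smul_comm, ← mul_assoc, ih, smul_mul_assoc, smul_smul, mul_assoc x₁]
        congr 1; ring
      have e2 : x₂ * z * x₁ = (w * s * q ^ (2 * (m + 1))) • (x₁ * (x₂ * z)) := by
        rw [mul_assoc, ih, mul_smul_comm, ← mul_assoc, hxx, smul_mul_assoc, smul_smul, mul_assoc x₁]
        congr 1; ring
      rw [sub_mul, smul_mul_assoc, e1, e2, mul_sub, smul_sub, mul_smul_comm, smul_comm]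
  have hup2 : ∀ m, twist (w * s) q (x₁ + x₂) y₂ m = twist (w * s) q x₂ y₂ m := by
    intro m
    induction m with
    | zero => rfl
    | succ m ih =>
      rw [twist, ih, twist, mul_add, hup, add_mul, smul_add]
      abel
  have hdn : ∀ m, x₂ * twist (w⁻¹ * s) q⁻¹ x₁ y₁ m =
      (w * s⁻¹ * q ^ (2 * m)) • (twist (w⁻¹ * s) q⁻¹ x₁ y₁ m * x₂) := by
    intro m
    induction m with
    | zero => simpa [twist] using hxy
    | succ m ih =>
      rw [twist]
      set z := twist (w⁻¹ * s) q⁻¹ x₁ y₁ m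
      have e1 : x₂ * (z * x₁) = (w * s⁻¹ * q ^ (2 * (m + 1))) • (z * x₁ * x₂) := by
        rw [← mul_assoc, ih, smul_mul_assoc, mul_assoc z, hxx, mul_smul_comm, smul_smul, ← mul_assoc z]
        congr 1; ring
      have e2 : x₂ * (x₁ * z) = (w * s⁻¹ * q ^ (2 * (m + 1))) • (x₁ * z * x₂) := by
        rw [← mul_assoc, hxx, smul_mul_assoc, mul_assoc x₁, ih, mul_smul_comm, smul_smul, ← mul_assoc x₁]
        congr 1; ring
      rw [mul_sub, mul_smul_comm, e1, e2, sub_mul, smul_sub, smul_mul_assoc, smul_comm]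
  have hdn2 : ∀ m, twist (w⁻¹ * s) q⁻¹ (x₁ + x₂) y₁ m = twist (w⁻¹ * s) q⁻¹ x₁ y₁ m := by
    intro m
    induction m with
    | zero => rfl
    | succ m ih =>
      rw [twist, ih, twist, mul_add, add_mul, hdn, smul_add, smul_smul]
      have : w⁻¹ * s * q⁻¹ ^ (2 * m) * (w * s⁻¹ * q ^ (2 * m)) = 1 := by
        rw [inv_pow]; field_simp
      rw [this, one_smul]
      abel
  have hN1 : w * s * q ^ ((N : ℤ) - 1) = s := by
    rw [mul_right_comm, hw, one_mul]
  have hN2 : w⁻¹ * s * q⁻¹ ^ ((N : ℤ) - 1) = s := by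
    rw [inv_zpow, mul_right_comm, ← mul_inv, hw, inv_one, one_mul]
  have hq' : ∀ n, 0 < n → bal q⁻¹ n ≠ 0 := fun n hn => by rw [bal_inv]; exact hq n hn
  have hns : ∀ x y : A, normSerre s q⁻¹ N x y = normSerre s q N x y := by
    intro x y; simp only [normSerre, balFact_inv]
  have a1 : normSerre s q N (x₁ + x₂) y₁ = normSerre s q N x₁ y₁ := by
    have h1 := twist_eq_normSerre (w⁻¹ * s) s q⁻¹ (inv_ne_zero hq0) hq' N hN2 (x₁ + x₂) y₁
    have h2 := twist_eq_normSerre (w⁻¹ * s) s q⁻¹ (inv_ne_zero hq0) hq' N hN2 x₁ y₁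
    rw [hdn2, h2, hns, hns, balFact_inv] at h1
    exact (smul_right_injective A hb h1).symm
  have a2 : normSerre s q N (x₁ + x₂) y₂ = normSerre s q N x₂ y₂ := by
    have h1 := twist_eq_normSerre (w * s) s q hq0 hq N hN1 (x₁ + x₂) y₂
    have h2 := twist_eq_normSerre (w * s) s q hq0 hq N hN1 x₂ y₂
    rw [hup2, h2] at h1
    exact (smul_right_injective A hb h1).symm
  rw [hadd, a1, a2]

end Iterate

theorem choose_two_add (a b : ℕ) : (a + b).choose 2 = a.choose 2 + b.choose 2 + a * b := by
  induction b with
  | zero => simp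
  | succ b ih =>
    rw [← add_assoc, Nat.choose_succ_succ' (a + b) 1, Nat.choose_succ_succ' b 1, ih,
      Nat.choose_one_right, Nat.choose_one_right]
    ring

/-- An integer matrix `Ω` with positive diagonal and nonpositive off-diagonal entries, such that
`(Ω i j + Ω j i) / Ω i i` is an integer (then nonpositive) for `i ≠ j` and the diagonal entries have
greatest common divisor `1`. The associated Cartan datum is `i · j = Ω i j + Ω j i`. -/
structure CartanDatum (I : Type u) [Fintype I] where
  Ω : I → I → ℤ
  diag_pos : ∀ i, 0 < Ω i i
  offdiag_nonpos : ∀ i j, i ≠ j → Ω i j ≤ 0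
  diag_dvd : ∀ i j, i ≠ j → Ω i i ∣ Ω i j + Ω j i
  gcd_diag : Finset.univ.gcd (fun i => Ω i i) = 1

namespace CartanDatum

variable {I : Type u} [Fintype I] (C : CartanDatum I)

/-- The bilinear form `⟨μ, ν⟩` on `ℤ[I]` with `⟨i, j⟩ = Ω i j`. -/
def form (μ ν : I → ℤ) : ℤ := ∑ i, ∑ j, μ i * ν j * C.Ω i j

/-- The symmetric form `μ · ν = ⟨μ, ν⟩ + ⟨ν, μ⟩` on `ℤ[I]`. -/
def dotForm (μ ν : I → ℤ) : ℤ := C.form μ ν + C.form ν μ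

/-- The multiplicative bilinear form `{μ, ν} = v^(μ·ν) t^(⟨ν,μ⟩ - ⟨μ,ν⟩)` on `ℤ[I]`. -/
noncomputable def brace (μ ν : I → ℤ) : QVT :=
  vv ^ C.dotForm μ ν * tt ^ (C.form ν μ - C.form μ ν)

/-- `i · j = ⟨i, j⟩ + ⟨j, i⟩`. -/
def dot (i j : I) : ℤ := C.Ω i j + C.Ω j i

/-- `v_i = v^(i·i/2)`. -/
noncomputable def vi (i : I) : QVT := vv ^ C.Ω i i

/-- `t_i = t^(i·i/2)`. -/
noncomputable def ti (i : I) : QVT := tt ^ C.Ω i i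

/-- `1 - 2 (i·j)/(i·i)`, a natural number for `i ≠ j`. -/
def serreN (i j : I) : ℕ := (1 - 2 * C.dot i j / C.dot i i).toNat

variable {A : Type*} [Ring A] [Algebra QVT A]

/-- The divided power `x^(n) = x^n / [n]!_{v_i,t_i}`. -/
noncomputable def divPow (i : I) (x : A) (n : ℕ) : A := (qFact (C.vi i) (C.ti i) n)⁻¹ • x ^ n

/-- The coefficient `(-1)^p t_i^(-p(p' - 2⟨i,j⟩/(i·i) + 2⟨j,i⟩/(i·i)))` of the quantum Serre
relations, where `t_i = t^(i·i/2)`. -/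
noncomputable def serreCoeff (i j : I) (p p' : ℕ) : QVT :=
  (-1) ^ p * tt ^ (-(p : ℤ) * (C.Ω i i * p' - C.Ω i j + C.Ω j i))

/-- Left-hand side of the quantum Serre relation for the `E_i`. -/
noncomputable def serreE (x : I → A) (i j : I) : A :=
  ∑ p ∈ Finset.HasAntidiagonal.antidiagonal (C.serreN i j),
    C.serreCoeff i j p.1 p.2 • (C.divPow i (x i) p.1 * x j * C.divPow i (x i) p.2)

/-- Left-hand side of the quantum Serre relation for the `F_i`. -/
noncomputable def serreF (x : I → A) (i j : I) : A :=
  ∑ p ∈ Finset.HasAntidiagonal.antidiagonal (C.serreN i j),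
    C.serreCoeff i j p.1 p.2 • (C.divPow i (x i) p.2 * x j * C.divPow i (x i) p.1)

theorem map_serreE {B : Type*} [Ring B] [Algebra QVT B] (f : A →ₐ[QVT] B) (x : I → A) (i j : I) :
    f (C.serreE x i j) = C.serreE (fun k => f (x k)) i j := by
  simp only [serreE, divPow, map_sum, map_smul, map_mul, map_pow]

theorem map_serreF {B : Type*} [Ring B] [Algebra QVT B] (f : A →ₐ[QVT] B) (x : I → A) (i j : I) :
    f (C.serreF x i j) = C.serreF (fun k => f (x k)) i j := by
  simp only [serreF, divPow, map_sum, map_smul, map_mul, map_pow]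

theorem vi_ne_zero (i : I) : C.vi i ≠ 0 := zpow_ne_zero _ vv_ne_zero

theorem ti_ne_zero (i : I) : C.ti i ≠ 0 := zpow_ne_zero _ tt_ne_zero

theorem bal_vi_ne_zero (i : I) (n : ℕ) (hn : 0 < n) : bal (C.vi i) n ≠ 0 := by
  obtain ⟨d, hd⟩ := Int.eq_ofNat_of_zero_le (C.diag_pos i).le
  have hd0 : 0 < d := by have := C.diag_pos i; omega
  have hv : C.vi i = vv ^ d := by rw [vi, hd, zpow_natCast]
  have key : ∀ m, 0 < m → C.vi i ^ m - (C.vi i)⁻¹ ^ m ≠ 0 := by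
    intro m hm h
    have h0 := C.vi_ne_zero i
    have h1 : C.vi i ^ (2 * m) = 1 := by
      rw [inv_pow, sub_eq_zero] at h
      rw [two_mul, pow_add]
      nth_rewrite 2 [h]
      exact mul_inv_cancel₀ (pow_ne_zero _ h0)
    rw [hv, ← pow_mul] at h1
    exact vv_pow_ne_one (by positivity) h1
  exact div_ne_zero (key n hn) (by simpa using key 1 one_pos)

/-- `⟨i,j⟩ - ⟨j,i⟩`. -/
def skew (i j : I) : ℤ := C.Ω i j - C.Ω j i

theorem serreE_eq (x : I → A) (i j : I) :
    C.serreE x i j = tt ^ (-(C.Ω i i * ((C.serreN i j).choose 2 : ℤ))) •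
      normSerre (tt ^ C.skew i j) (C.vi i) (C.serreN i j) (x i) (x j) := by
  rw [serreE, normSerre, Finset.smul_sum]
  refine Finset.sum_congr rfl fun p hp => ?_
  rw [Finset.HasAntidiagonal.mem_antidiagonal] at hp
  rw [divPow, divPow, smul_mul_assoc, smul_mul_assoc, mul_smul_comm, smul_smul, smul_smul, smul_smul]
  congr 1
  rw [qFact_eq _ _ (C.ti_ne_zero i), qFact_eq _ _ (C.ti_ne_zero i), serreCoeff]
  have ht : tt ^ (-(p.1 : ℤ) * (C.Ω i i * p.2 - C.Ω i j + C.Ω j i))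
      = tt ^ (-(C.Ω i i * ((C.serreN i j).choose 2 : ℤ))) * (tt ^ C.skew i j) ^ p.1 *
        (C.ti i ^ (p.1.choose 2) * C.ti i ^ (p.2.choose 2)) := by
    rw [ti, ← zpow_natCast, ← zpow_natCast, ← zpow_natCast, ← zpow_mul, ← zpow_mul, ← zpow_mul,
      ← zpow_add₀ tt_ne_zero, ← zpow_add₀ tt_ne_zero, ← zpow_add₀ tt_ne_zero]
    congr 1
    rw [← hp, choose_two_add]
    simp only [skew]
    push_cast
    ring
  have h1 : C.ti i ^ (p.1.choose 2) ≠ 0 := pow_ne_zero _ (C.ti_ne_zero i)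
  have h2 : C.ti i ^ (p.2.choose 2) ≠ 0 := pow_ne_zero _ (C.ti_ne_zero i)
  rw [ht, mul_inv, mul_inv, mul_inv]
  field_simp

theorem serreF_eq (x : I → A) (i j : I) :
    ∃ c : QVT, c ≠ 0 ∧ C.serreF x i j = c •
      normSerre (tt ^ (-C.skew i j)) (C.vi i) (C.serreN i j) (x i) (x j) := by
  refine ⟨tt ^ (-(C.Ω i i * ((C.serreN i j).choose 2 : ℤ))) *
    ((-1) ^ (C.serreN i j) * (tt ^ C.skew i j) ^ (C.serreN i j)), ?_, ?_⟩
  · exact mul_ne_zero (zpow_ne_zero _ tt_ne_zero) (mul_ne_zero (pow_ne_zero _ (by simp))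
      (pow_ne_zero _ (zpow_ne_zero _ tt_ne_zero)))
  rw [serreF, normSerre, Finset.smul_sum, ← Finset.Nat.sum_antidiagonal_swap]
  refine Finset.sum_congr rfl fun p hp => ?_
  rw [Finset.HasAntidiagonal.mem_antidiagonal] at hp
  simp only [Prod.fst_swap, Prod.snd_swap]
  rw [divPow, divPow, smul_mul_assoc, smul_mul_assoc, mul_smul_comm, smul_smul, smul_smul, smul_smul]
  congr 1
  rw [qFact_eq _ _ (C.ti_ne_zero i), qFact_eq _ _ (C.ti_ne_zero i), serreCoeff]
  have ht : tt ^ (-(p.2 : ℤ) * (C.Ω i i * p.1 - C.Ω i j + C.Ω j i))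
      = tt ^ (-(C.Ω i i * ((C.serreN i j).choose 2 : ℤ))) * ((tt ^ C.skew i j) ^ (C.serreN i j)
        * (tt ^ (-C.skew i j)) ^ p.1) *
        (C.ti i ^ (p.1.choose 2) * C.ti i ^ (p.2.choose 2)) := by
    rw [ti, ← zpow_natCast, ← zpow_natCast, ← zpow_natCast, ← zpow_natCast, ← zpow_mul, ← zpow_mul,
      ← zpow_mul, ← zpow_mul,
      ← zpow_add₀ tt_ne_zero, ← zpow_add₀ tt_ne_zero, ← zpow_add₀ tt_ne_zero,
      ← zpow_add₀ tt_ne_zero]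
    congr 1
    rw [← hp, choose_two_add]
    simp only [skew]
    push_cast
    ring
  have h1 : C.ti i ^ (p.1.choose 2) ≠ 0 := pow_ne_zero _ (C.ti_ne_zero i)
  have h2 : C.ti i ^ (p.2.choose 2) ≠ 0 := pow_ne_zero _ (C.ti_ne_zero i)
  have h3 : (-1 : QVT) ^ p.2 = (-1) ^ (C.serreN i j) * (-1) ^ p.1 := by
    rw [← hp, pow_add, mul_right_comm, ← mul_pow]; simp
  rw [ht, h3, mul_inv, mul_inv, mul_inv]
  field_simp

theorem serreN_spec {i j : I} (h : i ≠ j) :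
    C.Ω i i * ((C.serreN i j : ℤ) - 1) = -C.dot i j := by
  have hd := C.diag_pos i
  obtain ⟨k, hk⟩ := C.diag_dvd i j h
  have h1 := C.offdiag_nonpos i j h
  have h2 := C.offdiag_nonpos j i h.symm
  have e : 2 * C.dot i j / C.dot i i = k := by
    rw [dot, hk, dot]
    apply Int.ediv_eq_of_eq_mul_right (by omega)
    ring
  have hk0 : k ≤ 0 := by nlinarith
  rw [serreN, e, Int.toNat_of_nonneg (by omega), dot, hk]
  ring

theorem vv_dot_mul {i j : I} (h : i ≠ j) :
    vv ^ C.dot i j * C.vi i ^ ((C.serreN i j : ℤ) - 1) = 1 := by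
  rw [vi, ← zpow_mul, C.serreN_spec h, ← zpow_add₀ vv_ne_zero, add_neg_cancel, zpow_zero]

theorem serreN_pos {i j : I} (h : i ≠ j) : 0 < C.serreN i j := by
  have hd := C.diag_pos i
  have h0 := C.serreN_spec h
  have h1 := C.offdiag_nonpos i j h
  have h2 := C.offdiag_nonpos j i h.symm
  rw [dot] at h0
  by_contra hc
  have : C.serreN i j = 0 := by omega
  rw [this] at h0
  push_cast at h0
  nlinarith

end CartanDatum

/-- Generators of `U_{v,t}`; `Ki`, `Kpi` stand for the inverses of `K`, `Kp = K'`. -/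
inductive Gen (I : Type u) : Type u
  | E (i : I) | F (i : I) | K (i : I) | Ki (i : I) | Kp (i : I) | Kpi (i : I)

variable {I : Type u} [Fintype I] (C : CartanDatum I)

/-- The defining relations of `U_{v,t}`, for a family `g` of elements of an algebra. -/
structure Satisfies {A : Type*} [Ring A] [Algebra QVT A] (g : Gen I → A) : Prop where
  K_Ki : ∀ i, g (.K i) * g (.Ki i) = 1
  Ki_K : ∀ i, g (.Ki i) * g (.K i) = 1
  Kp_Kpi : ∀ i, g (.Kp i) * g (.Kpi i) = 1
  Kpi_Kp : ∀ i, g (.Kpi i) * g (.Kp i) = 1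
  K_K : ∀ i j, g (.K i) * g (.K j) = g (.K j) * g (.K i)
  Kp_Kp : ∀ i j, g (.Kp i) * g (.Kp j) = g (.Kp j) * g (.Kp i)
  K_Kp : ∀ i j, g (.K i) * g (.Kp j) = g (.Kp j) * g (.K i)
  K_E : ∀ i j, g (.K i) * g (.E j) * g (.Ki i) =
    (vv ^ C.dot i j * tt ^ (C.Ω j i - C.Ω i j)) • g (.E j)
  Kp_E : ∀ i j, g (.Kp i) * g (.E j) * g (.Kpi i) =
    (vv ^ (-C.dot i j) * tt ^ (C.Ω j i - C.Ω i j)) • g (.E j)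
  Kp_F : ∀ i j, g (.Kp i) * g (.F j) * g (.Kpi i) =
    (vv ^ C.dot i j * tt ^ (C.Ω i j - C.Ω j i)) • g (.F j)
  K_F : ∀ i j, g (.K i) * g (.F j) * g (.Ki i) =
    (vv ^ (-C.dot i j) * tt ^ (C.Ω i j - C.Ω j i)) • g (.F j)
  E_F : ∀ i, g (.E i) * g (.F i) - g (.F i) * g (.E i) =
    (C.vi i - (C.vi i)⁻¹)⁻¹ • (g (.K i) - g (.Kp i))
  E_F_ne : ∀ i j, i ≠ j → g (.E i) * g (.F j) - g (.F j) * g (.E i) = 0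
  serre_E : ∀ i j, i ≠ j → C.serreE (fun k => g (.E k)) i j = 0
  serre_F : ∀ i j, i ≠ j → C.serreF (fun k => g (.F k)) i j = 0

/-- The generators in the free algebra. -/
noncomputable def fgen (a : Gen I) : FreeAlgebra QVT (Gen I) := FreeAlgebra.ι QVT a

open Gen in
/-- The defining relations of `U_{v,t}`, as a relation on the free algebra. -/
inductive Rel : FreeAlgebra QVT (Gen I) → FreeAlgebra QVT (Gen I) → Prop
  | K_Ki (i) : Rel (fgen (K i) * fgen (Ki i)) 1
  | Ki_K (i) : Rel (fgen (Ki i) * fgen (K i)) 1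
  | Kp_Kpi (i) : Rel (fgen (Kp i) * fgen (Kpi i)) 1
  | Kpi_Kp (i) : Rel (fgen (Kpi i) * fgen (Kp i)) 1
  | K_K (i j) : Rel (fgen (K i) * fgen (K j)) (fgen (K j) * fgen (K i))
  | Kp_Kp (i j) : Rel (fgen (Kp i) * fgen (Kp j)) (fgen (Kp j) * fgen (Kp i))
  | K_Kp (i j) : Rel (fgen (K i) * fgen (Kp j)) (fgen (Kp j) * fgen (K i))
  | K_E (i j) : Rel (fgen (K i) * fgen (E j) * fgen (Ki i))
      ((vv ^ C.dot i j * tt ^ (C.Ω j i - C.Ω i j)) • fgen (E j))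
  | Kp_E (i j) : Rel (fgen (Kp i) * fgen (E j) * fgen (Kpi i))
      ((vv ^ (-C.dot i j) * tt ^ (C.Ω j i - C.Ω i j)) • fgen (E j))
  | Kp_F (i j) : Rel (fgen (Kp i) * fgen (F j) * fgen (Kpi i))
      ((vv ^ C.dot i j * tt ^ (C.Ω i j - C.Ω j i)) • fgen (F j))
  | K_F (i j) : Rel (fgen (K i) * fgen (F j) * fgen (Ki i))
      ((vv ^ (-C.dot i j) * tt ^ (C.Ω i j - C.Ω j i)) • fgen (F j))
  | E_F (i) : Rel (fgen (E i) * fgen (F i) - fgen (F i) * fgen (E i))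
      ((C.vi i - (C.vi i)⁻¹)⁻¹ • (fgen (K i) - fgen (Kp i)))
  | E_F_ne (i j) (h : i ≠ j) : Rel (fgen (E i) * fgen (F j) - fgen (F j) * fgen (E i)) 0
  | serre_E (i j) (h : i ≠ j) : Rel (C.serreE (fun k => fgen (E k)) i j) 0
  | serre_F (i j) (h : i ≠ j) : Rel (C.serreF (fun k => fgen (F k)) i j) 0

/-- The two-parameter quantum algebra `U_{v,t}`. -/
def U : Type u := RingQuot (Rel C)

noncomputable instance : Ring (U C) := inferInstanceAs (Ring (RingQuot (Rel C)))

noncomputable instance : Algebra QVT (U C) := inferInstanceAs (Algebra QVT (RingQuot (Rel C)))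

/-- The quotient map from the free algebra. -/
noncomputable def U.mk : FreeAlgebra QVT (Gen I) →ₐ[QVT] U C := RingQuot.mkAlgHom QVT (Rel C)

/-- The generators of `U_{v,t}`. -/
noncomputable def U.gen (a : Gen I) : U C := U.mk C (fgen a)

noncomputable def U.E (i : I) : U C := U.gen C (.E i)
noncomputable def U.F (i : I) : U C := U.gen C (.F i)
noncomputable def U.K (i : I) : U C := U.gen C (.K i)
noncomputable def U.Ki (i : I) : U C := U.gen C (.Ki i)
noncomputable def U.Kp (i : I) : U C := U.gen C (.Kp i)
noncomputable def U.Kpi (i : I) : U C := U.gen C (.Kpi i)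

theorem U.mk_rel {x y : FreeAlgebra QVT (Gen I)} (h : Rel C x y) : U.mk C x = U.mk C y :=
  RingQuot.mkAlgHom_rel QVT h

theorem U.satisfies : Satisfies C (U.gen C) where
  K_Ki i := by simpa [U.gen] using U.mk_rel C (Rel.K_Ki i)
  Ki_K i := by simpa [U.gen] using U.mk_rel C (Rel.Ki_K i)
  Kp_Kpi i := by simpa [U.gen] using U.mk_rel C (Rel.Kp_Kpi i)
  Kpi_Kp i := by simpa [U.gen] using U.mk_rel C (Rel.Kpi_Kp i)
  K_K i j := by simpa [U.gen] using U.mk_rel C (Rel.K_K i j)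
  Kp_Kp i j := by simpa [U.gen] using U.mk_rel C (Rel.Kp_Kp i j)
  K_Kp i j := by simpa [U.gen] using U.mk_rel C (Rel.K_Kp i j)
  K_E i j := by simpa only [U.gen, map_mul, map_smul] using U.mk_rel C (Rel.K_E i j)
  Kp_E i j := by simpa only [U.gen, map_mul, map_smul] using U.mk_rel C (Rel.Kp_E i j)
  Kp_F i j := by simpa only [U.gen, map_mul, map_smul] using U.mk_rel C (Rel.Kp_F i j)
  K_F i j := by simpa only [U.gen, map_mul, map_smul] using U.mk_rel C (Rel.K_F i j)
  E_F i := by simpa only [U.gen, map_mul, map_sub, map_smul] using U.mk_rel C (Rel.E_F i)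
  E_F_ne i j h := by
    simpa only [U.gen, map_mul, map_sub, map_zero] using U.mk_rel C (Rel.E_F_ne i j h)
  serre_E i j h := by
    simpa only [U.gen, C.map_serreE, map_zero] using U.mk_rel C (Rel.serre_E i j h)
  serre_F i j h := by
    simpa only [U.gen, C.map_serreF, map_zero] using U.mk_rel C (Rel.serre_F i j h)

section lift

variable {C} {A : Type*} [Ring A] [Algebra QVT A] {g : Gen I → A}

theorem Satisfies.lift_rel (hg : Satisfies C g) {x y : FreeAlgebra QVT (Gen I)} (h : Rel C x y) :
    FreeAlgebra.lift QVT g x = FreeAlgebra.lift QVT g y := by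
  have hι : ∀ a, FreeAlgebra.lift QVT g (fgen a) = g a := fun a => FreeAlgebra.lift_ι_apply _ _
  cases h with
  | K_Ki i => simpa [hι] using hg.K_Ki i
  | Ki_K i => simpa [hι] using hg.Ki_K i
  | Kp_Kpi i => simpa [hι] using hg.Kp_Kpi i
  | Kpi_Kp i => simpa [hι] using hg.Kpi_Kp i
  | K_K i j => simpa [hι] using hg.K_K i j
  | Kp_Kp i j => simpa [hι] using hg.Kp_Kp i j
  | K_Kp i j => simpa [hι] using hg.K_Kp i j
  | K_E i j => simpa only [hι, map_mul, map_smul] using hg.K_E i j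
  | Kp_E i j => simpa only [hι, map_mul, map_smul] using hg.Kp_E i j
  | Kp_F i j => simpa only [hι, map_mul, map_smul] using hg.Kp_F i j
  | K_F i j => simpa only [hι, map_mul, map_smul] using hg.K_F i j
  | E_F i => simpa only [hι, map_mul, map_sub, map_smul] using hg.E_F i
  | E_F_ne i j h => simpa only [hι, map_mul, map_sub, map_zero] using hg.E_F_ne i j h
  | serre_E i j h => simpa only [C.map_serreE, hι, map_zero] using hg.serre_E i j h
  | serre_F i j h => simpa only [C.map_serreF, hι, map_zero] using hg.serre_F i j h

/-- The algebra homomorphism out of `U_{v,t}` given by its values on generators. -/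
noncomputable def Satisfies.lift (hg : Satisfies C g) : U C →ₐ[QVT] A :=
  RingQuot.liftAlgHom QVT ⟨FreeAlgebra.lift QVT g, fun _ _ h => hg.lift_rel h⟩

theorem Satisfies.lift_gen (hg : Satisfies C g) (a : Gen I) : hg.lift (U.gen C a) = g a :=
  (RingQuot.liftAlgHom_mkAlgHom_apply QVT (FreeAlgebra.lift QVT g)
    (fun _ _ h => hg.lift_rel h) (fgen a)).trans (FreeAlgebra.lift_ι_apply _ _)

end lift

/-- Values of the comultiplication on generators. -/
noncomputable def comulGen : Gen I → U C ⊗[QVT] U C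
  | .E i => U.E C i ⊗ₜ 1 + U.K C i ⊗ₜ U.E C i
  | .F i => 1 ⊗ₜ U.F C i + U.F C i ⊗ₜ U.Kp C i
  | .K i => U.K C i ⊗ₜ U.K C i
  | .Ki i => U.Ki C i ⊗ₜ U.Ki C i
  | .Kp i => U.Kp C i ⊗ₜ U.Kp C i
  | .Kpi i => U.Kpi C i ⊗ₜ U.Kpi C i

/-- Values of the counit on generators. -/
noncomputable def counitGen : Gen I → QVT
  | .E _ => 0
  | .F _ => 0
  | _ => 1

namespace U

theorem K_mul_E (i j : I) : K C i * E C j =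
    (vv ^ C.dot i j * tt ^ (C.Ω j i - C.Ω i j)) • (E C j * K C i) := by
  have h := (satisfies C).K_E i j
  rw [← smul_mul_assoc, E, K, ← h, mul_assoc (gen C _ * gen C _), (satisfies C).Ki_K, mul_one]

theorem Kp_mul_E (i j : I) : Kp C i * E C j =
    (vv ^ (-C.dot i j) * tt ^ (C.Ω j i - C.Ω i j)) • (E C j * Kp C i) := by
  have h := (satisfies C).Kp_E i j
  rw [← smul_mul_assoc, E, Kp, ← h, mul_assoc (gen C _ * gen C _), (satisfies C).Kpi_Kp, mul_one]

theorem Kp_mul_F (i j : I) : Kp C i * F C j =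
    (vv ^ C.dot i j * tt ^ (C.Ω i j - C.Ω j i)) • (F C j * Kp C i) := by
  have h := (satisfies C).Kp_F i j
  rw [← smul_mul_assoc, F, Kp, ← h, mul_assoc (gen C _ * gen C _), (satisfies C).Kpi_Kp, mul_one]

theorem K_mul_F (i j : I) : K C i * F C j =
    (vv ^ (-C.dot i j) * tt ^ (C.Ω i j - C.Ω j i)) • (F C j * K C i) := by
  have h := (satisfies C).K_F i j
  rw [← smul_mul_assoc, F, K, ← h, mul_assoc (gen C _ * gen C _), (satisfies C).Ki_K, mul_one]

theorem K_conj (i j : I) : K C i * K C j * Ki C i = K C j := by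
  have h := (satisfies C).K_K i j
  have h2 := (satisfies C).K_Ki i
  rw [K, K, Ki, h, mul_assoc, h2, mul_one]

theorem Kp_conj (i j : I) : Kp C i * Kp C j * Kpi C i = Kp C j := by
  have h := (satisfies C).Kp_Kp i j
  have h2 := (satisfies C).Kp_Kpi i
  rw [Kp, Kp, Kpi, h, mul_assoc, h2, mul_one]

theorem K_conj_Kp (i j : I) : K C i * Kp C j * Ki C i = Kp C j := by
  have h := (satisfies C).K_Kp i j
  have h2 := (satisfies C).K_Ki i
  rw [K, Kp, Ki, h, mul_assoc, h2, mul_one]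

theorem Kp_conj_K (i j : I) : Kp C i * K C j * Kpi C i = K C j := by
  have h := (satisfies C).K_Kp j i
  have h2 := (satisfies C).Kp_Kpi i
  rw [K, Kp, Kpi, ← h, mul_assoc, h2, mul_one]

theorem dot_comm (i j : I) : C.dot i j = C.dot j i := by
  simp only [CartanDatum.dot]; ring

theorem cross (i j : I) : (K C i * F C j) ⊗ₜ[QVT] (E C i * Kp C j) =
    (F C j * K C i) ⊗ₜ[QVT] (Kp C j * E C i) := by
  rw [K_mul_F, Kp_mul_E, ← TensorProduct.smul_tmul', TensorProduct.tmul_smul, dot_comm C j i]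

theorem comm_EF (i j : I) : comulGen C (.E i) * comulGen C (.F j)
      - comulGen C (.F j) * comulGen C (.E i) =
    (E C i * F C j - F C j * E C i) ⊗ₜ[QVT] Kp C j
      + K C i ⊗ₜ[QVT] (E C i * F C j - F C j * E C i) := by
  simp only [comulGen, mul_add, add_mul, Algebra.TensorProduct.tmul_mul_tmul, one_mul, mul_one,
    TensorProduct.sub_tmul, TensorProduct.tmul_sub]
  rw [cross]
  abel

theorem serre_tmul_one {A B : Type*} [Ring A] [Algebra QVT A] [Ring B] [Algebra QVT B]
    (s q : QVT) (N : ℕ) (x y : A) (a b : B) (hab : a * b = b * a) :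
    normSerre s q N (x ⊗ₜ[QVT] a) (y ⊗ₜ[QVT] b) = normSerre s q N x y ⊗ₜ[QVT] (a ^ N * b) := by
  simp only [normSerre, TensorProduct.sum_tmul]
  refine Finset.sum_congr rfl fun p hp => ?_
  rw [Finset.HasAntidiagonal.mem_antidiagonal] at hp
  have hc : b * a ^ p.2 = a ^ p.2 * b := ((show Commute b a from hab.symm).pow_right p.2)
  rw [Algebra.TensorProduct.tmul_pow, Algebra.TensorProduct.tmul_pow,
    Algebra.TensorProduct.tmul_mul_tmul, Algebra.TensorProduct.tmul_mul_tmul, mul_assoc (a ^ _), hc,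
    ← mul_assoc, ← pow_add, hp, TensorProduct.smul_tmul']

theorem serre_one_tmul {A B : Type*} [Ring A] [Algebra QVT A] [Ring B] [Algebra QVT B]
    (s q : QVT) (N : ℕ) (x y : A) (a b : B) (hab : a * b = b * a) :
    normSerre s q N (a ⊗ₜ[QVT] x) (b ⊗ₜ[QVT] y) = (a ^ N * b) ⊗ₜ[QVT] normSerre s q N x y := by
  simp only [normSerre, TensorProduct.tmul_sum]
  refine Finset.sum_congr rfl fun p hp => ?_
  rw [Finset.HasAntidiagonal.mem_antidiagonal] at hp
  have hc : b * a ^ p.2 = a ^ p.2 * b := ((show Commute b a from hab.symm).pow_right p.2)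
  rw [Algebra.TensorProduct.tmul_pow, Algebra.TensorProduct.tmul_pow,
    Algebra.TensorProduct.tmul_mul_tmul, Algebra.TensorProduct.tmul_mul_tmul, mul_assoc (a ^ _), hc,
    ← mul_assoc, ← pow_add, hp, TensorProduct.tmul_smul]

theorem normSerre_E {i j : I} (h : i ≠ j) :
    normSerre (tt ^ C.skew i j) (C.vi i) (C.serreN i j) (E C i) (E C j) = 0 := by
  have h1 := (satisfies C).serre_E i j h
  rw [C.serreE_eq] at h1
  exact (smul_eq_zero.mp h1).resolve_left (zpow_ne_zero _ tt_ne_zero)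

theorem normSerre_F {i j : I} (h : i ≠ j) :
    normSerre (tt ^ (-C.skew i j)) (C.vi i) (C.serreN i j) (F C i) (F C j) = 0 := by
  have h1 := (satisfies C).serre_F i j h
  obtain ⟨c, hc, h2⟩ := C.serreF_eq (fun k => gen C (.F k)) i j
  rw [h2] at h1
  exact (smul_eq_zero.mp h1).resolve_left hc

theorem vi_sq (i : I) : C.vi i ^ 2 = vv ^ C.dot i i * tt ^ (C.Ω i i - C.Ω i i) := by
  rw [sub_self, zpow_zero, mul_one, CartanDatum.vi, CartanDatum.dot, zpow_add₀ vv_ne_zero, pow_two]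

end U

open U in
theorem comul_satisfies : Satisfies C (comulGen C) where
  K_Ki i := by
    simp only [comulGen, Algebra.TensorProduct.tmul_mul_tmul]
    rw [K, Ki, (satisfies C).K_Ki]; rfl
  Ki_K i := by
    simp only [comulGen, Algebra.TensorProduct.tmul_mul_tmul]
    rw [K, Ki, (satisfies C).Ki_K]; rfl
  Kp_Kpi i := by
    simp only [comulGen, Algebra.TensorProduct.tmul_mul_tmul]
    rw [Kp, Kpi, (satisfies C).Kp_Kpi]; rfl
  Kpi_Kp i := by
    simp only [comulGen, Algebra.TensorProduct.tmul_mul_tmul]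
    rw [Kp, Kpi, (satisfies C).Kpi_Kp]; rfl
  K_K i j := by
    simp only [comulGen, Algebra.TensorProduct.tmul_mul_tmul]
    rw [K, K, (satisfies C).K_K]
  Kp_Kp i j := by
    simp only [comulGen, Algebra.TensorProduct.tmul_mul_tmul]
    rw [Kp, Kp, (satisfies C).Kp_Kp]
  K_Kp i j := by
    simp only [comulGen, Algebra.TensorProduct.tmul_mul_tmul]
    rw [K, Kp, (satisfies C).K_Kp]
  K_E i j := by
    simp only [comulGen, mul_add, add_mul, Algebra.TensorProduct.tmul_mul_tmul, mul_one, K_conj]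
    rw [E, K, Ki, (satisfies C).K_Ki, (satisfies C).K_E, smul_add, TensorProduct.smul_tmul',
      TensorProduct.tmul_smul]
  Kp_E i j := by
    simp only [comulGen, mul_add, add_mul, Algebra.TensorProduct.tmul_mul_tmul, mul_one, Kp_conj_K]
    rw [E, Kp, Kpi, (satisfies C).Kp_Kpi, (satisfies C).Kp_E, smul_add, TensorProduct.smul_tmul',
      TensorProduct.tmul_smul]
  Kp_F i j := by
    simp only [comulGen, mul_add, add_mul, Algebra.TensorProduct.tmul_mul_tmul, mul_one, Kp_conj]
    rw [F, Kp, Kpi, (satisfies C).Kp_Kpi, (satisfies C).Kp_F, smul_add, ← TensorProduct.smul_tmul',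
      TensorProduct.tmul_smul]
  K_F i j := by
    simp only [comulGen, mul_add, add_mul, Algebra.TensorProduct.tmul_mul_tmul, mul_one, K_conj_Kp]
    rw [F, K, Ki, (satisfies C).K_Ki, (satisfies C).K_F, smul_add, ← TensorProduct.smul_tmul',
      TensorProduct.tmul_smul]
  E_F i := by
    rw [comm_EF, E, F, (satisfies C).E_F, ← TensorProduct.smul_tmul', TensorProduct.tmul_smul,
      ← smul_add, TensorProduct.sub_tmul, TensorProduct.tmul_sub]
    congr 1
    simp only [comulGen, K, Kp]
    abel
  E_F_ne i j h := by
    rw [comm_EF, E, F, (satisfies C).E_F_ne i j h, TensorProduct.zero_tmul, TensorProduct.tmul_zero,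
      add_zero]
  serre_E i j h := by
    rw [C.serreE_eq]
    simp only [comulGen]
    rw [normSerre_add _ _ (vv ^ C.dot i j) (zpow_ne_zero _ tt_ne_zero) (C.vi_ne_zero i)
      (C.bal_vi_ne_zero i) _ (C.vv_dot_mul h), serre_tmul_one _ _ _ _ _ _ _ rfl, normSerre_E C h,
      serre_one_tmul _ _ _ _ _ (K C i) (K C j) ((satisfies C).K_K i j), normSerre_E C h,
      TensorProduct.zero_tmul, TensorProduct.tmul_zero, add_zero, smul_zero]
    · simp only [Algebra.TensorProduct.tmul_mul_tmul, one_mul, mul_one]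
      rw [K_mul_E, TensorProduct.smul_tmul', vi_sq]
    · simp only [Algebra.TensorProduct.tmul_mul_tmul, one_mul, mul_one]
      rw [K_mul_E, TensorProduct.smul_tmul', ← zpow_neg, CartanDatum.skew, neg_sub]
    · simp only [Algebra.TensorProduct.tmul_mul_tmul, one_mul, mul_one]
      rw [K_mul_E, TensorProduct.smul_tmul', CartanDatum.skew, dot_comm]
  serre_F i j h := by
    obtain ⟨c, hc, h2⟩ := C.serreF_eq (fun k => comulGen C (.F k)) i j
    rw [h2]
    simp only [comulGen]
    rw [normSerre_add _ _ (vv ^ C.dot i j) (zpow_ne_zero _ tt_ne_zero) (C.vi_ne_zero i)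
      (C.bal_vi_ne_zero i) _ (C.vv_dot_mul h), serre_one_tmul _ _ _ _ _ _ _ rfl, normSerre_F C h,
      serre_tmul_one _ _ _ _ _ (Kp C i) (Kp C j) ((satisfies C).Kp_Kp i j), normSerre_F C h,
      TensorProduct.zero_tmul, TensorProduct.tmul_zero, add_zero, smul_zero]
    · simp only [Algebra.TensorProduct.tmul_mul_tmul, one_mul, mul_one]
      rw [Kp_mul_F, TensorProduct.tmul_smul, vi_sq]
    · simp only [Algebra.TensorProduct.tmul_mul_tmul, one_mul, mul_one]
      rw [Kp_mul_F, TensorProduct.tmul_smul, ← zpow_neg, neg_neg, CartanDatum.skew]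
    · simp only [Algebra.TensorProduct.tmul_mul_tmul, one_mul, mul_one]
      rw [Kp_mul_F, TensorProduct.tmul_smul, CartanDatum.skew, neg_sub, dot_comm]

/-- The comultiplication `Δ`. -/
noncomputable def comul : U C →ₐ[QVT] U C ⊗[QVT] U C := (comul_satisfies C).lift

theorem normSerre_zero (s q : QVT) {A : Type*} [Ring A] [Algebra QVT A] {N : ℕ} (x : A) :
    normSerre s q N x (0 : A) = 0 := by
  simp [normSerre]

theorem counit_satisfies : Satisfies C (counitGen (I := I)) where
  K_Ki i := by simp [counitGen]
  Ki_K i := by simp [counitGen]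
  Kp_Kpi i := by simp [counitGen]
  Kpi_Kp i := by simp [counitGen]
  K_K i j := by simp [counitGen]
  Kp_Kp i j := by simp [counitGen]
  K_Kp i j := by simp [counitGen]
  K_E i j := by simp [counitGen]
  Kp_E i j := by simp [counitGen]
  Kp_F i j := by simp [counitGen]
  K_F i j := by simp [counitGen]
  E_F i := by simp [counitGen]
  E_F_ne i j h := by simp [counitGen]
  serre_E i j h := by
    rw [C.serreE_eq]; simp [counitGen, normSerre_zero]
  serre_F i j h := by
    obtain ⟨c, hc, h2⟩ := C.serreF_eq (fun k => counitGen (I := I) (.F k)) i j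
    rw [h2]; simp [counitGen, normSerre_zero]

/-- The counit `ε`. -/
noncomputable def counit : U C →ₐ[QVT] QVT := (counit_satisfies C).lift

/-- The ring `U_{v,t}` with scalars acting through the bar involution of `ℚ(v,t)`; an algebra
homomorphism `U C →ₐ UTw C` is a bar-semilinear ring endomorphism of `U_{v,t}`. -/
def UTw : Type u := U C

noncomputable instance : Ring (UTw C) := inferInstanceAs (Ring (U C))

noncomputable instance : Algebra QVT (UTw C) := Algebra.compHom (U C) barQ

/-- Values of the bar involution on generators. -/
noncomputable def barGen : Gen I → UTw C
  | .E i => U.gen C (.E i)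
  | .F i => U.gen C (.F i)
  | .K i => U.gen C (.Kp i)
  | .Ki i => U.gen C (.Kpi i)
  | .Kp i => U.gen C (.K i)
  | .Kpi i => U.gen C (.Ki i)

theorem UTw_smul (c : QVT) (x : U C) : (c • (show UTw C from x) : UTw C) = (barQ c • x : U C) := rfl

theorem barQ_vi (i : I) : barQ (C.vi i) = (C.vi i)⁻¹ := by
  rw [CartanDatum.vi, map_zpow₀, barQ_vv, inv_zpow]

theorem barQ_bal (i : I) (n : ℕ) : barQ (bal (C.vi i) n) = bal (C.vi i) n := by
  rw [← bal_inv (C.vi i)]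
  simp only [bal, map_div₀, map_sub, map_pow, map_inv₀, barQ_vi, inv_inv]
  rw [← neg_sub, ← neg_sub (C.vi i), div_neg, neg_div]

theorem barQ_balFact (i : I) (n : ℕ) : barQ (balFact (C.vi i) n) = balFact (C.vi i) n := by
  simp only [balFact, map_prod, barQ_bal]

theorem UTw_normSerre (k : ℤ) (i : I) (N : ℕ) (x y : U C) :
    normSerre (A := UTw C) (tt ^ k) (C.vi i) N x y = normSerre (A := U C) (tt ^ k) (C.vi i) N x y := by
  unfold normSerre
  refine Finset.sum_congr rfl fun p _ => ?_
  refine (UTw_smul C _ (x ^ p.1 * y * x ^ p.2)).trans ?_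
  congr 1
  simp only [map_mul, map_pow, map_neg, map_one, map_inv₀, barQ_balFact, map_zpow₀, barQ_tt]

theorem barQ_coeff (m n : ℤ) : barQ (vv ^ m * tt ^ n) = vv ^ (-m) * tt ^ n := by
  rw [map_mul, map_zpow₀, map_zpow₀, barQ_vv, barQ_tt, inv_zpow, zpow_neg]

theorem bar_satisfies : Satisfies C (barGen C) where
  K_Ki i := (U.satisfies C).Kp_Kpi i
  Ki_K i := (U.satisfies C).Kpi_Kp i
  Kp_Kpi i := (U.satisfies C).K_Ki i
  Kpi_Kp i := (U.satisfies C).Ki_K i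
  K_K i j := (U.satisfies C).Kp_Kp i j
  Kp_Kp i j := (U.satisfies C).K_K i j
  K_Kp i j := ((U.satisfies C).K_Kp j i).symm
  K_E i j := by
    refine ((U.satisfies C).Kp_E i j).trans ?_
    rw [← barQ_coeff]; rfl
  Kp_E i j := by
    refine ((U.satisfies C).K_E i j).trans ?_
    rw [← neg_neg (C.dot i j), ← barQ_coeff, neg_neg]; rfl
  Kp_F i j := by
    refine ((U.satisfies C).K_F i j).trans ?_
    rw [← barQ_coeff]; rfl
  K_F i j := by
    refine ((U.satisfies C).Kp_F i j).trans ?_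
    rw [← neg_neg (C.dot i j), ← barQ_coeff, neg_neg]; rfl
  E_F i := by
    refine ((U.satisfies C).E_F i).trans ?_
    have : (C.vi i - (C.vi i)⁻¹)⁻¹ • (U.gen C (.K i) - U.gen C (.Kp i)) =
        barQ ((C.vi i - (C.vi i)⁻¹)⁻¹) • (U.gen C (.Kp i) - U.gen C (.K i)) := by
      rw [map_inv₀, map_sub, map_inv₀, barQ_vi, inv_inv, ← neg_sub (C.vi i), inv_neg, neg_smul,
        ← smul_neg, neg_sub]
    exact this
  E_F_ne i j h := (U.satisfies C).E_F_ne i j h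
  serre_E i j h := by
    rw [C.serreE_eq]
    refine (congrArg _ ((UTw_normSerre C _ _ _ _ _).trans (U.normSerre_E C h))).trans ?_
    exact smul_zero (M := QVT) (A := UTw C) _
  serre_F i j h := by
    obtain ⟨c, hc, h2⟩ := C.serreF_eq (fun k => barGen C (.F k)) i j
    rw [h2]
    refine (congrArg _ ((UTw_normSerre C _ _ _ _ _).trans (U.normSerre_F C h))).trans ?_
    exact smul_zero (M := QVT) (A := UTw C) _

/-- The bar involution of `U_{v,t}`: it fixes `E_i`, `F_i`, exchanges `K_i` and `K'_i`, and is
semilinear over the bar involution of `ℚ(v,t)`. -/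
noncomputable def bar : U C →ₛₗ[barQ] U C where
  toFun x := (bar_satisfies C).lift x
  map_add' x y := map_add (bar_satisfies C).lift x y
  map_smul' c x := map_smul (bar_satisfies C).lift c x

theorem bar_mul (x y : U C) : bar C (x * y) = bar C x * bar C y :=
  map_mul (bar_satisfies C).lift x y

theorem bar_gen (a : Gen I) : bar C (U.gen C a) = barGen C a := (bar_satisfies C).lift_gen a

/-- `Δ̄(x) = (bar ⊗ bar)(Δ(bar x))`. -/
noncomputable def comulBar (x : U C) : U C ⊗[QVT] U C :=
  TensorProduct.map (bar C) (bar C) (comul C (bar C x))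

section Words

variable {J A : Type*} [Ring A] [Algebra QVT A]

/-- Span of the monomials of length at least `N` in a family of elements. -/
noncomputable def wordSpan (f : J → A) (N : ℕ) : Submodule QVT A :=
  Submodule.span QVT {x | ∃ l : List J, N ≤ l.length ∧ x = (l.map f).prod}

theorem word_mem (f : J → A) {N : ℕ} (l : List J) (h : N ≤ l.length) :
    (l.map f).prod ∈ wordSpan f N := Submodule.subset_span ⟨l, h, rfl⟩

theorem wordSpan_anti (f : J → A) {M N : ℕ} (h : M ≤ N) : wordSpan f N ≤ wordSpan f M :=
  Submodule.span_mono fun _ ⟨l, hl, e⟩ => ⟨l, h.trans hl, e⟩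

theorem gen_mul_wordSpan (f : J → A) (N : ℕ) (j : J) {x : A} (hx : x ∈ wordSpan f N) :
    f j * x ∈ wordSpan f (N + 1) := by
  induction hx using Submodule.span_induction with
  | mem x hx =>
    obtain ⟨l, hl, rfl⟩ := hx
    have := word_mem f (N := N + 1) (j :: l) (by simpa using hl)
    simpa using this
  | zero => simp
  | add x y _ _ hx hy => rw [mul_add]; exact add_mem hx hy
  | smul c x _ hx => rw [mul_smul_comm]; exact Submodule.smul_mem _ _ hx

theorem wordSpan_mul_gen (f : J → A) (N : ℕ) (j : J) {x : A} (hx : x ∈ wordSpan f N) :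
    x * f j ∈ wordSpan f N := by
  induction hx using Submodule.span_induction with
  | mem x hx =>
    obtain ⟨l, hl, rfl⟩ := hx
    have := word_mem f (N := N) (l ++ [j]) (by simp; omega)
    simpa using this
  | zero => simp
  | add x y _ _ hx hy => rw [add_mul]; exact add_mem hx hy
  | smul c x _ hx => rw [smul_mul_assoc]; exact Submodule.smul_mem _ _ hx

theorem adjoin_eq_wordSpan (f : J → A) :
    Subalgebra.toSubmodule (Algebra.adjoin QVT (Set.range f)) = wordSpan f 0 := by
  apply le_antisymm
  · intro x hx
    have hx' : x ∈ Algebra.adjoin QVT (Set.range f) := hx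
    clear hx
    have hmul : ∀ x ∈ wordSpan f 0, ∀ y ∈ wordSpan f 0, x * y ∈ wordSpan f 0 := by
      intro x hx y hy
      induction hx using Submodule.span_induction with
      | mem x hx =>
        obtain ⟨l, -, rfl⟩ := hx
        induction l with
        | nil => simpa using hy
        | cons a l ih =>
          rw [List.map_cons, List.prod_cons, mul_assoc]
          exact wordSpan_anti f (Nat.zero_le 1) (gen_mul_wordSpan f 0 a ih)
      | zero => simp
      | add a b _ _ ha hb => rw [add_mul]; exact add_mem ha hb
      | smul c a _ ha => rw [smul_mul_assoc]; exact Submodule.smul_mem _ _ ha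
    induction hx' using Algebra.adjoin_induction with
    | mem x hx =>
      obtain ⟨j, rfl⟩ := hx
      simpa using word_mem f (N := 0) [j] (by simp)
    | algebraMap r =>
      rw [Algebra.algebraMap_eq_smul_one]
      exact Submodule.smul_mem _ _ (by simpa using word_mem f (N := 0) [] (by simp))
    | add x y _ _ hx hy => exact add_mem hx hy
    | mul x y _ _ hx hy => exact hmul x hx y hy
  · refine Submodule.span_le.mpr ?_
    rintro _ ⟨l, -, rfl⟩
    refine list_prod_mem (S := Algebra.adjoin QVT (Set.range f)) ?_
    intro x hx
    obtain ⟨j, -, rfl⟩ := List.mem_map.mp hx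
    exact Algebra.subset_adjoin ⟨j, rfl⟩

/-- What is needed of `E`, `F` and `U⁰` in order to move factors past each other. -/
structure TriData (e f : J → A) (Z : Subalgebra QVT A) : Prop where
  eZ : ∀ i, ∀ z ∈ Z, ∃ z' ∈ Z, e i * z = z' * e i
  Ze : ∀ i, ∀ z ∈ Z, ∃ z' ∈ Z, z * e i = e i * z'
  fZ : ∀ i, ∀ z ∈ Z, ∃ z' ∈ Z, f i * z = z' * f i
  Zf : ∀ i, ∀ z ∈ Z, ∃ z' ∈ Z, z * f i = f i * z'
  ef : ∀ i j, e i * f j - f j * e i ∈ Z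
  gen : Algebra.adjoin QVT (Set.range e ∪ Set.range f ∪ Z) = ⊤

/-- The subspace `A⁺ A⁰ A⁻_{≥ N}`. -/
noncomputable def triSpan (e f : J → A) (Z : Subalgebra QVT A) (N : ℕ) : Submodule QVT A :=
  wordSpan e 0 * Subalgebra.toSubmodule Z * wordSpan f N

variable {e f : J → A} {Z : Subalgebra QVT A}

theorem triSpan_anti {M N : ℕ} (h : M ≤ N) : triSpan e f Z N ≤ triSpan e f Z M :=
  mul_le_mul' le_rfl (wordSpan_anti f h)

theorem triSpan_induction {N : ℕ} {p : A → Prop}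
    (hp : ∀ x ∈ wordSpan e 0, ∀ z ∈ Z, ∀ y ∈ wordSpan f N, p (x * z * y))
    (hadd : ∀ a b, p a → p b → p (a + b)) {a : A} (ha : a ∈ triSpan e f Z N) : p a := by
  refine Submodule.mul_induction_on ha (fun m hm y hy => ?_) hadd
  refine Submodule.mul_induction_on (C := fun m => p (m * y)) hm (fun x hx z hz => hp x hx z hz y hy)
    fun a b ha hb => ?_
  rw [add_mul]
  exact hadd _ _ ha hb

theorem mem_triSpan {N : ℕ} {x z y : A} (hx : x ∈ wordSpan e 0) (hz : z ∈ Z)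
    (hy : y ∈ wordSpan f N) : x * z * y ∈ triSpan e f Z N :=
  Submodule.mul_mem_mul (Submodule.mul_mem_mul hx hz) hy

namespace TriData

theorem Z_word (h : TriData e f Z) (l : List J) : ∀ z ∈ Z, ∃ z' ∈ Z, z * (l.map e).prod = (l.map e).prod * z' := by
  induction l with
  | nil => intro z hz; exact ⟨z, hz, by simp⟩
  | cons a l ih =>
    intro z hz
    obtain ⟨z1, hz1, e1⟩ := h.Ze a z hz
    obtain ⟨z2, hz2, e2⟩ := ih z1 hz1
    exact ⟨z2, hz2, by rw [List.map_cons, List.prod_cons, ← mul_assoc, e1, mul_assoc, e2, mul_assoc]⟩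

theorem word_Z (h : TriData e f Z) (l : List J) : ∀ z ∈ Z, ∃ z' ∈ Z, (l.map f).prod * z = z' * (l.map f).prod := by
  induction l with
  | nil => intro z hz; exact ⟨z, hz, by simp⟩
  | cons a l ih =>
    intro z hz
    obtain ⟨z1, hz1, e1⟩ := ih z hz
    obtain ⟨z2, hz2, e2⟩ := h.fZ a z1 hz1
    exact ⟨z2, hz2, by rw [List.map_cons, List.prod_cons, mul_assoc, e1, ← mul_assoc, e2, mul_assoc]⟩

theorem Z_mul (h : TriData e f Z) {z x : A} (hz : z ∈ Z) (hx : x ∈ wordSpan e 0) :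
    z * x ∈ wordSpan e 0 * Subalgebra.toSubmodule Z := by
  induction hx using Submodule.span_induction with
  | mem x hx =>
    obtain ⟨l, hl, rfl⟩ := hx
    obtain ⟨z', hz', e1⟩ := h.Z_word l z hz
    rw [e1]
    exact Submodule.mul_mem_mul (word_mem e l hl) hz'
  | zero => simp
  | add x y _ _ hx hy => rw [mul_add]; exact add_mem hx hy
  | smul c x _ hx => rw [mul_smul_comm]; exact Submodule.smul_mem _ _ hx

theorem mul_Z (h : TriData e f Z) {N : ℕ} {z y : A} (hz : z ∈ Z) (hy : y ∈ wordSpan f N) :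
    y * z ∈ Subalgebra.toSubmodule Z * wordSpan f N := by
  induction hy using Submodule.span_induction with
  | mem x hx =>
    obtain ⟨l, hl, rfl⟩ := hx
    obtain ⟨z', hz', e1⟩ := h.word_Z l z hz
    rw [e1]
    exact Submodule.mul_mem_mul hz' (word_mem f l hl)
  | zero => simp
  | add x y _ _ hx hy => rw [add_mul]; exact add_mem hx hy
  | smul c x _ hx => rw [smul_mul_assoc]; exact Submodule.smul_mem _ _ hx

theorem f_word (h : TriData e f Z) (j : J) (l : List J) :
    f j * (l.map e).prod - (l.map e).prod * f j ∈ wordSpan e 0 * Subalgebra.toSubmodule Z := by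
  induction l with
  | nil => simp
  | cons a l ih =>
    rw [List.map_cons, List.prod_cons]
    set w := (l.map e).prod with hw
    have : f j * (e a * w) - e a * w * f j
        = -((e a * f j - f j * e a) * w) + e a * (f j * w - w * f j) := by noncomm_ring
    rw [this]
    refine add_mem (neg_mem (h.Z_mul (h.ef a j) (word_mem e l (Nat.zero_le _)))) ?_
    refine Submodule.mul_induction_on (C := fun x => e a * x ∈ _) ih (fun x hx z hz => ?_)
      fun x y hx hy => ?_
    · rw [← mul_assoc]
      exact Submodule.mul_mem_mul
        (wordSpan_anti e (Nat.zero_le 1) (gen_mul_wordSpan e 0 a hx)) hz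
    · rw [mul_add]; exact add_mem hx hy

theorem word_e (h : TriData e f Z) (i : J) (l : List J) :
    (l.map f).prod * e i - e i * (l.map f).prod ∈
      Subalgebra.toSubmodule Z * wordSpan f (l.length - 1) := by
  induction l with
  | nil => simp
  | cons a l ih =>
    rw [List.map_cons, List.prod_cons]
    set w := (l.map f).prod with hw
    have : f a * w * e i - e i * (f a * w)
        = -((e i * f a - f a * e i) * w) + f a * (w * e i - e i * w) := by noncomm_ring
    rw [this]
    refine add_mem (neg_mem (Submodule.mul_mem_mul (h.ef i a) (word_mem f l (by simp)))) ?_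
    refine Submodule.mul_induction_on (C := fun x => f a * x ∈ _) ih (fun z hz x hx => ?_)
      fun x y hx hy => ?_
    · obtain ⟨z', hz', e1⟩ := h.fZ a z hz
      rw [← mul_assoc, e1, mul_assoc]
      refine Submodule.mul_mem_mul hz' (wordSpan_anti f ?_ (gen_mul_wordSpan f _ a hx))
      simp; omega
    · rw [mul_add]; exact add_mem hx hy

theorem Z_PZ {N : ℕ} {m z y : A} (hm : m ∈ wordSpan e 0 * Subalgebra.toSubmodule Z) (hz : z ∈ Z)
    (hy : y ∈ wordSpan f N) : m * z * y ∈ triSpan e f Z N := by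
  refine Submodule.mul_mem_mul ?_ hy
  refine Submodule.mul_induction_on (C := fun m => m * z ∈ _) hm (fun x hx z' hz' => ?_)
    fun a b ha hb => ?_
  · rw [mul_assoc]; exact Submodule.mul_mem_mul hx (Z.mul_mem hz' hz)
  · rw [add_mul]; exact add_mem ha hb

theorem PZ_ZW {N : ℕ} {x z m : A} (hx : x ∈ wordSpan e 0) (hz : z ∈ Z)
    (hm : m ∈ Subalgebra.toSubmodule Z * wordSpan f N) : x * z * m ∈ triSpan e f Z N := by
  refine Submodule.mul_induction_on (C := fun m => x * z * m ∈ _) hm (fun z' hz' y hy => ?_)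
    fun a b ha hb => ?_
  · rw [← mul_assoc, mul_assoc x]
    exact mem_triSpan hx (Z.mul_mem hz hz') hy
  · rw [mul_add]; exact add_mem ha hb

theorem left_mem (h : TriData e f Z) (u : A) {N : ℕ} {a : A} (ha : a ∈ triSpan e f Z N) :
    u * a ∈ triSpan e f Z N := by
  have hu : u ∈ Algebra.adjoin QVT (Set.range e ∪ Set.range f ∪ Z) := by
    rw [h.gen]; trivial
  induction hu using Algebra.adjoin_induction generalizing a with
  | algebraMap r => rw [← Algebra.smul_def]; exact Submodule.smul_mem _ _ ha
  | add x y _ _ hx hy => rw [add_mul]; exact add_mem (hx ha) (hy ha)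
  | mul x y _ _ hx hy => rw [mul_assoc]; exact hx (hy ha)
  | mem u hu =>
    refine triSpan_induction (p := fun a => u * a ∈ triSpan e f Z N) ?_ ?_ ha
    swap
    · intro a b ha hb
      rw [mul_add]; exact add_mem ha hb
    intro x hx z hz y hy
    rcases hu with (⟨i, rfl⟩ | ⟨j, rfl⟩) | hu
    · rw [← mul_assoc, ← mul_assoc]
      exact mem_triSpan (wordSpan_anti e (Nat.zero_le 1) (gen_mul_wordSpan e 0 i hx)) hz hy
    · have key : f j * x - x * f j ∈ wordSpan e 0 * Subalgebra.toSubmodule Z := by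
        induction hx using Submodule.span_induction with
        | mem x hx =>
          obtain ⟨l, -, rfl⟩ := hx
          exact h.f_word j l
        | zero => simp
        | add x y _ _ hx hy =>
          have : f j * (x + y) - (x + y) * f j
            = (f j * x - x * f j) + (f j * y - y * f j) := by noncomm_ring
          rw [this]; exact add_mem hx hy
        | smul c x _ hx =>
          rw [mul_smul_comm, smul_mul_assoc, ← smul_sub]; exact Submodule.smul_mem _ _ hx
      obtain ⟨z', hz', e1⟩ := h.fZ j z hz
      have : f j * (x * z * y) = (f j * x - x * f j) * z * y + x * z' * (f j * y) := by
        rw [mul_assoc x z', ← mul_assoc z', ← e1]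
        noncomm_ring
      rw [this]
      exact add_mem (Z_PZ key hz hy)
        (mem_triSpan hx hz' (wordSpan_anti f (Nat.le_succ N) (gen_mul_wordSpan f N j hy)))
    · rw [← mul_assoc, ← mul_assoc]
      exact Z_PZ (h.Z_mul hu hx) hz hy

theorem right_mem (h : TriData e f Z) (u : A) : ∃ c : ℕ, ∀ N, ∀ a ∈ triSpan e f Z (N + c), a * u ∈ triSpan e f Z N := by
  have hu : u ∈ Algebra.adjoin QVT (Set.range e ∪ Set.range f ∪ Z) := by
    rw [h.gen]; trivial
  induction hu using Algebra.adjoin_induction with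
  | algebraMap r =>
    refine ⟨0, fun N a ha => ?_⟩
    rw [← Algebra.commutes, ← Algebra.smul_def]; exact Submodule.smul_mem _ _ ha
  | add x y _ _ hx hy =>
    obtain ⟨c, hc⟩ := hx
    obtain ⟨d, hd⟩ := hy
    refine ⟨c + d, fun N a ha => ?_⟩
    rw [mul_add]
    exact add_mem (hc N a (triSpan_anti (by omega) ha)) (hd N a (triSpan_anti (by omega) ha))
  | mul x y _ _ hx hy =>
    obtain ⟨c, hc⟩ := hx
    obtain ⟨d, hd⟩ := hy
    refine ⟨d + c, fun N a ha => ?_⟩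
    rw [← mul_assoc]
    exact hd N _ (hc (N + d) a (by rwa [add_assoc]))
  | mem u hu =>
    refine ⟨1, fun N a ha => ?_⟩
    refine triSpan_induction (p := fun a => a * u ∈ triSpan e f Z N) ?_ ?_ ha
    swap
    · intro a b ha hb
      rw [add_mul]; exact add_mem ha hb
    intro x hx z hz y hy
    have hy' := wordSpan_anti f (Nat.le_succ N) hy
    rcases hu with (⟨i, rfl⟩ | ⟨j, rfl⟩) | hu
    · have key : y * e i - e i * y ∈ Subalgebra.toSubmodule Z * wordSpan f N := by
        induction hy using Submodule.span_induction with
        | mem y hy =>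
          obtain ⟨l, hl, rfl⟩ := hy
          exact mul_le_mul' le_rfl (wordSpan_anti f (by omega)) (h.word_e i l)
        | zero => simp
        | add x y hx0 hy0 hx hy =>
          have : (x + y) * e i - e i * (x + y)
            = (x * e i - e i * x) + (y * e i - e i * y) := by noncomm_ring
          rw [this]
          exact add_mem (hx (wordSpan_anti f (Nat.le_succ N) hx0))
            (hy (wordSpan_anti f (Nat.le_succ N) hy0))
        | smul c x hx0 hx =>
          rw [mul_smul_comm, smul_mul_assoc, ← smul_sub]
          exact Submodule.smul_mem _ _ (hx (wordSpan_anti f (Nat.le_succ N) hx0))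
      obtain ⟨z', hz', e1⟩ := h.Ze i z hz
      have : x * z * y * e i = x * z * (y * e i - e i * y) + x * e i * z' * y := by
        rw [mul_assoc x (e i), ← e1]
        noncomm_ring
      rw [this]
      exact add_mem (PZ_ZW hx hz key) (mem_triSpan (wordSpan_mul_gen e 0 i hx) hz' hy')
    · rw [mul_assoc]
      exact mem_triSpan hx hz (wordSpan_mul_gen f N j hy')
    · rw [mul_assoc]
      exact PZ_ZW hx hz (h.mul_Z hu hy')

end TriData

end Words

/-- `U⁺`, generated by the `E_i`. -/
noncomputable def Uplus : Subalgebra QVT (U C) := Algebra.adjoin QVT (Set.range (U.E C))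

/-- `U⁻`, generated by the `F_i`. -/
noncomputable def Uminus : Subalgebra QVT (U C) := Algebra.adjoin QVT (Set.range (U.F C))

/-- `U⁰`, generated by the `K_i^{±1}` and `K'_i^{±1}`. -/
noncomputable def Uzero : Subalgebra QVT (U C) := Algebra.adjoin QVT
  (Set.range (U.K C) ∪ Set.range (U.Ki C) ∪ Set.range (U.Kp C) ∪ Set.range (U.Kpi C))

open Classical in
/-- The degree in `ℕ[I]` of a word in `I`. -/
noncomputable def wordDeg (l : List I) : I → ℕ := (l.map fun i => Pi.single i 1).sum

/-- `tr ν = ∑ ν_i`. -/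
def tr (ν : I → ℕ) : ℕ := ∑ i, ν i

/-- `U⁺_ν`, spanned by the monomials `E_{i₁} ⋯ E_{iₗ}` of degree `ν`. -/
noncomputable def UplusW (ν : I → ℕ) : Submodule QVT (U C) :=
  Submodule.span QVT {x | ∃ l : List I, wordDeg l = ν ∧ x = (l.map (U.E C)).prod}

/-- `U⁻_{-ν}`, spanned by the monomials `F_{i₁} ⋯ F_{iₗ}` of degree `ν`. -/
noncomputable def UminusW (ν : I → ℕ) : Submodule QVT (U C) :=
  Submodule.span QVT {x | ∃ l : List I, wordDeg l = ν ∧ x = (l.map (U.F C)).prod}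

/-- `U⁺ U⁰ (∑_{tr ν ≥ N} U⁻_{-ν})`. -/
noncomputable def leftFil (N : ℕ) : Submodule QVT (U C) :=
  Subalgebra.toSubmodule (Uplus C) * Subalgebra.toSubmodule (Uzero C) *
    ⨆ (ν : I → ℕ) (_ : N ≤ tr ν), UminusW C ν

/-- `U⁻ U⁰ (∑_{tr ν ≥ N} U⁺_ν)`. -/
noncomputable def rightFil (N : ℕ) : Submodule QVT (U C) :=
  Subalgebra.toSubmodule (Uminus C) * Subalgebra.toSubmodule (Uzero C) *
    ⨆ (ν : I → ℕ) (_ : N ≤ tr ν), UplusW C ν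

/-- The descending sequence of subspaces `H_N` of `U ⊗ U`: the sum of
`(U⁺ U⁰ ∑_{tr ν ≥ N} U⁻_{-ν}) ⊗ U` and `U ⊗ (U⁻ U⁰ ∑_{tr ν ≥ N} U⁺_ν)`. -/
noncomputable def HFil (N : ℕ) : Submodule QVT (U C ⊗[QVT] U C) :=
  Submodule.span QVT {z | ∃ a ∈ leftFil C N, ∃ b : U C, z = a ⊗ₜ b} ⊔
    Submodule.span QVT {z | ∃ a : U C, ∃ b ∈ rightFil C N, z = a ⊗ₜ b}

theorem tr_wordDeg (l : List I) : tr (wordDeg l) = l.length := by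
  classical
  induction l with
  | nil => simp [tr, wordDeg]
  | cons a l ih =>
    have : wordDeg (a :: l) = Pi.single a 1 + wordDeg l := by
      simp only [wordDeg, List.map_cons, List.sum_cons]
    rw [this, List.length_cons, ← ih]
    simp [tr, Finset.sum_add_distrib, add_comm]

theorem iSup_wordSpan {A : Type*} [Ring A] [Algebra QVT A] (f : I → A) (N : ℕ) :
    ⨆ (ν : I → ℕ) (_ : N ≤ tr ν),
      Submodule.span QVT {x | ∃ l : List I, wordDeg l = ν ∧ x = (l.map f).prod} = wordSpan f N := by
  apply le_antisymm
  · refine iSup₂_le fun ν hν => Submodule.span_mono ?_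
    rintro x ⟨l, hl, rfl⟩
    exact ⟨l, by rw [← tr_wordDeg, hl]; exact hν, rfl⟩
  · refine Submodule.span_le.mpr ?_
    rintro x ⟨l, hl, rfl⟩
    refine Submodule.mem_iSup_of_mem (wordDeg l) (Submodule.mem_iSup_of_mem ?_ ?_)
    · rw [tr_wordDeg]; exact hl
    · exact Submodule.subset_span ⟨l, rfl, rfl⟩

theorem leftFil_eq (N : ℕ) : leftFil C N = triSpan (U.E C) (U.F C) (Uzero C) N := by
  rw [leftFil, triSpan, Uplus, adjoin_eq_wordSpan, ← iSup_wordSpan (U.F C) N]; rfl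

theorem rightFil_eq (N : ℕ) : rightFil C N = triSpan (U.F C) (U.E C) (Uzero C) N := by
  rw [rightFil, triSpan, Uminus, adjoin_eq_wordSpan, ← iSup_wordSpan (U.E C) N]; rfl

theorem conj_comm {A : Type*} [Ring A] [Algebra QVT A] {k k' x : A} {c : QVT} (hc : c ≠ 0)
    (h2 : k' * k = 1) (h : k * x * k' = c • x) :
    k * x = c • (x * k) ∧ k' * x = c⁻¹ • (x * k') := by
  have e1 : k * x = c • (x * k) := by
    rw [← smul_mul_assoc, ← h, mul_assoc, h2, mul_one]
  refine ⟨e1, ?_⟩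
  have e2 : x * k' = c • (k' * x) := by
    rw [← mul_smul_comm, ← h, ← mul_assoc, ← mul_assoc, h2, one_mul]
  rw [e2, smul_smul, inv_mul_cancel₀ hc, one_smul]

/-- The generators of `U⁰` commute with `x` up to a nonzero scalar. -/
theorem zero_move (x : U C)
    (hK : ∀ i, ∃ c : QVT, c ≠ 0 ∧ U.K C i * x * U.Ki C i = c • x)
    (hKp : ∀ i, ∃ c : QVT, c ≠ 0 ∧ U.Kp C i * x * U.Kpi C i = c • x) :
    (∀ z ∈ Uzero C, ∃ z' ∈ Uzero C, x * z = z' * x) ∧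
    (∀ z ∈ Uzero C, ∃ z' ∈ Uzero C, z * x = x * z') := by
  have hgen : ∀ k ∈ (Set.range (U.K C) ∪ Set.range (U.Ki C) ∪ Set.range (U.Kp C) ∪
      Set.range (U.Kpi C)), ∃ c : QVT, c ≠ 0 ∧ k * x = c • (x * k) := by
    rintro k (((⟨i, rfl⟩ | ⟨i, rfl⟩) | ⟨i, rfl⟩) | ⟨i, rfl⟩)
    · obtain ⟨c, hc, h⟩ := hK i
      exact ⟨c, hc, (conj_comm hc ((U.satisfies C).Ki_K i) h).1⟩
    · obtain ⟨c, hc, h⟩ := hK i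
      exact ⟨c⁻¹, inv_ne_zero hc,
        (conj_comm hc ((U.satisfies C).Ki_K i) h).2⟩
    · obtain ⟨c, hc, h⟩ := hKp i
      exact ⟨c, hc, (conj_comm hc ((U.satisfies C).Kpi_Kp i) h).1⟩
    · obtain ⟨c, hc, h⟩ := hKp i
      exact ⟨c⁻¹, inv_ne_zero hc,
        (conj_comm hc ((U.satisfies C).Kpi_Kp i) h).2⟩
  constructor
  · intro z hz
    induction hz using Algebra.adjoin_induction with
    | mem k hk =>
      obtain ⟨c, hc, h⟩ := hgen k hk
      refine ⟨c⁻¹ • k, Subalgebra.smul_mem _ (Algebra.subset_adjoin hk) _, ?_⟩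
      rw [smul_mul_assoc, h, smul_smul, inv_mul_cancel₀ hc, one_smul]
    | algebraMap r => exact ⟨_, Subalgebra.algebraMap_mem _ r, (Algebra.commutes r x).symm⟩
    | add a b _ _ ha hb =>
      obtain ⟨a', ha', ea⟩ := ha
      obtain ⟨b', hb', eb⟩ := hb
      exact ⟨a' + b', add_mem ha' hb', by rw [mul_add, ea, eb, add_mul]⟩
    | mul a b _ _ ha hb =>
      obtain ⟨a', ha', ea⟩ := ha
      obtain ⟨b', hb', eb⟩ := hb
      exact ⟨a' * b', mul_mem ha' hb', by rw [← mul_assoc, ea, mul_assoc, eb, mul_assoc]⟩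
  · intro z hz
    induction hz using Algebra.adjoin_induction with
    | mem k hk =>
      obtain ⟨c, hc, h⟩ := hgen k hk
      refine ⟨c • k, Subalgebra.smul_mem _ (Algebra.subset_adjoin hk) _, ?_⟩
      rw [mul_smul_comm, h]
    | algebraMap r => exact ⟨_, Subalgebra.algebraMap_mem _ r, Algebra.commutes r x⟩
    | add a b _ _ ha hb =>
      obtain ⟨a', ha', ea⟩ := ha
      obtain ⟨b', hb', eb⟩ := hb
      exact ⟨a' + b', add_mem ha' hb', by rw [add_mul, ea, eb, mul_add]⟩
    | mul a b _ _ ha hb =>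
      obtain ⟨a', ha', ea⟩ := ha
      obtain ⟨b', hb', eb⟩ := hb
      exact ⟨a' * b', mul_mem ha' hb', by rw [mul_assoc, eb, ← mul_assoc, ea, mul_assoc]⟩

theorem coeff_ne_zero (m n : ℤ) : vv ^ m * tt ^ n ≠ 0 :=
  mul_ne_zero (zpow_ne_zero _ vv_ne_zero) (zpow_ne_zero _ tt_ne_zero)

theorem zero_move_E (j : I) :
    (∀ z ∈ Uzero C, ∃ z' ∈ Uzero C, U.E C j * z = z' * U.E C j) ∧
    (∀ z ∈ Uzero C, ∃ z' ∈ Uzero C, z * U.E C j = U.E C j * z') :=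
  zero_move C (U.E C j) (fun i => ⟨_, coeff_ne_zero _ _, (U.satisfies C).K_E i j⟩)
    (fun i => ⟨_, coeff_ne_zero _ _, (U.satisfies C).Kp_E i j⟩)

theorem zero_move_F (j : I) :
    (∀ z ∈ Uzero C, ∃ z' ∈ Uzero C, U.F C j * z = z' * U.F C j) ∧
    (∀ z ∈ Uzero C, ∃ z' ∈ Uzero C, z * U.F C j = U.F C j * z') :=
  zero_move C (U.F C j) (fun i => ⟨_, coeff_ne_zero _ _, (U.satisfies C).K_F i j⟩)
    (fun i => ⟨_, coeff_ne_zero _ _, (U.satisfies C).Kp_F i j⟩)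

theorem comm_EF_mem (i j : I) : U.E C i * U.F C j - U.F C j * U.E C i ∈ Uzero C := by
  by_cases h : i = j
  · subst h
    have h1 := (U.satisfies C).E_F i
    rw [U.E, U.F, h1]
    refine Subalgebra.smul_mem _ (sub_mem (Algebra.subset_adjoin ?_) (Algebra.subset_adjoin ?_)) _
    · exact Or.inl (Or.inl (Or.inl ⟨i, rfl⟩))
    · exact Or.inl (Or.inr ⟨i, rfl⟩)
  · have h1 := (U.satisfies C).E_F_ne i j h
    rw [U.E, U.F, h1]
    exact zero_mem _

theorem adjoin_gen : Algebra.adjoin QVT (Set.range (U.gen C)) = ⊤ := by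
  rw [eq_top_iff]
  rintro x -
  obtain ⟨y, rfl⟩ := RingQuot.mkAlgHom_surjective QVT (Rel C) x
  have : ∀ y : FreeAlgebra QVT (Gen I), U.mk C y ∈ Algebra.adjoin QVT (Set.range (U.gen C)) := by
    intro y
    induction y using FreeAlgebra.induction with
    | grade0 r => rw [AlgHom.commutes]; exact Subalgebra.algebraMap_mem _ r
    | grade1 a => exact Algebra.subset_adjoin ⟨a, rfl⟩
    | mul a b ha hb => rw [map_mul]; exact mul_mem ha hb
    | add a b ha hb => rw [map_add]; exact add_mem ha hb
  exact this y

theorem adjoin_EFZ : Algebra.adjoin QVT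
    (Set.range (U.E C) ∪ Set.range (U.F C) ∪ (Uzero C : Set (U C))) = ⊤ := by
  rw [eq_top_iff, ← adjoin_gen]
  refine Algebra.adjoin_le ?_
  rintro _ ⟨a, rfl⟩
  refine Algebra.subset_adjoin ?_
  cases a with
  | E i => exact Or.inl (Or.inl ⟨i, rfl⟩)
  | F i => exact Or.inl (Or.inr ⟨i, rfl⟩)
  | K i => exact Or.inr (Algebra.subset_adjoin (Or.inl (Or.inl (Or.inl ⟨i, rfl⟩))))
  | Ki i => exact Or.inr (Algebra.subset_adjoin (Or.inl (Or.inl (Or.inr ⟨i, rfl⟩))))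
  | Kp i => exact Or.inr (Algebra.subset_adjoin (Or.inl (Or.inr ⟨i, rfl⟩)))
  | Kpi i => exact Or.inr (Algebra.subset_adjoin (Or.inr ⟨i, rfl⟩))

theorem triData_EF : TriData (U.E C) (U.F C) (Uzero C) where
  eZ j := (zero_move_E C j).1
  Ze j := (zero_move_E C j).2
  fZ j := (zero_move_F C j).1
  Zf j := (zero_move_F C j).2
  ef := comm_EF_mem C
  gen := adjoin_EFZ C

theorem triData_FE : TriData (U.F C) (U.E C) (Uzero C) where
  eZ j := (zero_move_F C j).1
  Ze j := (zero_move_F C j).2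
  fZ j := (zero_move_E C j).1
  Zf j := (zero_move_E C j).2
  ef i j := by rw [← neg_sub]; exact neg_mem (comm_EF_mem C j i)
  gen := by rw [Set.union_comm (Set.range (U.F C))]; exact adjoin_EFZ C

theorem HFil_anti {M N : ℕ} (h : M ≤ N) : HFil C N ≤ HFil C M := by
  refine sup_le_sup (Submodule.span_mono ?_) (Submodule.span_mono ?_)
  · rintro _ ⟨a, ha, b, rfl⟩
    rw [leftFil_eq] at ha
    exact ⟨a, by rw [leftFil_eq]; exact triSpan_anti h ha, b, rfl⟩
  · rintro _ ⟨a, b, hb, rfl⟩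
    rw [rightFil_eq] at hb
    exact ⟨a, b, by rw [rightFil_eq]; exact triSpan_anti h hb, rfl⟩

theorem HFil_induction {N : ℕ} {p : U C ⊗[QVT] U C → Prop}
    (hl : ∀ a ∈ leftFil C N, ∀ b, p (a ⊗ₜ b)) (hr : ∀ a, ∀ b ∈ rightFil C N, p (a ⊗ₜ b))
    (h0 : p 0) (hadd : ∀ x y, p x → p y → p (x + y)) (hsmul : ∀ (c : QVT) x, p x → p (c • x))
    {z : U C ⊗[QVT] U C} (hz : z ∈ HFil C N) : p z := by
  obtain ⟨x, hx, y, hy, rfl⟩ := Submodule.mem_sup.mp hz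
  clear hz
  refine hadd _ _ ?_ ?_
  · induction hx using Submodule.span_induction with
    | mem x hx => obtain ⟨a, ha, b, rfl⟩ := hx; exact hl a ha b
    | zero => exact h0
    | add x y _ _ hx hy =>
      exact hadd _ _ hx hy
    | smul c x _ hx => exact hsmul _ _ hx
  · induction hy using Submodule.span_induction with
    | mem x hx => obtain ⟨a, b, hb, rfl⟩ := hx; exact hr a b hb
    | zero => exact h0
    | add x y _ _ hx hy => exact hadd _ _ hx hy
    | smul c x _ hx => exact hsmul _ _ hx

theorem tmul_mem_HFil_left {N : ℕ} {a : U C} (ha : a ∈ leftFil C N) (b : U C) :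
    a ⊗ₜ[QVT] b ∈ HFil C N := Submodule.mem_sup_left (Submodule.subset_span ⟨a, ha, b, rfl⟩)

theorem tmul_mem_HFil_right {N : ℕ} (a : U C) {b : U C} (hb : b ∈ rightFil C N) :
    a ⊗ₜ[QVT] b ∈ HFil C N := Submodule.mem_sup_right (Submodule.subset_span ⟨a, b, hb, rfl⟩)

theorem HFil_left (w : U C ⊗[QVT] U C) {N : ℕ} {z : U C ⊗[QVT] U C} (hz : z ∈ HFil C N) :
    w * z ∈ HFil C N := by
  induction w using TensorProduct.induction_on with
  | zero => simp
  | add x y hx hy => rw [add_mul]; exact add_mem hx hy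
  | tmul x y =>
    refine HFil_induction C (p := fun z => x ⊗ₜ[QVT] y * z ∈ HFil C N) ?_ ?_ ?_ ?_ ?_ hz
    · intro a ha b
      rw [Algebra.TensorProduct.tmul_mul_tmul]
      refine tmul_mem_HFil_left C ?_ _
      rw [leftFil_eq] at ha ⊢
      exact (triData_EF C).left_mem x ha
    · intro a b hb
      rw [Algebra.TensorProduct.tmul_mul_tmul]
      refine tmul_mem_HFil_right C _ ?_
      rw [rightFil_eq] at hb ⊢
      exact (triData_FE C).left_mem y hb
    · simp
    · intro a b ha hb; rw [mul_add]; exact add_mem ha hb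
    · intro c a ha; rw [mul_smul_comm]; exact Submodule.smul_mem _ _ ha

theorem HFil_right (w : U C ⊗[QVT] U C) :
    ∃ c : ℕ, ∀ N, ∀ z ∈ HFil C (N + c), z * w ∈ HFil C N := by
  induction w using TensorProduct.induction_on with
  | zero => exact ⟨0, fun N z _ => by simp⟩
  | add x y hx hy =>
    obtain ⟨c, hc⟩ := hx
    obtain ⟨d, hd⟩ := hy
    refine ⟨c + d, fun N z hz => ?_⟩
    rw [mul_add]
    exact add_mem (hc N z (HFil_anti C (by omega) hz)) (hd N z (HFil_anti C (by omega) hz))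
  | tmul x y =>
    obtain ⟨c, hc⟩ := (triData_EF C).right_mem x
    obtain ⟨d, hd⟩ := (triData_FE C).right_mem y
    refine ⟨c + d, fun N z hz => ?_⟩
    refine HFil_induction C (p := fun z => z * x ⊗ₜ[QVT] y ∈ HFil C N) ?_ ?_ ?_ ?_ ?_ hz
    · intro a ha b
      rw [Algebra.TensorProduct.tmul_mul_tmul]
      refine tmul_mem_HFil_left C ?_ _
      rw [leftFil_eq] at ha ⊢
      exact hc N a (triSpan_anti (by omega) ha)
    · intro a b hb
      rw [Algebra.TensorProduct.tmul_mul_tmul]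
      refine tmul_mem_HFil_right C _ ?_
      rw [rightFil_eq] at hb ⊢
      exact hd N b (triSpan_anti (by omega) hb)
    · simp
    · intro a b ha hb; rw [add_mul]; exact add_mem ha hb
    · intro c a ha; rw [smul_mul_assoc]; exact Submodule.smul_mem _ _ ha

theorem HFil_basis : RingSubgroupsBasis fun N : ℕ => (HFil C N).toAddSubgroup where
  inter i j := ⟨max i j, le_inf (HFil_anti C (le_max_left i j)) (HFil_anti C (le_max_right i j))⟩
  mul i := ⟨i, by
    rintro _ ⟨x, -, y, hy, rfl⟩
    exact HFil_left C x hy⟩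
  leftMul x i := ⟨i, fun y hy => HFil_left C x hy⟩
  rightMul x i := by
    obtain ⟨c, hc⟩ := HFil_right C x
    exact ⟨i + c, fun y hy => hc i y hy⟩

/-- The linear topology on `U ⊗ U` in which the `H_N` are a basis of neighbourhoods of `0`. -/
noncomputable instance : TopologicalSpace (U C ⊗[QVT] U C) := (HFil_basis C).topology

instance : IsTopologicalRing (U C ⊗[QVT] U C) :=
  (HFil_basis C).toRingFilterBasis.isTopologicalRing

noncomputable instance : UniformSpace (U C ⊗[QVT] U C) :=
  IsTopologicalAddGroup.rightUniformSpace (U C ⊗[QVT] U C)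

instance : IsUniformAddGroup (U C ⊗[QVT] U C) := isUniformAddGroup_of_addCommGroup

/-- The completion of `U ⊗ U` with respect to the `H_N`; it is a ring containing the image of
`U ⊗ U`. -/
abbrev UUhat : Type u := UniformSpace.Completion (U C ⊗[QVT] U C)

/-- `U_{≥0}`, generated by the `E_i` and `K_i^{±1}`. -/
noncomputable def Uge : Subalgebra QVT (U C) := Algebra.adjoin QVT
  (Set.range (U.E C) ∪ Set.range (U.K C) ∪ Set.range (U.Ki C))

/-- `U_{≤0}`, generated by the `F_i` and `K'_i^{±1}`. -/
noncomputable def Ule : Subalgebra QVT (U C) := Algebra.adjoin QVT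
  (Set.range (U.F C) ∪ Set.range (U.Kp C) ∪ Set.range (U.Kpi C))

noncomputable def geE (i : I) : Uge C :=
  ⟨U.E C i, Algebra.subset_adjoin (Or.inl (Or.inl ⟨i, rfl⟩))⟩

noncomputable def leF (i : I) : Ule C :=
  ⟨U.F C i, Algebra.subset_adjoin (Or.inl (Or.inl ⟨i, rfl⟩))⟩

/-- `K_i` as a unit of `U_{≥0}`. -/
noncomputable def geK (i : I) : (Uge C)ˣ where
  val := ⟨U.K C i, Algebra.subset_adjoin (Or.inl (Or.inr ⟨i, rfl⟩))⟩
  inv := ⟨U.Ki C i, Algebra.subset_adjoin (Or.inr ⟨i, rfl⟩)⟩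
  val_inv := Subtype.ext ((U.satisfies C).K_Ki i)
  inv_val := Subtype.ext ((U.satisfies C).Ki_K i)

/-- `K'_i` as a unit of `U_{≤0}`. -/
noncomputable def leKp (i : I) : (Ule C)ˣ where
  val := ⟨U.Kp C i, Algebra.subset_adjoin (Or.inl (Or.inr ⟨i, rfl⟩))⟩
  inv := ⟨U.Kpi C i, Algebra.subset_adjoin (Or.inr ⟨i, rfl⟩)⟩
  val_inv := Subtype.ext ((U.satisfies C).Kp_Kpi i)
  inv_val := Subtype.ext ((U.satisfies C).Kpi_Kp i)

theorem geK_comm (i j : I) : Commute (geK C i) (geK C j) :=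
  Units.ext (Subtype.ext ((U.satisfies C).K_K i j))

theorem leKp_comm (i j : I) : Commute (leKp C i) (leKp C j) :=
  Units.ext (Subtype.ext ((U.satisfies C).Kp_Kp i j))

/-- `K_μ = ∏ K_i^{μ_i}` for `μ ∈ ℤ[I]`. -/
noncomputable def geKmu (μ : I → ℤ) : (Uge C)ˣ :=
  Finset.univ.noncommProd (fun i => geK C i ^ μ i)
    fun i _ j _ _ => ((geK_comm C i j).zpow_zpow (μ i) (μ j))

/-- `K'_ν = ∏ K'_i^{ν_i}` for `ν ∈ ℤ[I]`. -/
noncomputable def leKpmu (ν : I → ℤ) : (Ule C)ˣ :=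
  Finset.univ.noncommProd (fun i => leKp C i ^ ν i)
    fun i _ j _ _ => ((leKp_comm C i j).zpow_zpow (ν i) (ν j))

theorem UplusW_le (ν : I → ℕ) : UplusW C ν ≤ Subalgebra.toSubmodule (Uge C) := by
  refine Submodule.span_le.mpr ?_
  rintro _ ⟨l, -, rfl⟩
  refine list_prod_mem (S := Uge C) fun x hx => ?_
  obtain ⟨j, -, rfl⟩ := List.mem_map.mp hx
  exact Algebra.subset_adjoin (Or.inl (Or.inl ⟨j, rfl⟩))

theorem UminusW_le (ν : I → ℕ) : UminusW C ν ≤ Subalgebra.toSubmodule (Ule C) := by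
  refine Submodule.span_le.mpr ?_
  rintro _ ⟨l, -, rfl⟩
  refine list_prod_mem (S := Ule C) fun x hx => ?_
  obtain ⟨j, -, rfl⟩ := List.mem_map.mp hx
  exact Algebra.subset_adjoin (Or.inl (Or.inl ⟨j, rfl⟩))

/-- The inclusion of `U⁺_ν` into `U_{≥0}`. -/
noncomputable def plusIncl (ν : I → ℕ) : UplusW C ν →ₗ[QVT] Uge C :=
  Submodule.inclusion (UplusW_le C ν)

/-- The inclusion of `U⁻_{-ν}` into `U_{≤0}`. -/
noncomputable def minusIncl (ν : I → ℕ) : UminusW C ν →ₗ[QVT] Ule C :=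
  Submodule.inclusion (UminusW_le C ν)

/-- For a bilinear map `φ`, the induced bilinear map on tensor squares,
`(x ⊗ x', y ⊗ y') ↦ φ(x,y) φ(x',y')`. -/
noncomputable def tensorPairing {X Y : Type*} [AddCommGroup X] [Module QVT X] [AddCommGroup Y]
    [Module QVT Y] (φ : X →ₗ[QVT] Y →ₗ[QVT] QVT) :
    X ⊗[QVT] X →ₗ[QVT] Y ⊗[QVT] Y →ₗ[QVT] QVT :=
  TensorProduct.lift ((LinearMap.compr₂ (TensorProduct.mapBilinear (RingHom.id QVT) Y Y QVT QVT)
    (LinearMap.compRight QVT (LinearMap.mul' QVT QVT))).compl₁₂ φ φ)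

theorem tensorPairing_tmul {X Y : Type*} [AddCommGroup X] [Module QVT X] [AddCommGroup Y]
    [Module QVT Y] (φ : X →ₗ[QVT] Y →ₗ[QVT] QVT) (x x' : X) (y y' : Y) :
    tensorPairing φ (x ⊗ₜ x') (y ⊗ₜ y') = φ x y * φ x' y' := by
  simp [tensorPairing]

/-- `φ` is a skew-Hopf pairing of `U_{≥0}` and `U_{≤0}`, that is `φ(1,y) = ε(y)`, `φ(x,1) = ε(x)`,
`φ(x,yy') = φ(Δ(x), y ⊗ y')` and `φ(xx',y) = φ(x ⊗ x', Δᵒᵖ(y))`, with the prescribed values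
`(E_i,F_j) = δ_{ij} (v_i⁻¹ - v_i)⁻¹` and
`(K_μ x, K'_ν y) = {μ,ν} {μ,|y|} {|x|,ν} (x,y)` for homogeneous `x ∈ U⁺` and `y ∈ U⁻`.
Here `z` is `Δ(x)`, resp. `Δ(y)`, seen in `U_{≥0} ⊗ U_{≥0}`, resp. `U_{≤0} ⊗ U_{≤0}`. -/
structure IsSkewHopfPairing (φ : Uge C →ₗ[QVT] Ule C →ₗ[QVT] QVT) : Prop where
  one_left : ∀ y : Ule C, φ 1 y = counit C y
  one_right : ∀ x : Uge C, φ x 1 = counit C x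
  mul_right : ∀ x : Uge C, ∃ z : Uge C ⊗[QVT] Uge C,
    TensorProduct.map (Uge C).val.toLinearMap (Uge C).val.toLinearMap z = comul C x ∧
      ∀ y y' : Ule C, φ x (y * y') = tensorPairing φ z (y ⊗ₜ y')
  mul_left : ∀ y : Ule C, ∃ z : Ule C ⊗[QVT] Ule C,
    TensorProduct.map (Ule C).val.toLinearMap (Ule C).val.toLinearMap z = comul C y ∧
      ∀ x x' : Uge C, φ (x * x') y =
        tensorPairing φ (x ⊗ₜ x') (TensorProduct.comm QVT (Ule C) (Ule C) z)
  E_F : ∀ i, φ (geE C i) (leF C i) = ((C.vi i)⁻¹ - C.vi i)⁻¹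
  E_F_ne : ∀ i j, i ≠ j → φ (geE C i) (leF C j) = 0
  K_mul : ∀ (μ ν : I → ℤ) (α β : I → ℕ) (x : UplusW C α) (y : UminusW C β),
    φ (geKmu C μ * plusIncl C α x) (leKpmu C ν * minusIncl C β y) =
      C.brace μ ν * C.brace μ (fun i => β i) * C.brace (fun i => α i) ν *
        φ (plusIncl C α x) (minusIncl C β y)

/-- `Θ_ν = ∑_{b ∈ B_ν} b ⊗ b*`, for a basis `B_ν = (b)` of `U⁻_{-ν}` and a basis `(b*)` of `U⁺_ν`
with the same index set. -/
noncomputable def quasiRComp {ν : I → ℕ} {ι : Type*} [Fintype ι]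
    (b : Module.Basis ι QVT (UminusW C ν)) (bs : Module.Basis ι QVT (UplusW C ν)) :
    U C ⊗[QVT] U C :=
  ∑ a, (b a : U C) ⊗ₜ[QVT] (bs a : U C)

/-- `Θ = ∑_ν Θ_ν` in the completion of `U ⊗ U`. -/
noncomputable def quasiR {ι : (I → ℕ) → Type*} [∀ ν, Fintype (ι ν)]
    (b : ∀ ν, Module.Basis (ι ν) QVT (UminusW C ν))
    (bs : ∀ ν, Module.Basis (ι ν) QVT (UplusW C ν)) : UUhat C :=
  ∑' ν, (quasiRComp C (b ν) (bs ν) : UUhat C)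

end TwoParam

open TwoParam

/-! Existence of a pairing. Everything rests on homomorphisms out of `U_{≥0}` and `U_{≤0}` with
prescribed values on generators. Both are defined as subalgebras of `U`, so it must be shown that
the evident relations among their generators suffice. For this, `U` acts on an abstractly presented
Borel algebra as on a universal lowest weight module: `E_i` and `K_i` act by left multiplication,
`K'_i` by a torus automorphism, `F_i` by a skew derivation killing `1`. The map `x ↦ x · 1` is then
a homomorphism from `U_{≥0}` to the Borel algebra taking generators to generators (`act_Uge`,
`geToBorel`). The half `U_{≤0}` is carried to the half `U_{≥0}` of the transposed datum by
exchanging `E` and `F` (`omega`).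

The pairing is `(x, y) = ε(ψ(y) x)`, where `ψ(y) x = x₁ (x₂, y)` is built from its values on the
generators of `U_{≤0}`: automorphisms `TK` for `K'_i` and skew derivations `TF` for `F_i`. The two
product axioms hold because `ψ` is a homomorphism whose operators act on the last factor of a
coproduct (`comulGe_psi`), and because `ψ(y)` acts on a product through the opposite coproduct
(`mul_psi₂`).

The delicate relation is always the Serre relation, and two mechanisms deal with it. A skew
derivation is a homomorphism to upper triangular `2 × 2` matrices, and the Serre expression of such
matrices is computed from its additivity on `q`-commuting summands (`serre_upTri`). For the lowering
operators themselves, the Serre expression commutes up to nonzero scalars with left multiplication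
by a generating family and kills `1`, so it vanishes (`serre_eq_zero_of_adjoin`).

Intertwining. For an arbitrary skew-Hopf pairing, left and right multiplication by `E_i` on `U_{≥0}`
have the adjoints `y ↦ y₁ (E_i, y₂)` and `y ↦ (E_i, y₁) y₂` on `U_{≤0}`, and for `y ∈ U⁻` these same
two maps give the commutator `E_i y - y E_i = (E_i, y₁) y₂ - K_i y₁ (E_i, y₂)` (`E_mul_minusZ`).
Since `Θ_ν` is the canonical element of a perfect pairing, an operator on its first factor may be
replaced by the adjoint on the second (`sum_transfer`). Hence `[E_i ⊗ 1, Θ_{ν+i}] = Θ_ν (K'_i ⊗ E_i)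
- (K_i ⊗ E_i) Θ_ν`, which is one homogeneous component of `Δ(E_i) Θ = Θ Δ̄(E_i)`. The generators
`F_i` are symmetric, and torus elements commute with every `Θ_ν`.

Finally, `Θ_ν ∈ H_N` as soon as `tr ν ≥ N`, so the series converges, and the component identities
are summed after shifting the index by `i` (`tsum_intertwine_shift`). As `Δ` and `Δ̄` are both
algebra homomorphisms, the generators of `U` suffice. -/

namespace TwoParam

universe u

/-! ### Upper triangular matrices, which encode skew derivations as homomorphisms. -/

section UpTri

variable {A : Type*} [Ring A]

/-- Upper triangular `2 × 2` matrices. -/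
def upTri (a d b : A) : Matrix (Fin 2) (Fin 2) A := !![a, d; 0, b]

theorem upTri_mul (a d b a' d' b' : A) :
    upTri a d b * upTri a' d' b' = upTri (a * a') (a * d' + d * b') (b * b') := by
  simp [upTri]

theorem upTri_add (a d b a' d' b' : A) :
    upTri a d b + upTri a' d' b' = upTri (a + a') (d + d') (b + b') := by
  simp [upTri]

theorem upTri_zero : upTri (0 : A) 0 0 = 0 := by
  ext i j; fin_cases i <;> fin_cases j <;> rfl

theorem upTri_one : upTri (1 : A) 0 1 = 1 := by
  rw [Matrix.one_fin_two]; rfl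

theorem upTri_injective {a d b a' d' b' : A} (h : upTri a d b = upTri a' d' b') :
    a = a' ∧ d = d' ∧ b = b' :=
  ⟨congrFun (congrFun h 0) 0, congrFun (congrFun h 0) 1, congrFun (congrFun h 1) 1⟩

end UpTri

/-! ### Serre expressions of upper triangular matrices. -/

section NormSerre

variable {A B : Type*} [Ring A] [Algebra QVT A] [Ring B] [Algebra QVT B]

theorem map_normSerre (f : A →ₐ[QVT] B) (s q : QVT) (N : ℕ) (x y : A) :
    f (normSerre s q N x y) = normSerre s q N (f x) (f y) := by
  simp only [normSerre, map_sum, map_smul, map_mul, map_pow]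

theorem normSerre_smul (s q : QVT) (N : ℕ) (α β : QVT) (x y : A) :
    normSerre s q N (α • x) (β • y) = (α ^ N * β) • normSerre s q N x y := by
  simp only [normSerre, Finset.smul_sum]
  refine Finset.sum_congr rfl fun p hp => ?_
  rw [Finset.HasAntidiagonal.mem_antidiagonal] at hp
  simp only [smul_pow, smul_mul_assoc, mul_smul_comm, smul_smul]
  congr 1
  rw [← hp]
  ring

theorem normSerre_zero_left (s q : QVT) {N : ℕ} (hN : 0 < N) (y : A) :
    normSerre s q N 0 y = 0 := by
  refine Finset.sum_eq_zero fun p hp => ?_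
  rw [Finset.HasAntidiagonal.mem_antidiagonal] at hp
  by_cases h : p.1 = 0
  · rw [zero_pow (show p.2 ≠ 0 by omega), mul_zero, smul_zero]
  · rw [zero_pow h, zero_mul, zero_mul, smul_zero]

theorem semiconj_normSerre (s q : QVT) (N : ℕ) {g x y x' y' : A} (hx : g * x = x' * g)
    (hy : g * y = y' * g) : g * normSerre s q N x y = normSerre s q N x' y' * g := by
  have hx : SemiconjBy g x x' := hx
  have hy : SemiconjBy g y y' := hy
  simp only [normSerre, Finset.mul_sum, Finset.sum_mul]
  refine Finset.sum_congr rfl fun p _ => ?_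
  rw [mul_smul_comm, smul_mul_assoc]
  congr 1
  exact ((hx.pow_right p.1).mul_right hy).mul_right (hx.pow_right p.2)

theorem upTri_smul (c : QVT) (a d b : A) : c • upTri a d b = upTri (c • a) (c • d) (c • b) := by
  simp [upTri]

theorem normSerre_diag (s q : QVT) (N : ℕ) (x y x' y' : A) :
    normSerre s q N (upTri x 0 x') (upTri y 0 y') =
      upTri (normSerre s q N x y) 0 (normSerre s q N x' y') := by
  have hpow : ∀ n, (upTri x 0 x') ^ n = upTri (x ^ n) 0 (x' ^ n) := by
    intro n
    induction n with
    | zero => simp [upTri_one]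
    | succ n ih => rw [pow_succ, ih, upTri_mul, pow_succ, pow_succ]; simp
  have hsum : ∀ (S : Finset (ℕ × ℕ)) (f g : ℕ × ℕ → A),
      ∑ p ∈ S, upTri (f p) 0 (g p) = upTri (∑ p ∈ S, f p) 0 (∑ p ∈ S, g p) := by
    intro S f g
    classical
    induction S using Finset.induction_on with
    | empty => simp [upTri_zero]
    | insert a S ha ih => simp only [Finset.sum_insert ha, ih, upTri_add, add_zero]
  simp only [normSerre, hpow, upTri_mul, upTri_smul, mul_zero, zero_mul, add_zero, smul_zero, hsum]

variable {s q w : QVT} (hs : s ≠ 0) (hq0 : q ≠ 0) (hq : ∀ n, 0 < n → bal q n ≠ 0) {N : ℕ}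
  (hw : w * q ^ ((N : ℤ) - 1) = 1) {x y a b : A}

include hs hq0 hq hw

/-- The matrix is the sum of a corner `-b`, a diagonal part and a corner `a`. The hypotheses say
exactly that these summands `q`-commute in the order required by `normSerre_add`, so the Serre
expression is the sum of those of the summands. The two corner summands are paired with `0` in the
second argument and contribute nothing. -/
theorem normSerre_upTri_left (hax : a * x = q ^ 2 • (x * a)) (hxb : x * b = q ^ 2 • (b * x))
    (hay : a * y = (w * s⁻¹) • (y * a)) (hyb : y * b = (w * s) • (b * y)) :
    normSerre s q N (upTri x (a - b) x) (upTri y 0 y) =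
      upTri (normSerre s q N x y) 0 (normSerre s q N x y) := by
  have e1 : upTri x (a - b) x = upTri x (-b) x + upTri 0 a 0 := by
    rw [upTri_add]; congr 1 <;> abel
  have e2 : upTri x (-b) x = upTri 0 (-b) 0 + upTri x 0 x := by
    rw [upTri_add]; congr 1 <;> abel
  have h1 := normSerre_add s q w hs hq0 hq N hw (upTri x (-b) x) (upTri 0 a 0) (upTri y 0 y) 0
    (by simp [upTri_mul, upTri_smul, hax]) (by simp [upTri_mul, upTri_smul, hay]) (by simp)
  have h2 := normSerre_add s q w hs hq0 hq N hw (upTri 0 (-b) 0) (upTri x 0 x) 0 (upTri y 0 y)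
    (by simp [upTri_mul, upTri_smul, hxb]) (by simp) (by simp [upTri_mul, upTri_smul, hyb])
  rw [add_zero, ← e1, normSerre_zero, add_zero] at h1
  rw [zero_add, ← e2, normSerre_zero, zero_add] at h2
  rw [h1, h2, normSerre_diag]

/-- The same splitting, with the corner now in the argument that occurs only once. The corner
summands are paired with `0` in the repeated argument, so `0 < N` is what makes them vanish. -/
theorem normSerre_upTri_right (hN : 0 < N) (hax : a * x = (w * s) • (x * a))
    (hxb : x * b = (w * s⁻¹) • (b * x)) :
    normSerre s q N (upTri x 0 x) (upTri y (a - b) y) =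
      upTri (normSerre s q N x y) 0 (normSerre s q N x y) := by
  have e1 : upTri y (a - b) y = upTri y (-b) y + upTri 0 a 0 := by
    rw [upTri_add]; congr 1 <;> abel
  have e2 : upTri y (-b) y = upTri 0 (-b) 0 + upTri y 0 y := by
    rw [upTri_add]; congr 1 <;> abel
  have h1 := normSerre_add s q w hs hq0 hq N hw (upTri x 0 x) 0 (upTri y (-b) y) (upTri 0 a 0)
    (by simp) (by simp) (by simp [upTri_mul, upTri_smul, hax])
  have h2 := normSerre_add s q w hs hq0 hq N hw 0 (upTri x 0 x) (upTri 0 (-b) 0) (upTri y 0 y)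
    (by simp) (by simp [upTri_mul, upTri_smul, hxb]) (by simp)
  rw [add_zero, ← e1, normSerre_zero_left _ _ hN, add_zero] at h1
  rw [zero_add, ← e2, normSerre_zero_left _ _ hN, zero_add] at h2
  rw [h1, h2, normSerre_diag]

/-- Conjugation by the unipotent matrix with corner `z` turns `diag(x, x)` into the matrix with
corner `z x - x z = a - b` and fixes `diag(y, y)`. By `normSerre_upTri_left` the Serre expression of
the conjugated matrices still has corner `0`, and this corner is the commutator of `z` with the
Serre expression. -/
theorem commute_normSerre_left {z : A} (hzx : z * x - x * z = a - b) (hzy : z * y = y * z)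
    (hax : a * x = q ^ 2 • (x * a)) (hxb : x * b = q ^ 2 • (b * x))
    (hay : a * y = (w * s⁻¹) • (y * a)) (hyb : y * b = (w * s) • (b * y)) :
    z * normSerre s q N x y = normSerre s q N x y * z := by
  have h := semiconj_normSerre s q N (g := upTri 1 z 1) (x := upTri x 0 x) (y := upTri y 0 y)
    (x' := upTri x (a - b) x) (y' := upTri y 0 y)
    (by rw [upTri_mul, upTri_mul, ← hzx]; simp) (by rw [upTri_mul, upTri_mul]; simp [hzy])
  rw [normSerre_upTri_left hs hq0 hq hw hax hxb hay hyb, normSerre_diag, upTri_mul, upTri_mul] at h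
  simpa using (upTri_injective h).2.1

theorem commute_normSerre_right {z : A} (hN : 0 < N) (hzx : z * x = x * z)
    (hzy : z * y - y * z = a - b) (hax : a * x = (w * s) • (x * a))
    (hxb : x * b = (w * s⁻¹) • (b * x)) :
    z * normSerre s q N x y = normSerre s q N x y * z := by
  have h := semiconj_normSerre s q N (g := upTri 1 z 1) (x := upTri x 0 x) (y := upTri y 0 y)
    (x' := upTri x 0 x) (y' := upTri y (a - b) y)
    (by rw [upTri_mul, upTri_mul]; simp [hzx]) (by rw [upTri_mul, upTri_mul, ← hzy]; simp)
  rw [normSerre_upTri_right hs hq0 hq hw hN hax hxb, normSerre_diag, upTri_mul, upTri_mul] at h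
  simpa using (upTri_injective h).2.1

end NormSerre

end TwoParam

/-! ### The transposed datum and the Borel algebra by generators and relations. -/

namespace TwoParam

universe u

variable {I : Type u} [Fintype I] (C : CartanDatum I)

namespace CartanDatum

/-- The value `{i, j}` of the multiplicative form on simple roots. -/
noncomputable def br (i j : I) : QVT := vv ^ C.dot i j * tt ^ (C.Ω j i - C.Ω i j)

theorem br_ne_zero (i j : I) : C.br i j ≠ 0 := coeff_ne_zero _ _

theorem br_inv (i j : I) : (C.br i j)⁻¹ = vv ^ (-C.dot i j) * tt ^ (C.Ω i j - C.Ω j i) := by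
  rw [br, mul_inv, ← zpow_neg, ← zpow_neg, neg_sub]

theorem br_swap_inv (i j : I) : (C.br j i)⁻¹ = vv ^ (-C.dot i j) * tt ^ (C.Ω j i - C.Ω i j) := by
  rw [br_inv, U.dot_comm]

theorem br_swap (i j : I) : C.br j i = vv ^ C.dot i j * tt ^ (C.Ω i j - C.Ω j i) := by
  rw [br, U.dot_comm]

theorem vi_sq (i : I) : C.vi i ^ 2 = C.br i i := U.vi_sq C i

theorem dot_mul_skew (i j : I) : vv ^ C.dot i j * tt ^ C.skew i j = C.br j i := by
  rw [br_swap, skew]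

theorem dot_mul_skew_inv (i j : I) : vv ^ C.dot i j * (tt ^ C.skew i j)⁻¹ = C.br i j := by
  rw [br, ← zpow_neg, skew, neg_sub]

/-- The Serre expression `E_i ⋯ E_j ⋯ E_i` in normalised form. -/
noncomputable def serre {A : Type*} [Ring A] [Algebra QVT A] (e : I → A) (i j : I) : A :=
  normSerre (tt ^ C.skew i j) (C.vi i) (C.serreN i j) (e i) (e j)

/-- The datum with transposed matrix. -/
def transpose : CartanDatum I where
  Ω i j := C.Ω j i
  diag_pos := C.diag_pos
  offdiag_nonpos i j h := C.offdiag_nonpos j i h.symm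
  diag_dvd i j h := by rw [add_comm]; exact C.diag_dvd i j h
  gcd_diag := C.gcd_diag

theorem transpose_br (i j : I) : C.transpose.br i j = C.br j i := by
  rw [br_swap]
  simp only [br, dot, transpose]
  rw [add_comm]

theorem transpose_vi (i : I) : C.transpose.vi i = C.vi i := rfl

theorem transpose_skew (i j : I) : C.transpose.skew i j = -C.skew i j := by
  simp [skew, transpose]

theorem transpose_dot (i j : I) : C.transpose.dot i j = C.dot i j := by
  simp only [dot, transpose]; rw [add_comm]

theorem transpose_serreN (i j : I) : C.transpose.serreN i j = C.serreN i j := by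
  simp only [serreN, transpose_dot]

section

variable {A B : Type*} [Ring A] [Algebra QVT A] [Ring B] [Algebra QVT B]

theorem map_serre (f : A →ₐ[QVT] B) (e : I → A) (i j : I) :
    f (C.serre e i j) = C.serre (fun k => f (e k)) i j := map_normSerre f _ _ _ _ _

open Classical in
/-- Serre expressions of upper triangular matrices whose corner is supported at one vertex. -/
theorem serre_upTri {i j : I} (h : i ≠ j) (e : I → A) (k : I) {a b : A}
    (ha : ∀ l, a * e l = C.br k l • (e l * a)) (hb : ∀ l, e l * b = C.br l k • (b * e l)) :
    C.serre (fun l => upTri (e l) (if l = k then a - b else 0) (e l)) i j =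
      upTri (C.serre e i j) 0 (C.serre e i j) := by
  simp only [serre]
  by_cases hi : i = k
  · subst hi
    rw [if_pos rfl, if_neg h.symm]
    refine normSerre_upTri_left (zpow_ne_zero _ tt_ne_zero) (C.vi_ne_zero i) (C.bal_vi_ne_zero i)
      (C.vv_dot_mul h) ?_ ?_ ?_ ?_
    · rw [vi_sq, ha]
    · rw [vi_sq, hb]
    · rw [dot_mul_skew_inv, ha]
    · rw [dot_mul_skew, hb]
  · rw [if_neg hi]
    by_cases hj : j = k
    · subst hj
      rw [if_pos rfl]
      refine normSerre_upTri_right (zpow_ne_zero _ tt_ne_zero) (C.vi_ne_zero i)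
        (C.bal_vi_ne_zero i) (C.vv_dot_mul h) (C.serreN_pos h) ?_ ?_
      · rw [dot_mul_skew, ha]
      · rw [dot_mul_skew_inv, hb]
    · rw [if_neg hj, normSerre_diag]

open Classical in
-- This is the pattern of `F_k` against the `E_l`: the commutator with `e l` is zero except at `l =
-- k`, where it is a difference of two elements behaving like torus elements. The cases `k = i` and
-- `k = j` are the two matrix computations; for any other `k` the element `z` commutes with both
-- letters.
theorem commute_serre {i j : I} (h : i ≠ j) (e : I → A) (k : I) {z a b : A}
    (hz : ∀ l, z * e l - e l * z = if l = k then a - b else 0)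
    (ha : ∀ l, a * e l = C.br k l • (e l * a)) (hb : ∀ l, e l * b = C.br l k • (b * e l)) :
    z * C.serre e i j = C.serre e i j * z := by
  unfold serre
  by_cases hi : i = k
  · subst hi
    refine commute_normSerre_left (zpow_ne_zero _ tt_ne_zero) (C.vi_ne_zero i) (C.bal_vi_ne_zero i)
      (C.vv_dot_mul h) (a := a) (b := b) ?_ ?_ ?_ ?_ ?_ ?_
    · rw [hz, if_pos rfl]
    · rw [← sub_eq_zero, hz, if_neg h.symm]
    · rw [vi_sq, ha]
    · rw [vi_sq, hb]
    · rw [dot_mul_skew_inv, ha]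
    · rw [dot_mul_skew, hb]
  · by_cases hj : j = k
    · subst hj
      refine commute_normSerre_right (zpow_ne_zero _ tt_ne_zero) (C.vi_ne_zero i)
        (C.bal_vi_ne_zero i) (C.vv_dot_mul h) (a := a) (b := b) (C.serreN_pos h) ?_ ?_ ?_ ?_
      · rw [← sub_eq_zero, hz, if_neg hi]
      · rw [hz, if_pos rfl]
      · rw [dot_mul_skew, ha]
      · rw [dot_mul_skew_inv, hb]
    · refine semiconj_normSerre _ _ _ ?_ ?_
      · rw [← sub_eq_zero, hz, if_neg hi]
      · rw [← sub_eq_zero, hz, if_neg hj]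

theorem serreE_eq_zero_iff (e : I → A) (i j : I) : C.serreE e i j = 0 ↔ C.serre e i j = 0 := by
  rw [serreE_eq, smul_eq_zero_iff_right (zpow_ne_zero _ tt_ne_zero), serre]

/-- Reading the sum backwards inverts `s = t^(⟨i,j⟩ - ⟨j,i⟩)`, and so does transposing `Ω`. Thus the
relations of the `F_i` are those of the `E_i` for the transposed datum, and only one kind of Borel
algebra is needed. -/
theorem serreF_eq_zero_iff (e : I → A) (i j : I) :
    C.serreF e i j = 0 ↔ C.transpose.serre e i j = 0 := by
  obtain ⟨c, hc, h⟩ := C.serreF_eq e i j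
  rw [h, smul_eq_zero_iff_right hc, serre, transpose_skew, transpose_serreN, transpose_vi]

end

end CartanDatum

/-- Generators of the Borel algebra. -/
inductive BGen (I : Type u) : Type u
  | e (i : I) | k (i : I) | ki (i : I)

/-- The defining relations of the Borel algebra, for a family of elements of an algebra. -/
structure BorelSat {A : Type*} [Ring A] [Algebra QVT A] (g : BGen I → A) : Prop where
  k_ki : ∀ i, g (.k i) * g (.ki i) = 1
  ki_k : ∀ i, g (.ki i) * g (.k i) = 1
  k_k : ∀ i j, g (.k i) * g (.k j) = g (.k j) * g (.k i)
  k_e : ∀ i j, g (.k i) * g (.e j) = C.br i j • (g (.e j) * g (.k i))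
  serre : ∀ i j, i ≠ j → C.serre (fun l => g (.e l)) i j = 0

/-- The generators in the free algebra. -/
noncomputable def bgen (a : BGen I) : FreeAlgebra QVT (BGen I) := FreeAlgebra.ι QVT a

open BGen in
/-- The defining relations of the Borel algebra, as a relation on the free algebra. -/
inductive BRel : FreeAlgebra QVT (BGen I) → FreeAlgebra QVT (BGen I) → Prop
  | k_ki (i) : BRel (bgen (k i) * bgen (ki i)) 1
  | ki_k (i) : BRel (bgen (ki i) * bgen (k i)) 1
  | k_k (i j) : BRel (bgen (k i) * bgen (k j)) (bgen (k j) * bgen (k i))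
  | k_e (i j) : BRel (bgen (k i) * bgen (e j)) (C.br i j • (bgen (e j) * bgen (k i)))
  | serre (i j) (h : i ≠ j) : BRel (C.serre (fun l => bgen (e l)) i j) 0

/-- The abstract Borel algebra. -/
def Borel : Type u := RingQuot (BRel C)

namespace Borel

noncomputable instance : Ring (Borel C) := inferInstanceAs (Ring (RingQuot (BRel C)))

noncomputable instance : Algebra QVT (Borel C) := inferInstanceAs (Algebra QVT (RingQuot (BRel C)))

noncomputable def mk : FreeAlgebra QVT (BGen I) →ₐ[QVT] Borel C := RingQuot.mkAlgHom QVT (BRel C)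

/-- The generators of the Borel algebra. -/
noncomputable def gen (a : BGen I) : Borel C := mk C (bgen a)

theorem mk_rel {x y : FreeAlgebra QVT (BGen I)} (h : BRel C x y) : mk C x = mk C y :=
  RingQuot.mkAlgHom_rel QVT h

theorem satisfies : BorelSat C (gen C) where
  k_ki i := by simpa [gen] using mk_rel C (BRel.k_ki i)
  ki_k i := by simpa [gen] using mk_rel C (BRel.ki_k i)
  k_k i j := by simpa [gen] using mk_rel C (BRel.k_k i j)
  k_e i j := by simpa only [gen, map_mul, map_smul] using mk_rel C (BRel.k_e i j)
  serre i j h := by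
    simpa only [gen, C.map_serre, map_zero] using mk_rel C (BRel.serre i j h)

theorem adjoin_gen : Algebra.adjoin QVT (Set.range (gen C)) = ⊤ := by
  rw [eq_top_iff]
  rintro x -
  obtain ⟨y, rfl⟩ := RingQuot.mkAlgHom_surjective QVT (BRel C) x
  have : ∀ y : FreeAlgebra QVT (BGen I), mk C y ∈ Algebra.adjoin QVT (Set.range (gen C)) := by
    intro y
    induction y using FreeAlgebra.induction with
    | grade0 r => rw [AlgHom.commutes]; exact Subalgebra.algebraMap_mem _ r
    | grade1 a => exact Algebra.subset_adjoin ⟨a, rfl⟩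
    | mul a b ha hb => rw [map_mul]; exact mul_mem ha hb
    | add a b ha hb => rw [map_add]; exact add_mem ha hb
  exact this y

end Borel

section lift

variable {C} {A : Type*} [Ring A] [Algebra QVT A] {g : BGen I → A}

theorem BorelSat.lift_rel (hg : BorelSat C g) {x y : FreeAlgebra QVT (BGen I)} (h : BRel C x y) :
    FreeAlgebra.lift QVT g x = FreeAlgebra.lift QVT g y := by
  have hι : ∀ a, FreeAlgebra.lift QVT g (bgen a) = g a := fun a => FreeAlgebra.lift_ι_apply _ _
  cases h with
  | k_ki i => simpa [hι] using hg.k_ki i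
  | ki_k i => simpa [hι] using hg.ki_k i
  | k_k i j => simpa [hι] using hg.k_k i j
  | k_e i j => simpa only [hι, map_mul, map_smul] using hg.k_e i j
  | serre i j h => simpa only [C.map_serre, hι, map_zero] using hg.serre i j h

/-- The algebra homomorphism out of the Borel algebra given by its values on generators. -/
noncomputable def BorelSat.lift (hg : BorelSat C g) : Borel C →ₐ[QVT] A :=
  RingQuot.liftAlgHom QVT ⟨FreeAlgebra.lift QVT g, fun _ _ h => hg.lift_rel h⟩

theorem BorelSat.lift_gen (hg : BorelSat C g) (a : BGen I) : hg.lift (Borel.gen C a) = g a :=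
  (RingQuot.liftAlgHom_mkAlgHom_apply QVT (FreeAlgebra.lift QVT g)
    (fun _ _ h => hg.lift_rel h) (bgen a)).trans (FreeAlgebra.lift_ι_apply _ _)

theorem BorelSat.map {B : Type*} [Ring B] [Algebra QVT B] (hg : BorelSat C g) (f : A →ₐ[QVT] B) :
    BorelSat C (fun a => f (g a)) where
  k_ki i := by rw [← map_mul, hg.k_ki, map_one]
  ki_k i := by rw [← map_mul, hg.ki_k, map_one]
  k_k i j := by rw [← map_mul, hg.k_k, map_mul]
  k_e i j := by rw [← map_mul, hg.k_e, map_smul, map_mul]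
  serre i j h := by rw [← C.map_serre f (fun l => g (.e l)), hg.serre i j h, map_zero]

theorem BorelSat.of_injective {B : Type*} [Ring B] [Algebra QVT B] (f : A →ₐ[QVT] B)
    (hf : Function.Injective f) (hg : BorelSat C (fun a => f (g a))) : BorelSat C g where
  k_ki i := hf (by rw [map_mul, hg.k_ki, map_one])
  ki_k i := hf (by rw [map_mul, hg.ki_k, map_one])
  k_k i j := hf (by rw [map_mul, hg.k_k, map_mul])
  k_e i j := hf (by rw [map_mul, hg.k_e, map_smul, map_mul])
  serre i j h := hf (by rw [C.map_serre, hg.serre i j h, map_zero])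

/-- Values of a torus automorphism on generators. -/
noncomputable def scaleGen (g : BGen I → A) (α β : I → QVT) : BGen I → A
  | .e i => α i • g (.e i)
  | .k i => β i • g (.k i)
  | .ki i => (β i)⁻¹ • g (.ki i)

/-- The relations are homogeneous in each generator separately, with `ki` of degree opposite to `k`.
All torus automorphisms below come from here. -/
theorem BorelSat.scale (hg : BorelSat C g) (α : I → QVT) {β : I → QVT} (hβ : ∀ i, β i ≠ 0) :
    BorelSat C (scaleGen g α β) where
  k_ki i := by simp [scaleGen, smul_smul, hg.k_ki, hβ i]
  ki_k i := by simp [scaleGen, smul_smul, hg.ki_k, hβ i]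
  k_k i j := by simp only [scaleGen, smul_mul_assoc, mul_smul_comm, smul_smul, hg.k_k i j, mul_comm]
  k_e i j := by
    simp only [scaleGen, smul_mul_assoc, mul_smul_comm, smul_smul, hg.k_e i j]
    congr 1; ring
  serre i j h := by
    have := hg.serre i j h
    simp only [CartanDatum.serre, scaleGen] at this ⊢
    rw [normSerre_smul, this, smul_zero]

end lift

end TwoParam

/-! ### The lowest weight action of `U` on the Borel algebra. -/

namespace TwoParam

universe u

/-- The induction runs over the stronger property that left multiplication by `x` preserves `p`,
which is stable under products. -/
theorem adjoin_mul_induction {A : Type*} [Ring A] [Algebra QVT A] {S : Set A}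
    (hS : Algebra.adjoin QVT S = ⊤) {p : A → Prop} (one : p 1) (add : ∀ x y, p x → p y → p (x + y))
    (smul : ∀ (c : QVT) x, p x → p (c • x)) (mul : ∀ s ∈ S, ∀ x, p x → p (s * x)) (x : A) : p x := by
  have hx : x ∈ Algebra.adjoin QVT S := by rw [hS]; trivial
  have key : ∀ y, p y → p (x * y) := by
    induction hx using Algebra.adjoin_induction with
    | mem s hs => exact mul s hs
    | algebraMap r => intro y hy; rw [← Algebra.smul_def]; exact smul r y hy
    | add a b _ _ ha hb => intro y hy; rw [add_mul]; exact add _ _ (ha y hy) (hb y hy)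
    | mul a b _ _ ha hb => intro y hy; rw [mul_assoc]; exact ha _ (hb y hy)
  simpa using key 1 one

variable {I : Type u} [Fintype I] (C : CartanDatum I)

namespace Borel

theorem induction {p : Borel C → Prop} (one : p 1) (add : ∀ x y, p x → p y → p (x + y))
    (smul : ∀ (c : QVT) x, p x → p (c • x)) (mul : ∀ a x, p x → p (gen C a * x)) (x : Borel C) :
    p x :=
  adjoin_mul_induction (adjoin_gen C) one add smul (by rintro _ ⟨a, rfl⟩; exact mul a) x

/-- Left multiplication by a generator. -/
noncomputable def L (a : BGen I) : Module.End QVT (Borel C) := Algebra.lmul QVT (Borel C) (gen C a)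

theorem L_apply (a : BGen I) (x : Borel C) : L C a x = gen C a * x := rfl

theorem L_satisfies : BorelSat C (L C) := (satisfies C).map (Algebra.lmul QVT (Borel C))

theorem L_k_ki (i : I) (x : Borel C) : gen C (.k i) * (gen C (.ki i) * x) = x := by
  rw [← mul_assoc, (satisfies C).k_ki, one_mul]

/-- The automorphism by which `K'_i` acts. -/
noncomputable def tau (i : I) : Borel C →ₐ[QVT] Borel C :=
  ((satisfies C).scale (fun j => (C.br j i)⁻¹) (β := fun _ => 1) (fun _ => one_ne_zero)).lift

/-- The automorphism by which the inverse of `K'_i` acts. -/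
noncomputable def tauInv (i : I) : Borel C →ₐ[QVT] Borel C :=
  ((satisfies C).scale (fun j => C.br j i) (β := fun _ => 1) (fun _ => one_ne_zero)).lift

theorem tau_e (i j : I) : tau C i (gen C (.e j)) = (C.br j i)⁻¹ • gen C (.e j) :=
  BorelSat.lift_gen _ _

theorem tau_k (i j : I) : tau C i (gen C (.k j)) = gen C (.k j) :=
  (BorelSat.lift_gen _ _).trans (one_smul _ _)

theorem tau_ki (i j : I) : tau C i (gen C (.ki j)) = gen C (.ki j) :=
  (BorelSat.lift_gen _ _).trans (by simp [scaleGen])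

theorem tauInv_e (i j : I) : tauInv C i (gen C (.e j)) = C.br j i • gen C (.e j) :=
  BorelSat.lift_gen _ _

theorem tauInv_k (i j : I) : tauInv C i (gen C (.k j)) = gen C (.k j) :=
  (BorelSat.lift_gen _ _).trans (one_smul _ _)

theorem tauInv_ki (i j : I) : tauInv C i (gen C (.ki j)) = gen C (.ki j) :=
  (BorelSat.lift_gen _ _).trans (by simp [scaleGen])

theorem algHom_ext {A : Type*} [Ring A] [Algebra QVT A] {f g : Borel C →ₐ[QVT] A}
    (h : ∀ a, f (gen C a) = g (gen C a)) : f = g :=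
  AlgHom.ext_of_adjoin_eq_top (adjoin_gen C) (by rintro _ ⟨a, rfl⟩; exact h a)

theorem tau_tauInv (i : I) (x : Borel C) : tau C i (tauInv C i x) = x := by
  refine DFunLike.congr_fun (f := (tau C i).comp (tauInv C i)) (g := AlgHom.id QVT _)
    (algHom_ext C fun a => ?_) x
  cases a <;> simp [tau_e, tau_k, tau_ki, tauInv_e, tauInv_k, tauInv_ki, smul_smul, C.br_ne_zero]

theorem tauInv_tau (i : I) (x : Borel C) : tauInv C i (tau C i x) = x := by
  refine DFunLike.congr_fun (f := (tauInv C i).comp (tau C i)) (g := AlgHom.id QVT _)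
    (algHom_ext C fun a => ?_) x
  cases a <;> simp [tau_e, tau_k, tau_ki, tauInv_e, tauInv_k, tauInv_ki, smul_smul, C.br_ne_zero]

theorem tau_comm (i j : I) (x : Borel C) : tau C i (tau C j x) = tau C j (tau C i x) := by
  refine DFunLike.congr_fun (f := (tau C i).comp (tau C j)) (g := (tau C j).comp (tau C i))
    (algHom_ext C fun a => ?_) x
  cases a <;> simp [tau_e, tau_k, tau_ki, smul_smul, mul_comm]

/-- `(v_i - v_i⁻¹)⁻¹`. -/
noncomputable def cf (i : I) : QVT := (C.vi i - (C.vi i)⁻¹)⁻¹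

open Classical in
/-- Values on generators of the homomorphism defining the action of `F_k`. -/
noncomputable def derGen (k : I) : BGen I → Matrix (Fin 2) (Fin 2) (Module.End QVT (Borel C))
  | .e j => upTri (L C (.e j))
      (if j = k then (-cf C k) • L C (.k k) - (-cf C k) • (tau C k).toLinearMap else 0) (L C (.e j))
  | .k j => upTri (C.br j k • L C (.k j)) 0 (L C (.k j))
  | .ki j => upTri ((C.br j k)⁻¹ • L C (.ki j)) 0 (L C (.ki j))

theorem L_e_tau (j k : I) : L C (.e j) * (tau C k).toLinearMap =
    C.br j k • ((tau C k).toLinearMap * L C (.e j)) := by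
  ext x
  simp [L_apply, tau_e, smul_smul, C.br_ne_zero]

theorem tau_L_k (j k : I) : (tau C k).toLinearMap * L C (.k j) =
    L C (.k j) * (tau C k).toLinearMap := by
  ext x
  simp [L_apply, tau_k]

/-- The entries are forced by the relations that `F_k` must satisfy as an operator. The diagonal
twist comes from `F_k K_j = {j,k} K_j F_k`, and the corner from `F_k E_k = E_k F_k - (K_k -
K'_k)/(v_k - v_k⁻¹)`. The two parts of this corner, left multiplication by `K_k` and the
automorphism by which `K'_k` acts, commute with the left multiplications by `E_l` up to the scalars
that `serre_upTri` requires. -/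
theorem derGen_satisfies (k : I) : BorelSat C (derGen C k) where
  k_ki i := by
    simp only [derGen, upTri_mul, (L_satisfies C).k_ki, smul_mul_assoc, mul_smul_comm, smul_smul,
      mul_zero, zero_mul, add_zero, one_smul,
      inv_mul_cancel₀ (C.br_ne_zero i k), upTri_one]
  ki_k i := by
    simp only [derGen, upTri_mul, (L_satisfies C).ki_k, smul_mul_assoc, mul_smul_comm, smul_smul,
      mul_zero, zero_mul, add_zero, mul_inv_cancel₀ (C.br_ne_zero i k), one_smul,
      upTri_one]
  k_k i j := by
    simp only [derGen, upTri_mul, (L_satisfies C).k_k i j, smul_mul_assoc, mul_smul_comm,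
      mul_zero, zero_mul, add_zero]
    rw [smul_comm]
  k_e i j := by
    simp only [derGen, upTri_mul, (L_satisfies C).k_e i j, smul_mul_assoc, mul_smul_comm,
      mul_zero, zero_mul, add_zero, zero_add, upTri_smul]
    congr 1
    · rw [smul_comm]
    · split_ifs with h
      · subst h
        simp only [mul_sub, sub_mul, mul_smul_comm, smul_mul_assoc, tau_L_k, (L_satisfies C).k_k i j]
      · simp
  serre i j h := by
    rw [show (fun l => derGen C k (.e l)) = fun l => upTri (L C (.e l)) _ (L C (.e l)) from rfl,
      C.serre_upTri h, (L_satisfies C).serre i j h, upTri_zero]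
    · intro l
      rw [smul_mul_assoc, (L_satisfies C).k_e, mul_smul_comm, smul_comm]
    · intro l
      rw [smul_mul_assoc, mul_smul_comm, L_e_tau, smul_comm]

noncomputable def derHom (k : I) : Borel C →ₐ[QVT] Matrix (Fin 2) (Fin 2) (Module.End QVT (Borel C)) :=
  (derGen_satisfies C k).lift

theorem derHom_gen (k : I) (a : BGen I) : derHom C k (gen C a) = derGen C k a :=
  BorelSat.lift_gen _ _

theorem derHom_bot (k : I) (x : Borel C) : derHom C k x 1 0 = 0 ∧ derHom C k x 1 1 = Algebra.lmul QVT _ x := by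
  induction x using induction with
  | one => exact ⟨by simp, by rw [map_one, map_one, Matrix.one_apply_eq]⟩
  | add x y hx hy => simp [hx, hy]
  | smul c x hx => simp [hx]
  | mul a x hx =>
    rw [map_mul, map_mul, derHom_gen]
    simp only [Matrix.mul_apply, Fin.sum_univ_two, hx]
    cases a <;> simp [derGen, upTri] <;> rfl

/-- The operator by which `F_k` acts on the Borel algebra. -/
noncomputable def der (k : I) : Module.End QVT (Borel C) where
  toFun x := derHom C k x 0 1 1
  map_add' x y := by simp
  map_smul' c x := by simp

/-- The corner of the image of `x` stands for the operator `F_k x - x' F_k`, where `x'` is the upper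
left entry. Evaluated at `1`, which `F_k` is to annihilate, it gives `F_k · x`; the rule below is
matrix multiplication read in this way. -/
theorem der_gen_mul (k : I) (a : BGen I) (x : Borel C) :
    der C k (gen C a * x) = derGen C k a 0 0 (der C k x) + derGen C k a 0 1 x := by
  simp [der, derHom_gen, Matrix.mul_apply, Fin.sum_univ_two, (derHom_bot C k x).2]

theorem der_one (k : I) : der C k 1 = 0 := by simp [der]

theorem der_k_mul (k j : I) (x : Borel C) :
    der C k (gen C (.k j) * x) = C.br j k • (gen C (.k j) * der C k x) := by
  rw [der_gen_mul]; simp [derGen, upTri, L_apply]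

theorem der_ki_mul (k j : I) (x : Borel C) :
    der C k (gen C (.ki j) * x) = (C.br j k)⁻¹ • (gen C (.ki j) * der C k x) := by
  rw [der_gen_mul]; simp [derGen, upTri, L_apply]

theorem der_e_mul (k : I) (x : Borel C) : der C k (gen C (.e k) * x) =
    gen C (.e k) * der C k x - cf C k • (gen C (.k k) * x - tau C k x) := by
  rw [der_gen_mul]; simp [derGen, upTri, L_apply, smul_sub]; abel

theorem der_e_mul_ne {k j : I} (h : j ≠ k) (x : Borel C) : der C k (gen C (.e j) * x) =
    gen C (.e j) * der C k x := by
  rw [der_gen_mul]; simp [derGen, upTri, L_apply, h]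

theorem tau_der (i k : I) (x : Borel C) :
    tau C i (der C k x) = C.br k i • der C k (tau C i x) := by
  induction x using induction with
  | one => simp [der_one]
  | add x y hx hy => simp [hx, hy]
  | smul c x hx => simp [hx, smul_comm c]
  | mul a x hx =>
    cases a with
    | e j =>
      by_cases h : j = k
      · subst h
        rw [der_e_mul, map_sub, map_mul, hx, map_smul, map_sub, map_mul, map_mul, tau_comm, tau_e,
          tau_k, smul_mul_assoc, smul_mul_assoc, map_smul, der_e_mul,
          mul_smul_comm, smul_smul, smul_smul, mul_inv_cancel₀ (C.br_ne_zero _ _),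
          inv_mul_cancel₀ (C.br_ne_zero _ _), one_smul, one_smul]
      · rw [der_e_mul_ne C h, map_mul, hx, map_mul, tau_e, smul_mul_assoc, smul_mul_assoc, map_smul,
          der_e_mul_ne C h, mul_smul_comm, smul_comm (C.br k i)]
    | k j => rw [der_k_mul, map_smul, map_mul, map_mul, tau_k, der_k_mul, hx, mul_smul_comm, smul_comm]
    | ki j =>
      rw [der_ki_mul, map_smul, map_mul, map_mul, tau_ki, der_ki_mul, hx, mul_smul_comm, smul_comm]

/-- The values on generators of the action of `U` on the Borel algebra. -/
noncomputable def actGen : Gen I → Module.End QVT (Borel C)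
  | .E i => L C (.e i)
  | .F i => der C i
  | .K i => L C (.k i)
  | .Ki i => L C (.ki i)
  | .Kp i => (tau C i).toLinearMap
  | .Kpi i => (tauInv C i).toLinearMap

theorem normSerre_apply_eq_zero {V : Type*} [AddCommGroup V] [Module QVT V] (s q : QVT) (N : ℕ)
    {x y : Module.End QVT V} {m : V} (hx : x m = 0) (hy : y m = 0) : normSerre s q N x y m = 0 := by
  rw [normSerre, LinearMap.sum_apply]
  refine Finset.sum_eq_zero fun p _ => ?_
  rw [LinearMap.smul_apply, Module.End.mul_apply, Module.End.mul_apply]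
  cases p.2 with
  | zero => simp [hy]
  | succ n => rw [pow_succ, Module.End.mul_apply, hx]; simp

open Classical in
/-- Operators which satisfy commutation relations with left multiplications by a generating family
satisfy the Serre relations as soon as they annihilate `1`. -/
theorem serre_eq_zero_of_adjoin {V : Type*} [Ring V] [Algebra QVT V] {g : BGen I → V}
    (hg : Algebra.adjoin QVT (Set.range g) = ⊤) (d a b : I → Module.End QVT V)
    (h1 : ∀ i, d i 1 = 0)
    (hE : ∀ k l, Algebra.lmul QVT V (g (.e k)) * d l - d l * Algebra.lmul QVT V (g (.e k)) =
      if l = k then a k - b k else 0)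
    (ha : ∀ k l, a k * d l = C.br k l • (d l * a k))
    (hb : ∀ k l, d l * b k = C.br l k • (b k * d l))
    (hk : ∀ k, ∃ c : I → QVT, (∀ l, c l ≠ 0) ∧ ∀ l, Algebra.lmul QVT V (g (.k k)) * d l =
      (c l • d l) * Algebra.lmul QVT V (g (.k k)))
    (hki : ∀ k, ∃ c : I → QVT, (∀ l, c l ≠ 0) ∧ ∀ l, Algebra.lmul QVT V (g (.ki k)) * d l =
      (c l • d l) * Algebra.lmul QVT V (g (.ki k)))
    {i j : I} (h : i ≠ j) : C.serre d i j = 0 := by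
  -- The Serre expression is homogeneous in its letters, so a map commuting with each `d l` up to a
  -- nonzero scalar commutes with the whole expression up to a nonzero scalar, and hence preserves
  -- its kernel.
  have hK : ∀ (f : Module.End QVT V), (∃ c : I → QVT, (∀ l, c l ≠ 0) ∧
      ∀ l, f * d l = (c l • d l) * f) → ∀ x, C.serre d i j x = 0 → C.serre d i j (f x) = 0 := by
    rintro f ⟨c, hc, hf⟩ x hx
    have h1 := semiconj_normSerre (tt ^ C.skew i j) (C.vi i) (C.serreN i j) (hf i) (hf j)
    rw [normSerre_smul, smul_mul_assoc] at h1
    have h2 := DFunLike.congr_fun h1 x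
    simp only [Module.End.mul_apply, LinearMap.smul_apply] at h2
    have hx' : normSerre (tt ^ C.skew i j) (C.vi i) (C.serreN i j) (d i) (d j) x = 0 := hx
    rw [hx', map_zero] at h2
    exact (smul_eq_zero.mp h2.symm).resolve_left
      (mul_ne_zero (pow_ne_zero _ (hc i)) (hc j))
  ext x
  rw [LinearMap.zero_apply]
  refine adjoin_mul_induction hg (p := fun x => C.serre d i j x = 0) ?_ ?_ ?_ ?_ x
  · exact normSerre_apply_eq_zero _ _ _ (h1 i) (h1 j)
  · intro x y hx hy
    rw [map_add, hx, hy, add_zero]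
  · intro c x hx
    rw [map_smul, hx, smul_zero]
  · rintro _ ⟨a', rfl⟩ x hx
    cases a' with
    | e k =>
      have := DFunLike.congr_fun (C.commute_serre h d k (hE k) (ha k) (hb k)) x
      simp only [Module.End.mul_apply, hx, map_zero] at this
      exact this.symm
    | k k => exact hK _ (hk k) x hx
    | ki k => exact hK _ (hki k) x hx

/-- Here the `F_l` are the letters and `E_k` is the element commuted past them, so compared with
`derGen_satisfies` the torus parts exchange roles: `K'_k` supplies `a` and `K_k` supplies `b`, for
the transposed datum. -/
theorem serre_der {i j : I} (h : i ≠ j) : C.transpose.serre (der C) i j = 0 := by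
  refine serre_eq_zero_of_adjoin C.transpose (adjoin_gen C) (der C)
    (fun k => (-cf C k) • (tau C k).toLinearMap) (fun k => (-cf C k) • L C (.k k)) (der_one C)
    ?_ ?_ ?_ ?_ ?_ h
  · intro k l
    split_ifs with hl
    · subst hl
      ext x
      simp [L_apply, der_e_mul, smul_sub]
      abel
    · ext x
      simp [der_e_mul_ne C (Ne.symm hl)]
  · intro k l
    ext x
    simp [C.transpose_br, tau_der, smul_comm (cf C k)]
  · intro k l
    ext x
    simp [C.transpose_br, L_apply, der_k_mul, smul_comm (cf C k)]
  · refine fun k => ⟨fun l => (C.br k l)⁻¹, fun l => inv_ne_zero (C.br_ne_zero _ _), fun l => ?_⟩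
    ext y
    simp [der_k_mul, smul_smul, C.br_ne_zero]
  · refine fun k => ⟨fun l => C.br k l, fun l => C.br_ne_zero _ _, fun l => ?_⟩
    ext y
    simp [der_ki_mul, smul_smul, C.br_ne_zero]

theorem act_satisfies : Satisfies C (actGen C) where
  K_Ki i := (L_satisfies C).k_ki i
  Ki_K i := (L_satisfies C).ki_k i
  Kp_Kpi i := LinearMap.ext fun x => tau_tauInv C i x
  Kpi_Kp i := LinearMap.ext fun x => tauInv_tau C i x
  K_K i j := (L_satisfies C).k_k i j
  Kp_Kp i j := LinearMap.ext fun x => tau_comm C i j x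
  K_Kp i j := (tau_L_k C i j).symm
  K_E i j := by
    simp only [actGen]
    rw [(L_satisfies C).k_e, smul_mul_assoc, mul_assoc, (L_satisfies C).k_ki, mul_one]; rfl
  Kp_E i j := by
    rw [← C.br_swap_inv]
    ext x
    simp [actGen, L_apply, tau_e, tau_tauInv]
  Kp_F i j := by
    ext x
    simp [actGen, tau_der, tau_tauInv, ← C.br_swap]
  K_F i j := by
    ext x
    simp only [actGen, ← C.br_inv, Module.End.mul_apply, L_apply, der_ki_mul, mul_smul_comm, L_k_ki,
      LinearMap.smul_apply]
  E_F i := by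
    ext x
    simp [actGen, L_apply, der_e_mul, cf]
  E_F_ne i j h := by
    ext x
    simp [actGen, L_apply, der_e_mul_ne C h]
  serre_E i j h := (C.serreE_eq_zero_iff _ i j).mpr ((L_satisfies C).serre i j h)
  serre_F i j h := (C.serreF_eq_zero_iff _ i j).mpr (serre_der C h)

/-- The action of `U` on the Borel algebra, a universal lowest weight module. -/
noncomputable def act : U C →ₐ[QVT] Module.End QVT (Borel C) := (act_satisfies C).lift

theorem act_gen (a : Gen I) : act C (U.gen C a) = actGen C a := Satisfies.lift_gen _ _

end Borel

/-! ### The presentation of `U_{≥0}`. -/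

section Presentation

/-- The generators of `U_{≥0}`. -/
noncomputable def geGen : BGen I → Uge C
  | .e i => geE C i
  | .k i => geK C i
  | .ki i => ((geK C i)⁻¹ : (Uge C)ˣ)

theorem geGen_satisfies : BorelSat C (geGen C) where
  k_ki i := Units.mul_inv _
  ki_k i := Units.inv_mul _
  k_k i j := Subtype.ext ((U.satisfies C).K_K i j)
  k_e i j := Subtype.ext (U.K_mul_E C i j)
  serre i j h := Subtype.ext (by
    refine (C.map_serre (Uge C).val _ i j).trans ?_
    exact U.normSerre_E C h)

theorem geGen_adjoin : Algebra.adjoin QVT (Set.range (geGen C)) = ⊤ := by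
  apply Subalgebra.map_injective (f := (Uge C).val) Subtype.val_injective
  rw [AlgHom.map_adjoin, Algebra.map_top, Subalgebra.range_val]
  refine congrArg (Algebra.adjoin QVT) ?_
  ext x
  constructor
  · rintro ⟨_, ⟨a, rfl⟩, rfl⟩
    cases a with
    | e i => exact Or.inl (Or.inl ⟨i, rfl⟩)
    | k i => exact Or.inl (Or.inr ⟨i, rfl⟩)
    | ki i => exact Or.inr ⟨i, rfl⟩
  · rintro ((⟨i, rfl⟩ | ⟨i, rfl⟩) | ⟨i, rfl⟩)
    · exact ⟨_, ⟨.e i, rfl⟩, rfl⟩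
    · exact ⟨_, ⟨.k i, rfl⟩, rfl⟩
    · exact ⟨_, ⟨.ki i, rfl⟩, rfl⟩

theorem Uge_induction {p : Uge C → Prop} (one : p 1) (add : ∀ x y, p x → p y → p (x + y))
    (smul : ∀ (c : QVT) x, p x → p (c • x)) (mul : ∀ a x, p x → p (geGen C a * x)) (x : Uge C) :
    p x :=
  adjoin_mul_induction (geGen_adjoin C) one add smul (by rintro _ ⟨a, rfl⟩; exact mul a) x

theorem Uge_algHom_ext {A : Type*} [Ring A] [Algebra QVT A] {f g : Uge C →ₐ[QVT] A}
    (h : ∀ a, f (geGen C a) = g (geGen C a)) : f = g :=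
  AlgHom.ext_of_adjoin_eq_top (geGen_adjoin C) (by rintro _ ⟨a, rfl⟩; exact h a)

theorem act_geGen (a : BGen I) : Borel.act C (geGen C a : U C) = Borel.L C a := by
  cases a <;> exact Borel.act_gen C _

/-- True for generators by construction of the action, and inherited by products. This is what makes
`x ↦ x · 1` multiplicative on `U_{≥0}`. -/
theorem act_Uge (x : Uge C) :
    Borel.act C (x : U C) = Algebra.lmul QVT (Borel C) (Borel.act C (x : U C) 1) := by
  induction x using Uge_induction with
  | one => rw [OneMemClass.coe_one, map_one, Module.End.one_apply, map_one]
  | add x y hx hy => rw [AddMemClass.coe_add, map_add, LinearMap.add_apply, map_add, ← hx, ← hy]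
  | smul c x hx => rw [SetLike.val_smul, map_smul, LinearMap.smul_apply, map_smul, ← hx]
  | mul a x hx =>
    rw [MulMemClass.coe_mul, map_mul, act_geGen, Module.End.mul_apply, Borel.L_apply, map_mul, ← hx]
    rfl

/-- The identification of `U_{≥0}` with the abstract Borel algebra. -/
noncomputable def geToBorel : Uge C →ₐ[QVT] Borel C :=
  AlgHom.ofLinearMap
    { toFun x := Borel.act C (x : U C) 1
      map_add' x y := by simp
      map_smul' c x := by simp }
    (by simp)
    (by
      intro x y
      change Borel.act C ((x : U C) * (y : U C)) 1 = _
      rw [map_mul, Module.End.mul_apply, act_Uge C x]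
      simp)

/-- This is the presentation of `U_{≥0}` in the form in which it is used: composed with `geToBorel`,
any homomorphism given by the Borel relations becomes one on the subalgebra `U_{≥0}`. -/
theorem geToBorel_gen (a : BGen I) : geToBorel C (geGen C a) = Borel.gen C a := by
  change Borel.act C (geGen C a : U C) 1 = _
  rw [act_geGen, Borel.L_apply, mul_one]

variable {C} {A : Type*} [Ring A] [Algebra QVT A] {g : BGen I → A}

/-- The homomorphism out of `U_{≥0}` with given values on generators. -/
noncomputable def BorelSat.liftGe (hg : BorelSat C g) : Uge C →ₐ[QVT] A :=
  hg.lift.comp (geToBorel C)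

theorem BorelSat.liftGe_gen (hg : BorelSat C g) (a : BGen I) : hg.liftGe (geGen C a) = g a := by
  rw [liftGe, AlgHom.comp_apply, geToBorel_gen, hg.lift_gen]

end Presentation

end TwoParam

namespace TwoParam

universe u

variable {I : Type u} [Fintype I] (C : CartanDatum I)

/-! ### The half `U_{≤0}` through the transposed datum. -/

section Omega

/-- Values on generators of the isomorphism exchanging the two halves. -/
noncomputable def omegaGen : Gen I → U C.transpose
  | .E i => U.F C.transpose i
  | .F i => U.E C.transpose i
  | .K i => U.Kp C.transpose i
  | .Ki i => U.Kpi C.transpose i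
  | .Kp i => U.K C.transpose i
  | .Kpi i => U.Ki C.transpose i

/-- Exchanging `E` with `F` changes the sign of the commutator, and exchanging `K` with `K'` changes
the sign of the right-hand side. The exponents of `t` in the torus relations are interchanged, which
is corrected by transposing `Ω`. -/
theorem omega_satisfies : Satisfies C (omegaGen C) where
  K_Ki i := (U.satisfies C.transpose).Kp_Kpi i
  Ki_K i := (U.satisfies C.transpose).Kpi_Kp i
  Kp_Kpi i := (U.satisfies C.transpose).K_Ki i
  Kpi_Kp i := (U.satisfies C.transpose).Ki_K i
  K_K i j := (U.satisfies C.transpose).Kp_Kp i j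
  Kp_Kp i j := (U.satisfies C.transpose).K_K i j
  K_Kp i j := ((U.satisfies C.transpose).K_Kp j i).symm
  K_E i j := by rw [← C.transpose_dot]; exact (U.satisfies C.transpose).Kp_F i j
  Kp_E i j := by rw [← C.transpose_dot]; exact (U.satisfies C.transpose).K_F i j
  Kp_F i j := by rw [← C.transpose_dot]; exact (U.satisfies C.transpose).K_E i j
  K_F i j := by rw [← C.transpose_dot]; exact (U.satisfies C.transpose).Kp_E i j
  E_F i := by
    have h := (U.satisfies C.transpose).E_F i
    simp only [omegaGen, U.E, U.F, U.K, U.Kp]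
    rw [← neg_sub, h, ← smul_neg, neg_sub]
    rfl
  E_F_ne i j h := by
    have h := (U.satisfies C.transpose).E_F_ne j i h.symm
    simp only [omegaGen, U.E, U.F]
    rw [← neg_sub, h, neg_zero]
  serre_E i j h := by
    rw [C.serreE_eq_zero_iff]
    exact (C.transpose.serreF_eq_zero_iff _ i j).mp ((U.satisfies C.transpose).serre_F i j h)
  serre_F i j h := by
    rw [C.serreF_eq_zero_iff]
    exact (C.transpose.serreE_eq_zero_iff _ i j).mp ((U.satisfies C.transpose).serre_E i j h)

noncomputable def omega : U C →ₐ[QVT] U C.transpose := (omega_satisfies C).lift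

theorem omega_gen (a : Gen I) : omega C (U.gen C a) = omegaGen C a := Satisfies.lift_gen _ _

/-- The generators of `U_{≤0}`. -/
noncomputable def leGen : BGen I → Ule C
  | .e i => leF C i
  | .k i => leKp C i
  | .ki i => ((leKp C i)⁻¹ : (Ule C)ˣ)

theorem leGen_satisfies : BorelSat C.transpose (leGen C) where
  k_ki i := Units.mul_inv _
  ki_k i := Units.inv_mul _
  k_k i j := Subtype.ext ((U.satisfies C).Kp_Kp i j)
  k_e i j := Subtype.ext (by
    rw [C.transpose_br, C.br_swap]
    exact U.Kp_mul_F C i j)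
  serre i j h := Subtype.ext (by
    refine (C.transpose.map_serre (Ule C).val _ i j).trans ?_
    exact (C.serreF_eq_zero_iff _ i j).mp ((U.satisfies C).serre_F i j h))

theorem leGen_adjoin : Algebra.adjoin QVT (Set.range (leGen C)) = ⊤ := by
  apply Subalgebra.map_injective (f := (Ule C).val) Subtype.val_injective
  rw [AlgHom.map_adjoin, Algebra.map_top, Subalgebra.range_val]
  refine congrArg (Algebra.adjoin QVT) ?_
  ext x
  constructor
  · rintro ⟨_, ⟨a, rfl⟩, rfl⟩
    cases a with
    | e i => exact Or.inl (Or.inl ⟨i, rfl⟩)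
    | k i => exact Or.inl (Or.inr ⟨i, rfl⟩)
    | ki i => exact Or.inr ⟨i, rfl⟩
  · rintro ((⟨i, rfl⟩ | ⟨i, rfl⟩) | ⟨i, rfl⟩)
    · exact ⟨_, ⟨.e i, rfl⟩, rfl⟩
    · exact ⟨_, ⟨.k i, rfl⟩, rfl⟩
    · exact ⟨_, ⟨.ki i, rfl⟩, rfl⟩

theorem Ule_induction {p : Ule C → Prop} (one : p 1) (add : ∀ x y, p x → p y → p (x + y))
    (smul : ∀ (c : QVT) x, p x → p (c • x)) (mul : ∀ a x, p x → p (leGen C a * x)) (x : Ule C) :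
    p x :=
  adjoin_mul_induction (leGen_adjoin C) one add smul (by rintro _ ⟨a, rfl⟩; exact mul a) x

theorem Ule_algHom_ext {A : Type*} [Ring A] [Algebra QVT A] {f g : Ule C →ₐ[QVT] A}
    (h : ∀ a, f (leGen C a) = g (leGen C a)) : f = g :=
  AlgHom.ext_of_adjoin_eq_top (leGen_adjoin C) (by rintro _ ⟨a, rfl⟩; exact h a)

theorem omega_leGen (a : BGen I) : omega C (leGen C a : U C) = geGen C.transpose a := by
  cases a <;> exact omega_gen C _

/-- The homomorphism from `U_{≤0}` to `U_{≥0}` of the transposed datum. -/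
noncomputable def leToGe : Ule C →ₐ[QVT] Uge C.transpose :=
  ((omega C).comp (Ule C).val).codRestrict (Uge C.transpose) (by
    intro x
    induction x using Ule_induction with
    | one => simp
    | add x y hx hy => rw [map_add]; exact add_mem hx hy
    | smul c x hx => rw [map_smul]; exact Subalgebra.smul_mem _ hx c
    | mul a x hx =>
      rw [map_mul]
      refine mul_mem ?_ hx
      rw [AlgHom.comp_apply, Subalgebra.val_apply, omega_leGen]
      exact Subtype.property _)

theorem leToGe_gen (a : BGen I) : leToGe C (leGen C a) = geGen C.transpose a :=
  Subtype.ext (omega_leGen C a)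

variable {C} {A : Type*} [Ring A] [Algebra QVT A] {g : BGen I → A}

/-- The homomorphism out of `U_{≤0}` with given values on generators. -/
noncomputable def BorelSat.liftLe (hg : BorelSat C.transpose g) : Ule C →ₐ[QVT] A :=
  hg.liftGe.comp (leToGe C)

theorem BorelSat.liftLe_gen (hg : BorelSat C.transpose g) (a : BGen I) :
    hg.liftLe (leGen C a) = g a := by
  rw [liftLe, AlgHom.comp_apply, leToGe_gen, hg.liftGe_gen]

end Omega

/-! ### Comultiplication and counit of the two halves. -/

section Coproduct

theorem comul_gen (a : Gen I) : comul C (U.gen C a) = comulGen C a := Satisfies.lift_gen _ _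

theorem counit_gen (a : Gen I) : counit C (U.gen C a) = counitGen a := Satisfies.lift_gen _ _

/-- Over a field every module is flat. Identities in the tensor square of a half can therefore be
checked in `U ⊗ U`, and an element of `U ⊗ U` has at most one preimage there. -/
theorem map_val_injective {A : Type*} [Ring A] [Algebra QVT A] (S : Subalgebra QVT A) :
    Function.Injective (Algebra.TensorProduct.map S.val S.val) :=
  TensorProduct.map_injective_of_flat_flat S.val.toLinearMap S.val.toLinearMap
    Subtype.val_injective Subtype.val_injective

/-- Values of the comultiplication of `U_{≥0}` on generators. -/
noncomputable def comulGeGen : BGen I → Uge C ⊗[QVT] Uge C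
  | .e i => geGen C (.e i) ⊗ₜ 1 + geGen C (.k i) ⊗ₜ geGen C (.e i)
  | .k i => geGen C (.k i) ⊗ₜ geGen C (.k i)
  | .ki i => geGen C (.ki i) ⊗ₜ geGen C (.ki i)

theorem map_comulGeGen (a : BGen I) :
    Algebra.TensorProduct.map (Uge C).val (Uge C).val (comulGeGen C a) = comul C (geGen C a) := by
  cases a with
  | e i => exact (map_add _ _ _).trans (comul_gen C (.E i)).symm
  | k i => exact (comul_gen C (.K i)).symm
  | ki i => exact (comul_gen C (.Ki i)).symm

/-- No new computation: inside `U ⊗ U` these elements are the images under `Δ` of the generators,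
which satisfy the relations, and the relations descend along the injection. -/
theorem comulGeGen_satisfies : BorelSat C (comulGeGen C) := by
  refine BorelSat.of_injective _ (map_val_injective (Uge C)) ?_
  simp only [map_comulGeGen]
  exact (geGen_satisfies C).map ((comul C).comp (Uge C).val)

/-- The comultiplication of `U_{≥0}`. -/
noncomputable def comulGe : Uge C →ₐ[QVT] Uge C ⊗[QVT] Uge C := (comulGeGen_satisfies C).liftGe

theorem comulGe_gen (a : BGen I) : comulGe C (geGen C a) = comulGeGen C a :=
  BorelSat.liftGe_gen _ _

theorem map_comulGe (x : Uge C) :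
    Algebra.TensorProduct.map (Uge C).val (Uge C).val (comulGe C x) = comul C x := by
  refine DFunLike.congr_fun (f := (Algebra.TensorProduct.map (Uge C).val (Uge C).val).comp (comulGe C))
    (g := (comul C).comp (Uge C).val) (Uge_algHom_ext C fun a => ?_) x
  rw [AlgHom.comp_apply, comulGe_gen, map_comulGeGen]
  rfl

/-- Values of the comultiplication of `U_{≤0}` on generators. -/
noncomputable def comulLeGen : BGen I → Ule C ⊗[QVT] Ule C
  | .e i => 1 ⊗ₜ leGen C (.e i) + leGen C (.e i) ⊗ₜ leGen C (.k i)
  | .k i => leGen C (.k i) ⊗ₜ leGen C (.k i)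
  | .ki i => leGen C (.ki i) ⊗ₜ leGen C (.ki i)

theorem map_comulLeGen (a : BGen I) :
    Algebra.TensorProduct.map (Ule C).val (Ule C).val (comulLeGen C a) = comul C (leGen C a) := by
  cases a with
  | e i => exact (map_add _ _ _).trans (comul_gen C (.F i)).symm
  | k i => exact (comul_gen C (.Kp i)).symm
  | ki i => exact (comul_gen C (.Kpi i)).symm

theorem comulLeGen_satisfies : BorelSat C.transpose (comulLeGen C) := by
  refine BorelSat.of_injective _ (map_val_injective (Ule C)) ?_
  simp only [map_comulLeGen]
  exact (leGen_satisfies C).map ((comul C).comp (Ule C).val)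

/-- The comultiplication of `U_{≤0}`. -/
noncomputable def comulLe : Ule C →ₐ[QVT] Ule C ⊗[QVT] Ule C := (comulLeGen_satisfies C).liftLe

theorem comulLe_gen (a : BGen I) : comulLe C (leGen C a) = comulLeGen C a :=
  BorelSat.liftLe_gen _ _

theorem map_comulLe (x : Ule C) :
    Algebra.TensorProduct.map (Ule C).val (Ule C).val (comulLe C x) = comul C x := by
  refine DFunLike.congr_fun (f := (Algebra.TensorProduct.map (Ule C).val (Ule C).val).comp (comulLe C))
    (g := (comul C).comp (Ule C).val) (Ule_algHom_ext C fun a => ?_) x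
  rw [AlgHom.comp_apply, comulLe_gen, map_comulLeGen]
  rfl

/-- The counit of `U_{≥0}`. -/
noncomputable def counitGe : Uge C →ₐ[QVT] QVT := (counit C).comp (Uge C).val

/-- The counit of `U_{≤0}`. -/
noncomputable def counitLe : Ule C →ₐ[QVT] QVT := (counit C).comp (Ule C).val

theorem counitGe_e (i : I) : counitGe C (geGen C (.e i)) = 0 := counit_gen C (.E i)
theorem counitGe_k (i : I) : counitGe C (geGen C (.k i)) = 1 := counit_gen C (.K i)
theorem counitGe_ki (i : I) : counitGe C (geGen C (.ki i)) = 1 := counit_gen C (.Ki i)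
theorem counitLe_e (i : I) : counitLe C (leGen C (.e i)) = 0 := counit_gen C (.F i)
theorem counitLe_k (i : I) : counitLe C (leGen C (.k i)) = 1 := counit_gen C (.Kp i)
theorem counitLe_ki (i : I) : counitLe C (leGen C (.ki i)) = 1 := counit_gen C (.Kpi i)

theorem comulGe_counit_right (x : Uge C) :
    Algebra.TensorProduct.rid QVT QVT (Uge C)
      (Algebra.TensorProduct.map (AlgHom.id QVT (Uge C)) (counitGe C) (comulGe C x)) = x := by
  refine DFunLike.congr_fun (f := ((Algebra.TensorProduct.rid QVT QVT (Uge C)).toAlgHom.comp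
    (Algebra.TensorProduct.map (AlgHom.id QVT (Uge C)) (counitGe C))).comp (comulGe C))
    (g := AlgHom.id QVT _) (Uge_algHom_ext C fun a => ?_) x
  cases a <;> simp [comulGe_gen, comulGeGen, counitGe_e, counitGe_k, counitGe_ki]

end Coproduct

end TwoParam

/-! ### Construction of a skew-Hopf pairing. -/

namespace TwoParam

universe u

variable {I : Type u} [Fintype I] (C : CartanDatum I)

namespace Pairing

/-- The value `(v_i⁻¹ - v_i)⁻¹` of the pairing at `(E_i, F_i)`. -/
noncomputable def cp (i : I) : QVT := ((C.vi i)⁻¹ - C.vi i)⁻¹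

/-- The automorphism `x ↦ x₁ (x₂, K'_i)` of `U_{≥0}`. -/
noncomputable def TK (i : I) : Uge C →ₐ[QVT] Uge C :=
  ((geGen_satisfies C).scale (fun _ => 1) (β := fun j => C.br j i) (fun _ => C.br_ne_zero _ _)).liftGe

/-- The automorphism `x ↦ x₁ (x₂, K'_i⁻¹)` of `U_{≥0}`. -/
noncomputable def TKinv (i : I) : Uge C →ₐ[QVT] Uge C :=
  ((geGen_satisfies C).scale (fun _ => 1) (β := fun j => (C.br j i)⁻¹)
    (fun _ => inv_ne_zero (C.br_ne_zero _ _))).liftGe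

theorem TK_e (i j : I) : TK C i (geGen C (.e j)) = geGen C (.e j) :=
  (BorelSat.liftGe_gen _ _).trans (one_smul _ _)

theorem TK_k (i j : I) : TK C i (geGen C (.k j)) = C.br j i • geGen C (.k j) :=
  BorelSat.liftGe_gen _ _

theorem TK_ki (i j : I) : TK C i (geGen C (.ki j)) = (C.br j i)⁻¹ • geGen C (.ki j) :=
  BorelSat.liftGe_gen _ _

theorem TKinv_e (i j : I) : TKinv C i (geGen C (.e j)) = geGen C (.e j) :=
  (BorelSat.liftGe_gen _ _).trans (one_smul _ _)

theorem TKinv_k (i j : I) : TKinv C i (geGen C (.k j)) = (C.br j i)⁻¹ • geGen C (.k j) :=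
  BorelSat.liftGe_gen _ _

theorem TKinv_ki (i j : I) : TKinv C i (geGen C (.ki j)) = C.br j i • geGen C (.ki j) :=
  (BorelSat.liftGe_gen _ _).trans (by simp [scaleGen])

theorem TK_TKinv (i : I) (x : Uge C) : TK C i (TKinv C i x) = x := by
  refine DFunLike.congr_fun (f := (TK C i).comp (TKinv C i)) (g := AlgHom.id QVT _)
    (Uge_algHom_ext C fun a => ?_) x
  cases a <;> simp [TK_e, TK_k, TK_ki, TKinv_e, TKinv_k, TKinv_ki, smul_smul, C.br_ne_zero]

theorem TKinv_TK (i : I) (x : Uge C) : TKinv C i (TK C i x) = x := by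
  refine DFunLike.congr_fun (f := (TKinv C i).comp (TK C i)) (g := AlgHom.id QVT _)
    (Uge_algHom_ext C fun a => ?_) x
  cases a <;> simp [TK_e, TK_k, TK_ki, TKinv_e, TKinv_k, TKinv_ki, smul_smul, C.br_ne_zero]

theorem TK_comm (i j : I) (x : Uge C) : TK C i (TK C j x) = TK C j (TK C i x) := by
  refine DFunLike.congr_fun (f := (TK C i).comp (TK C j)) (g := (TK C j).comp (TK C i))
    (Uge_algHom_ext C fun a => ?_) x
  cases a <;> simp [TK_e, TK_k, TK_ki, smul_smul, mul_comm]

open Classical in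
/-- Values on generators of the homomorphism `x ↦ [x₁ (x₂, K'_i), x₁ (x₂, F_i); 0, x]`. -/
noncomputable def skewGen (i : I) : BGen I → Matrix (Fin 2) (Fin 2) (Uge C)
  | .e j => upTri (geGen C (.e j)) (if j = i then cp C i • geGen C (.k i) - 0 else 0)
      (geGen C (.e j))
  | .k j => upTri (C.br j i • geGen C (.k j)) 0 (geGen C (.k j))
  | .ki j => upTri ((C.br j i)⁻¹ • geGen C (.ki j)) 0 (geGen C (.ki j))

/-- The entries are dictated by `Δ`: since `Δ(E_i) = E_i ⊗ 1 + K_i ⊗ E_i`, the functional `F_i` on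
the second factor turns `E_i` into `(E_i, F_i) K_i`. There is a single torus term, so `serre_upTri`
applies with `b = 0`. -/
theorem skewGen_satisfies (k : I) : BorelSat C (skewGen C k) where
  k_ki i := by
    simp only [skewGen, upTri_mul, (geGen_satisfies C).k_ki, smul_mul_assoc, mul_smul_comm,
      smul_smul, mul_zero, zero_mul, add_zero, one_smul,
      inv_mul_cancel₀ (C.br_ne_zero i k), upTri_one]
  ki_k i := by
    simp only [skewGen, upTri_mul, (geGen_satisfies C).ki_k, smul_mul_assoc, mul_smul_comm,
      smul_smul, mul_zero, zero_mul, add_zero, mul_inv_cancel₀ (C.br_ne_zero i k), one_smul,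
      upTri_one]
  k_k i j := by
    simp only [skewGen, upTri_mul, (geGen_satisfies C).k_k i j, smul_mul_assoc, mul_smul_comm,
      mul_zero, zero_mul, add_zero]
    rw [smul_comm]
  k_e i j := by
    simp only [skewGen, upTri_mul, (geGen_satisfies C).k_e i j, smul_mul_assoc, mul_smul_comm,
      mul_zero, zero_mul, add_zero, zero_add, upTri_smul]
    congr 1
    · rw [smul_comm]
    · split_ifs with h
      · subst h
        simp only [sub_zero, mul_smul_comm, smul_mul_assoc, (geGen_satisfies C).k_k i j]
      · simp
  serre i j h := by
    rw [show (fun l => skewGen C k (.e l)) = fun l => upTri (geGen C (.e l)) _ (geGen C (.e l))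
      from rfl, C.serre_upTri h, (geGen_satisfies C).serre i j h, upTri_zero]
    · intro l
      rw [smul_mul_assoc, (geGen_satisfies C).k_e, mul_smul_comm, smul_comm]
    · intro l
      simp

noncomputable def skewHom (k : I) : Uge C →ₐ[QVT] Matrix (Fin 2) (Fin 2) (Uge C) :=
  (skewGen_satisfies C k).liftGe

theorem skewHom_gen (k : I) (a : BGen I) : skewHom C k (geGen C a) = skewGen C k a :=
  BorelSat.liftGe_gen _ _

theorem skewHom_apply (k : I) (x : Uge C) :
    skewHom C k x 1 0 = 0 ∧ skewHom C k x 1 1 = x ∧ skewHom C k x 0 0 = TK C k x := by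
  induction x using Uge_induction with
  | one => simp
  | add x y hx hy => simp [hx, hy]
  | smul c x hx => simp [hx]
  | mul a x hx =>
    rw [map_mul, map_mul, skewHom_gen]
    simp only [Matrix.mul_apply, Fin.sum_univ_two, hx]
    cases a <;> simp [skewGen, upTri, TK_e, TK_k, TK_ki]

/-- The skew derivation `x ↦ x₁ (x₂, F_i)` of `U_{≥0}`. -/
noncomputable def TF (i : I) : Module.End QVT (Uge C) where
  toFun x := skewHom C i x 0 1
  map_add' x y := by simp
  map_smul' c x := by simp

theorem TF_mul (i : I) (x y : Uge C) : TF C i (x * y) = TK C i x * TF C i y + TF C i x * y := by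
  simp [TF, Matrix.mul_apply, Fin.sum_univ_two, skewHom_apply]

theorem TF_one (i : I) : TF C i 1 = 0 := by simp [TF]

theorem TF_e (i : I) : TF C i (geGen C (.e i)) = cp C i • geGen C (.k i) := by
  simp [TF, skewHom_gen, skewGen, upTri]

theorem TF_e_ne {i j : I} (h : j ≠ i) : TF C i (geGen C (.e j)) = 0 := by
  simp [TF, skewHom_gen, skewGen, upTri, h]

theorem TF_k (i j : I) : TF C i (geGen C (.k j)) = 0 := by
  simp [TF, skewHom_gen, skewGen, upTri]

theorem TF_ki (i j : I) : TF C i (geGen C (.ki j)) = 0 := by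
  simp [TF, skewHom_gen, skewGen, upTri]

theorem TK_TF (i k : I) (x : Uge C) : TK C i (TF C k x) = C.br k i • TF C k (TK C i x) := by
  induction x using Uge_induction with
  | one => simp [TF_one]
  | add x y hx hy => simp [hx, hy]
  | smul c x hx => simp [hx, smul_comm c]
  | mul a x hx =>
    have key : ∀ a, TK C i (TF C k (geGen C a)) = C.br k i • TF C k (TK C i (geGen C a)) := by
      intro a
      cases a with
      | e j =>
        by_cases h : j = k
        · subst h
          rw [TK_e, TF_e, map_smul, TK_k, smul_comm]
        · rw [TK_e, TF_e_ne C h, map_zero, smul_zero]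
      | k j => simp [TF_k, TK_k]
      | ki j => simp [TF_ki, TK_ki]
    rw [TF_mul, map_add, map_mul, map_mul, hx, key, map_mul, TF_mul, smul_add, TK_comm,
      mul_smul_comm, smul_mul_assoc]

/-- Values on generators of the action of `U_{≤0}` on `U_{≥0}`. -/
noncomputable def psiGen : BGen I → Module.End QVT (Uge C)
  | .e i => TF C i
  | .k i => (TK C i).toLinearMap
  | .ki i => (TKinv C i).toLinearMap

/-- For the Serre relation, the skew Leibniz rule shows that the commutator of left multiplication
by `E_k` with `TF l` is zero for `l ≠ k` and a multiple of left multiplication by `K_k` for `l = k`.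
As `TF` kills `1`, `serre_eq_zero_of_adjoin` applies with `a = 0`. -/
theorem psiGen_satisfies : BorelSat C.transpose (psiGen C) where
  k_ki i := LinearMap.ext fun x => TK_TKinv C i x
  ki_k i := LinearMap.ext fun x => TKinv_TK C i x
  k_k i j := LinearMap.ext fun x => TK_comm C i j x
  k_e i j := by
    ext1 x
    simp [psiGen, TK_TF, C.transpose_br]
  serre i j h := by
    refine Borel.serre_eq_zero_of_adjoin C.transpose (geGen_adjoin C) (TF C) (fun _ => 0)
      (fun k => cp C k • Algebra.lmul QVT _ (geGen C (.k k))) (TF_one C) ?_ ?_ ?_ ?_ ?_ h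
    · intro k l
      split_ifs with hl
      · subst hl
        ext1 x
        simp [TF_mul, TF_e, TK_e]
      · ext1 x
        simp [TF_mul, TF_e_ne C (Ne.symm hl), TK_e]
    · simp
    · intro k l
      ext1 x
      simp [C.transpose_br, TF_mul, TF_k, TK_k, smul_comm (cp C k)]
    · refine fun k => ⟨fun l => (C.br k l)⁻¹, fun l => inv_ne_zero (C.br_ne_zero _ _), fun l => ?_⟩
      ext1 y
      simp [TF_mul, TF_k, TK_k, smul_smul, C.br_ne_zero]
    · refine fun k => ⟨fun l => C.br k l, fun l => C.br_ne_zero _ _, fun l => ?_⟩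
      ext1 y
      simp [TF_mul, TF_ki, TK_ki, smul_smul, C.br_ne_zero]

/-- The action `y ↦ (x ↦ x₁ (x₂, y))` of `U_{≤0}` on `U_{≥0}`. -/
noncomputable def psi : Ule C →ₐ[QVT] Module.End QVT (Uge C) := (psiGen_satisfies C).liftLe

theorem psi_gen (a : BGen I) : psi C (leGen C a) = psiGen C a := BorelSat.liftLe_gen _ _

/-- The pairing `(x, y) = ε(ψ(y) x)`. -/
noncomputable def phi : Uge C →ₗ[QVT] Ule C →ₗ[QVT] QVT :=
  LinearMap.flip ((psi C).toLinearMap.compr₂ (counitGe C).toLinearMap)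

theorem phi_apply (x : Uge C) (y : Ule C) : phi C x y = counitGe C (psi C y x) := rfl

theorem psi_one (y : Ule C) : psi C y 1 = counitLe C y • 1 := by
  induction y using Ule_induction with
  | one => simp
  | add x y hx hy => simp [hx, hy, add_smul]
  | smul c x hx => simp [hx, smul_smul]
  | mul a x hx =>
    rw [map_mul, map_mul, Module.End.mul_apply, hx, map_smul, psi_gen]
    cases a <;> simp [psiGen, TF_one, counitLe_e, counitLe_k, counitLe_ki]

theorem lTensor_TF_mul (i : I) (z w : Uge C ⊗[QVT] Uge C) :
    (TF C i).lTensor (Uge C) (z * w) =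
      Algebra.TensorProduct.map (AlgHom.id QVT (Uge C)) (TK C i) z * (TF C i).lTensor (Uge C) w
        + (TF C i).lTensor (Uge C) z * w := by
  induction z using TensorProduct.induction_on with
  | zero => simp
  | add z z' hz hz' => simp only [add_mul, map_add, hz, hz']; abel
  | tmul x y =>
    induction w using TensorProduct.induction_on with
    | zero => simp
    | add z z' hz hz' => simp only [mul_add, map_add, hz, hz']; abel
    | tmul x' y' => simp [TF_mul, TensorProduct.tmul_add]

theorem comulGe_TK (i : I) (x : Uge C) : comulGe C (TK C i x) =
    Algebra.TensorProduct.map (AlgHom.id QVT (Uge C)) (TK C i) (comulGe C x) := by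
  refine DFunLike.congr_fun (f := (comulGe C).comp (TK C i)) (g := (Algebra.TensorProduct.map
    (AlgHom.id QVT (Uge C)) (TK C i)).comp (comulGe C)) (Uge_algHom_ext C fun a => ?_) x
  cases a <;> simp [TK_e, TK_k, TK_ki, comulGe_gen, comulGeGen]

theorem comulGe_TKinv (i : I) (x : Uge C) : comulGe C (TKinv C i x) =
    Algebra.TensorProduct.map (AlgHom.id QVT (Uge C)) (TKinv C i) (comulGe C x) := by
  refine DFunLike.congr_fun (f := (comulGe C).comp (TKinv C i)) (g := (Algebra.TensorProduct.map
    (AlgHom.id QVT (Uge C)) (TKinv C i)).comp (comulGe C)) (Uge_algHom_ext C fun a => ?_) x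
  cases a <;> simp [TKinv_e, TKinv_k, TKinv_ki, comulGe_gen, comulGeGen]

theorem comulGe_TF (i : I) (x : Uge C) :
    comulGe C (TF C i x) = (TF C i).lTensor (Uge C) (comulGe C x) := by
  induction x using Uge_induction with
  | one => simp [TF_one, Algebra.TensorProduct.one_def]
  | add x y hx hy => simp [hx, hy]
  | smul c x hx => simp [hx]
  | mul a x hx =>
    rw [TF_mul, map_add, map_mul, map_mul, map_mul, hx, lTensor_TF_mul, comulGe_TK]
    congr 2
    cases a with
    | e j =>
      by_cases h : j = i
      · subst h
        simp [TF_e, comulGe_gen, comulGeGen, TF_one]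
      · simp [TF_e_ne C h, comulGe_gen, comulGeGen, TF_one]
    | k j => simp [TF_k, comulGe_gen, comulGeGen]
    | ki j => simp [TF_ki, comulGe_gen, comulGeGen]

/-- In Sweedler form, `Δ(x₁ (x₂, y)) = x₁ ⊗ x₂ (x₃, y)`, which is coassociativity. Both sides are
compatible with products in `y`, so it suffices to treat the three kinds of generators. -/
theorem comulGe_psi (y : Ule C) (x : Uge C) :
    comulGe C (psi C y x) = (psi C y).lTensor (Uge C) (comulGe C x) := by
  induction y using Ule_induction generalizing x with
  | one => simp [Module.End.one_eq_id]
  | add y y' hy hy' => simp [hy, hy', LinearMap.lTensor_add]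
  | smul c y hy => simp [hy, LinearMap.lTensor_smul]
  | mul a y hy =>
    rw [map_mul, Module.End.mul_apply, Module.End.mul_eq_comp, LinearMap.lTensor_comp,
      LinearMap.comp_apply, ← hy, psi_gen]
    cases a with
    | e i => exact comulGe_TF C i _
    | k i => exact comulGe_TK C i _
    | ki i => exact comulGe_TKinv C i _

theorem phi_mul_right (x : Uge C) (y y' : Ule C) :
    phi C x (y * y') = tensorPairing (phi C) (comulGe C x) (y ⊗ₜ y') := by
  -- For `z = Δ(x)` the right-hand side simplifies: `(id ⊗ ψ(y')) Δ(x) = Δ(ψ(y') x)`, and the counit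
  -- axiom leaves `(ψ(y') x, y) = ε(ψ(y) ψ(y') x)`.
  have h : ∀ z : Uge C ⊗[QVT] Uge C, tensorPairing (phi C) z (y ⊗ₜ y') =
      phi C (Algebra.TensorProduct.rid QVT QVT (Uge C) (Algebra.TensorProduct.map
        (AlgHom.id QVT (Uge C)) (counitGe C) ((psi C y').lTensor (Uge C) z))) y := by
    intro z
    induction z using TensorProduct.induction_on with
    | zero => simp
    | add z z' hz hz' => simp [hz, hz']
    | tmul a b => rw [tensorPairing_tmul]; simp [phi_apply, mul_comm]
  rw [h, ← comulGe_psi, comulGe_counit_right, phi_apply, phi_apply, map_mul, Module.End.mul_apply]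

/-- The action of `U_{≤0} ⊗ U_{≤0}` on `U_{≥0} ⊗ U_{≥0}` with the two factors exchanged. -/
noncomputable def psi₂ : Ule C ⊗[QVT] Ule C →ₐ[QVT] Module.End QVT (Uge C ⊗[QVT] Uge C) :=
  (Module.endTensorEndAlgHom (R := QVT) (S := QVT) (A := QVT) (M := Uge C) (N := Uge C)).comp
    ((Algebra.TensorProduct.map (psi C) (psi C)).comp
      (Algebra.TensorProduct.comm QVT (Ule C) (Ule C)).toAlgHom)

theorem psi₂_tmul (y y' : Ule C) (x x' : Uge C) :
    psi₂ C (y ⊗ₜ y') (x ⊗ₜ x') = psi C y' x ⊗ₜ psi C y x' := rfl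

/-- In Sweedler form, `ψ(y)(x x') = (ψ(y₂) x)(ψ(y₁) x')`. On generators this is multiplicativity of
`TK` and `TKinv` and the skew Leibniz rule for `TF`; products follow since `psi₂` and the
comultiplication are homomorphisms. Applying `ε` gives the second product axiom. -/
theorem mul_psi₂ (y : Ule C) (z : Uge C ⊗[QVT] Uge C) :
    LinearMap.mul' QVT (Uge C) (psi₂ C (comulLe C y) z) = psi C y (LinearMap.mul' QVT (Uge C) z) := by
  induction y using Ule_induction generalizing z with
  | one => simp
  | add y y' hy hy' => simp [hy, hy']
  | smul c y hy => simp [hy]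
  | mul a y hy =>
    rw [map_mul, map_mul, map_mul, Module.End.mul_apply, Module.End.mul_apply, ← hy, comulLe_gen]
    generalize psi₂ C (comulLe C y) z = w
    induction w using TensorProduct.induction_on with
    | zero => simp
    | add w w' hw hw' => simp only [map_add, hw, hw']
    | tmul x x' =>
      rw [psi_gen]
      cases a with
      | e i => simp [comulLeGen, psi₂_tmul, psi_gen, psiGen, TF_mul, add_comm]
      | k i => simp [comulLeGen, psi₂_tmul, psi_gen, psiGen]
      | ki i => simp [comulLeGen, psi₂_tmul, psi_gen, psiGen]

theorem phi_mul_left (x x' : Uge C) (y : Ule C) :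
    phi C (x * x') y = tensorPairing (phi C) (x ⊗ₜ x')
      (TensorProduct.comm QVT (Ule C) (Ule C) (comulLe C y)) := by
  have h : ∀ z : Ule C ⊗[QVT] Ule C, tensorPairing (phi C) (x ⊗ₜ x')
      (TensorProduct.comm QVT (Ule C) (Ule C) z) =
      counitGe C (LinearMap.mul' QVT (Uge C) (psi₂ C z (x ⊗ₜ x'))) := by
    intro z
    induction z using TensorProduct.induction_on with
    | zero => simp
    | add z z' hz hz' => simp [hz, hz']
    | tmul a b => rw [TensorProduct.comm_tmul, tensorPairing_tmul, psi₂_tmul]; simp [phi_apply]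
  rw [h, mul_psi₂, phi_apply, LinearMap.mul'_apply]

end Pairing

end TwoParam

/-! ### Torus elements, degrees, and the remaining axiom of the pairing. -/

namespace TwoParam

universe u

variable {I : Type u} [Fintype I] (C : CartanDatum I)

section Brace

namespace CartanDatum

theorem form_add_left (μ μ' ν : I → ℤ) : C.form (μ + μ') ν = C.form μ ν + C.form μ' ν := by
  simp only [form, Pi.add_apply, add_mul, Finset.sum_add_distrib]

theorem form_add_right (μ ν ν' : I → ℤ) : C.form μ (ν + ν') = C.form μ ν + C.form μ ν' := by
  simp only [form, Pi.add_apply, mul_add, add_mul, Finset.sum_add_distrib]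

theorem brace_add_left (μ μ' ν : I → ℤ) : C.brace (μ + μ') ν = C.brace μ ν * C.brace μ' ν := by
  simp only [brace, dotForm, form_add_left, form_add_right]
  rw [mul_mul_mul_comm, ← zpow_add₀ vv_ne_zero, ← zpow_add₀ tt_ne_zero]
  congr 2 <;> ring

theorem brace_add_right (μ ν ν' : I → ℤ) : C.brace μ (ν + ν') = C.brace μ ν * C.brace μ ν' := by
  simp only [brace, dotForm, form_add_left, form_add_right]
  rw [mul_mul_mul_comm, ← zpow_add₀ vv_ne_zero, ← zpow_add₀ tt_ne_zero]
  congr 2 <;> ring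

theorem brace_ne_zero (μ ν : I → ℤ) : C.brace μ ν ≠ 0 := coeff_ne_zero _ _

theorem brace_zero_left (ν : I → ℤ) : C.brace 0 ν = 1 := by
  simp [brace, dotForm, form]

theorem brace_zero_right (ν : I → ℤ) : C.brace ν 0 = 1 := by
  simp [brace, dotForm, form]

open Classical in
theorem brace_single (i j : I) : C.brace (Pi.single i 1) (Pi.single j 1) = C.br i j := by
  have h : ∀ i j, C.form (Pi.single i 1) (Pi.single j 1) = C.Ω i j := by
    intro i j
    rw [form, Finset.sum_eq_single i, Finset.sum_eq_single j] <;> simp +contextual [Pi.single_apply]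
  rw [brace, dotForm, h, h, br, dot]

end CartanDatum

open Classical in
theorem wordDeg_cons {I : Type*} (j : I) (l : List I) : wordDeg (j :: l) = Pi.single j 1 + wordDeg l := by
  simp only [wordDeg, List.map_cons, List.sum_cons]

/-- Degrees in `ℕ[I]` as elements of `ℤ[I]`. -/
def intDeg {I : Type*} (ν : I → ℕ) : I → ℤ := fun i => ν i

open Classical in
theorem intDeg_cons {I : Type*} (j : I) (l : List I) :
    intDeg (wordDeg (j :: l)) = Pi.single j 1 + intDeg (wordDeg l) := by
  rw [wordDeg_cons]
  ext i
  by_cases h : i = j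
  · subst h; simp [intDeg]
  · simp [intDeg, h]

theorem intDeg_nil {I : Type*} : intDeg (wordDeg ([] : List I)) = 0 := by
  ext i; simp [intDeg, wordDeg]

open Classical in
-- The translations preserving `p` in both directions form a subgroup of `ℤ[I]` containing the basis
-- vectors, hence all of `ℤ[I]`.
theorem intVec_induction {p : (I → ℤ) → Prop} (zero : p 0)
    (add : ∀ μ i, p μ → p (Pi.single i 1 + μ)) (sub : ∀ μ i, p (Pi.single i 1 + μ) → p μ)
    (μ : I → ℤ) : p μ := by
  have key : ∀ μ ∈ AddSubgroup.closure (Set.range fun i : I => (Pi.single i 1 : I → ℤ)),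
      ∀ ν, p ν ↔ p (μ + ν) := by
    intro μ hμ
    induction hμ using AddSubgroup.closure_induction with
    | mem x hx =>
      obtain ⟨i, rfl⟩ := hx
      exact fun ν => ⟨add ν i, sub ν i⟩
    | zero => simp
    | add x y _ _ hx hy => intro ν; rw [add_assoc, ← hx, ← hy]
    | neg x _ hx => intro ν; rw [hx (-x + ν)]; simp
  have hμ : μ ∈ AddSubgroup.closure (Set.range fun i : I => (Pi.single i 1 : I → ℤ)) := by
    have : μ = ∑ i, μ i • (Pi.single i 1 : I → ℤ) := by
      ext j
      simp [Finset.sum_apply, Pi.single_apply]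
    rw [this]
    exact sum_mem fun i _ => zsmul_mem (AddSubgroup.subset_closure (Set.mem_range_self i)) _
  simpa using (key μ hμ 0).mp zero

end Brace

section Torus

section CommutingFamily

variable {G : Type*} [Group G] {f : I → G} (hf : ∀ i j, Commute (f i) (f j))

include hf

theorem noncommProd_zpow_add (μ ν : I → ℤ) :
    Finset.univ.noncommProd (fun i => f i ^ (μ + ν) i)
      (fun i _ j _ _ => (hf i j).zpow_zpow ((μ + ν) i) ((μ + ν) j)) =
    Finset.univ.noncommProd (fun i => f i ^ μ i)
      (fun i _ j _ _ => (hf i j).zpow_zpow (μ i) (μ j)) *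
    Finset.univ.noncommProd (fun i => f i ^ ν i)
      (fun i _ j _ _ => (hf i j).zpow_zpow (ν i) (ν j)) := by
  refine Eq.trans ?_ (Finset.noncommProd_mul_distrib (fun i => f i ^ μ i) (fun i => f i ^ ν i) _ _
    (fun i _ j _ _ => (hf i j).zpow_zpow (ν i) (μ j)))
  exact Finset.noncommProd_congr rfl (fun i _ => zpow_add _ _ _) _

open Classical in
theorem noncommProd_zpow_single (i : I) :
    Finset.univ.noncommProd (fun j => f j ^ (Pi.single i 1 : I → ℤ) j)
      (fun k _ j _ _ => (hf k j).zpow_zpow ((Pi.single i 1 : I → ℤ) k) ((Pi.single i 1 : I → ℤ) j)) =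
    f i := by
  refine (Finset.noncommProd_congr (Finset.insert_erase (Finset.mem_univ i)).symm
    (fun _ _ => rfl) _).trans ?_
  refine (Finset.noncommProd_insert_of_notMem _ _ _ _ (Finset.notMem_erase i _)).trans ?_
  rw [Finset.noncommProd_eq_pow_card _ _ _ 1, one_pow, mul_one, Pi.single_eq_same, zpow_one]
  intro j hj
  rw [Pi.single_eq_of_ne (Finset.ne_of_mem_erase hj), zpow_zero]

end CommutingFamily

theorem geKmu_add (μ ν : I → ℤ) : geKmu C (μ + ν) = geKmu C μ * geKmu C ν :=
  noncommProd_zpow_add (geK_comm C) μ ν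

theorem leKpmu_add (μ ν : I → ℤ) : leKpmu C (μ + ν) = leKpmu C μ * leKpmu C ν :=
  noncommProd_zpow_add (leKp_comm C) μ ν

theorem geKmu_zero : geKmu C 0 = 1 := by
  have h := geKmu_add C 0 0
  rw [add_zero] at h
  exact left_eq_mul.mp h

theorem leKpmu_zero : leKpmu C 0 = 1 := by
  have h := leKpmu_add C 0 0
  rw [add_zero] at h
  exact left_eq_mul.mp h

open Classical in
theorem geKmu_single (i : I) : geKmu C (Pi.single i 1) = geK C i :=
  noncommProd_zpow_single (geK_comm C) i

open Classical in
theorem leKpmu_single (i : I) : leKpmu C (Pi.single i 1) = leKp C i :=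
  noncommProd_zpow_single (leKp_comm C) i

end Torus

section WordInduction

/-- Monomials in the `E_i`, in `U_{≥0}`. -/
noncomputable def geWord (l : List I) : Uge C := (l.map fun i => geGen C (.e i)).prod

/-- Monomials in the `F_i`, in `U_{≤0}`. -/
noncomputable def leWord (l : List I) : Ule C := (l.map fun i => leGen C (.e i)).prod

theorem geWord_cons (i : I) (l : List I) : geWord C (i :: l) = geGen C (.e i) * geWord C l := by
  simp [geWord]

theorem leWord_cons (i : I) (l : List I) : leWord C (i :: l) = leGen C (.e i) * leWord C l := by
  simp [leWord]

theorem coe_geWord (l : List I) : (geWord C l : U C) = (l.map (U.E C)).prod := by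
  induction l with
  | nil => simp [geWord]
  | cons i l ih => rw [geWord_cons, List.map_cons, List.prod_cons, ← ih]; rfl

theorem coe_leWord (l : List I) : (leWord C l : U C) = (l.map (U.F C)).prod := by
  induction l with
  | nil => simp [leWord]
  | cons i l ih => rw [leWord_cons, List.map_cons, List.prod_cons, ← ih]; rfl

theorem UplusW_induction {α : I → ℕ} {p : Uge C → Prop} (word : ∀ l, wordDeg l = α → p (geWord C l))
    (zero : p 0) (add : ∀ x y, p x → p y → p (x + y)) (smul : ∀ (c : QVT) x, p x → p (c • x))
    (x : UplusW C α) : p (plusIncl C α x) := by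
  obtain ⟨x, hx⟩ := x
  change p ⟨x, UplusW_le C α hx⟩
  induction hx using Submodule.span_induction with
  | mem x h =>
    obtain ⟨l, hl, rfl⟩ := h
    convert word l hl
    exact (coe_geWord C l).symm
  | zero => exact zero
  | add x y _ _ hx hy => exact add _ _ hx hy
  | smul c x _ hx => exact smul c _ hx

theorem UminusW_induction {α : I → ℕ} {p : Ule C → Prop} (word : ∀ l, wordDeg l = α → p (leWord C l))
    (zero : p 0) (add : ∀ x y, p x → p y → p (x + y)) (smul : ∀ (c : QVT) x, p x → p (c • x))
    (x : UminusW C α) : p (minusIncl C α x) := by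
  obtain ⟨x, hx⟩ := x
  change p ⟨x, UminusW_le C α hx⟩
  induction hx using Submodule.span_induction with
  | mem x h =>
    obtain ⟨l, hl, rfl⟩ := h
    convert word l hl
    exact (coe_leWord C l).symm
  | zero => exact zero
  | add x y _ _ hx hy => exact add _ _ hx hy
  | smul c x _ hx => exact smul c _ hx

end WordInduction

namespace Pairing

open Classical in
theorem TK_Kmu (i : I) (μ : I → ℤ) :
    TK C i (geKmu C μ) = C.brace μ (Pi.single i 1) • (geKmu C μ : Uge C) := by
  have hk : ∀ j, TK C i (geK C j) = C.br j i • (geK C j : Uge C) := fun j => TK_k C i j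
  induction μ using intVec_induction with
  | zero => simp [geKmu_zero, C.brace_zero_left]
  | add μ j h =>
    rw [geKmu_add, Units.val_mul, map_mul, h, geKmu_single, C.brace_add_left, C.brace_single, hk,
      smul_mul_smul_comm]
  | sub μ j h =>
    rw [geKmu_add, Units.val_mul, map_mul, geKmu_single, C.brace_add_left, C.brace_single, hk,
      smul_mul_assoc, mul_smul] at h
    have h' := smul_right_injective _ (C.br_ne_zero j i) h
    simp only [← mul_smul_comm] at h'
    exact (geK C j).isUnit.mul_left_cancel h'

theorem TF_Kmu (i : I) (μ : I → ℤ) : TF C i (geKmu C μ) = 0 := by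
  have hk : ∀ j, TK C i (geK C j) = C.br j i • (geK C j : Uge C) := fun j => TK_k C i j
  have hf : ∀ j, TF C i (geK C j) = 0 := fun j => TF_k C i j
  induction μ using intVec_induction with
  | zero => simp [geKmu_zero, TF_one]
  | add μ j h => rw [geKmu_add, Units.val_mul, TF_mul, h, geKmu_single, hf, mul_zero, zero_mul, add_zero]
  | sub μ j h =>
    rw [geKmu_add, Units.val_mul, TF_mul, geKmu_single, hf, zero_mul, add_zero, hk,
      smul_mul_assoc] at h
    exact (geK C j).isUnit.mul_right_eq_zero.mp ((smul_eq_zero.mp h).resolve_left (C.br_ne_zero j i))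

theorem psi_leWord_Kmu (μ : I → ℤ) (l : List I) (x : Uge C) :
    psi C (leWord C l) (geKmu C μ * x) =
      C.brace μ (intDeg (wordDeg l)) • (geKmu C μ * psi C (leWord C l) x) := by
  induction l with
  | nil => simp [leWord, intDeg_nil, C.brace_zero_right]
  | cons i l ih =>
    rw [leWord_cons, map_mul (psi C), Module.End.mul_apply, ih, map_smul, psi_gen, Module.End.mul_apply,
      psiGen, TF_mul, TF_Kmu, zero_mul, add_zero, TK_Kmu, intDeg_cons, C.brace_add_right,
      smul_mul_assoc, smul_smul, mul_comm (C.brace _ _)]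

open Classical in
theorem psi_Kpmu_Kmu (μ ν : I → ℤ) (x : Uge C) :
    psi C (leKpmu C ν) (geKmu C μ * x) = C.brace μ ν • (geKmu C μ * psi C (leKpmu C ν) x) := by
  have hk : ∀ j, psi C (leKp C j) = (TK C j).toLinearMap := fun j => psi_gen C (.k j)
  have inj : ∀ j, Function.Injective (TK C j) := fun j =>
    Function.LeftInverse.injective (TKinv_TK C j)
  induction ν using intVec_induction generalizing x with
  | zero => simp [leKpmu_zero, C.brace_zero_right]
  | add ν j h =>
    rw [leKpmu_add, Units.val_mul, map_mul (psi C), leKpmu_single, hk, Module.End.mul_apply,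
      Module.End.mul_apply, h]
    simp only [AlgHom.toLinearMap_apply, map_smul, map_mul]
    rw [TK_Kmu, C.brace_add_right, smul_mul_assoc, smul_smul, mul_comm (C.brace _ _)]
  | sub ν j h =>
    have h := h x
    rw [leKpmu_add, Units.val_mul, map_mul (psi C), leKpmu_single, hk, Module.End.mul_apply,
      Module.End.mul_apply] at h
    simp only [AlgHom.toLinearMap_apply] at h
    -- The claim at `ν` follows from the claim at `ν + j` by cancelling the injective automorphism
    -- by which `K'_j` acts.
    apply inj j
    rw [h, map_smul, map_mul, TK_Kmu, C.brace_add_right, smul_mul_assoc, smul_smul,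
      mul_comm (C.brace _ _)]

open Classical in
theorem psi_Kpmu_leWord (ν : I → ℤ) (l : List I) (x : Uge C) :
    psi C (leKpmu C ν) (psi C (leWord C l) x) =
      C.brace (intDeg (wordDeg l)) ν • psi C (leWord C l) (psi C (leKpmu C ν) x) := by
  have hk : ∀ j, psi C (leKp C j) = (TK C j).toLinearMap := fun j => psi_gen C (.k j)
  have inj : ∀ j, Function.Injective (TK C j) := fun j =>
    Function.LeftInverse.injective (TKinv_TK C j)
  have one : ∀ j (x : Uge C), TK C j (psi C (leWord C l) x) =
      C.brace (intDeg (wordDeg l)) (Pi.single j 1) • psi C (leWord C l) (TK C j x) := by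
    intro j
    induction l with
    | nil => simp [leWord, intDeg_nil, C.brace_zero_left]
    | cons i l ih =>
      intro x
      rw [leWord_cons, map_mul (psi C), Module.End.mul_apply, psi_gen, psiGen, TK_TF, ih,
        Module.End.mul_apply, map_smul, intDeg_cons, C.brace_add_left, C.brace_single, smul_smul]
  induction ν using intVec_induction generalizing x with
  | zero => simp [leKpmu_zero, C.brace_zero_right]
  | add ν j h =>
    rw [leKpmu_add, Units.val_mul, map_mul (psi C), leKpmu_single, hk, Module.End.mul_apply,
      Module.End.mul_apply, h]
    simp only [AlgHom.toLinearMap_apply, map_smul]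
    rw [one, C.brace_add_right, smul_smul, mul_comm (C.brace _ _)]
  | sub ν j h =>
    have h := h x
    rw [leKpmu_add, Units.val_mul, map_mul (psi C), leKpmu_single, hk, Module.End.mul_apply,
      Module.End.mul_apply] at h
    simp only [AlgHom.toLinearMap_apply] at h
    apply inj j
    rw [h, map_smul, one, C.brace_add_right, smul_smul, mul_comm (C.brace _ _)]

open Classical in
theorem psi_Kpmu_geWord (ν : I → ℤ) (l : List I) :
    psi C (leKpmu C ν) (geWord C l) = geWord C l := by
  have hk : ∀ j, psi C (leKp C j) = (TK C j).toLinearMap := fun j => psi_gen C (.k j)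
  have inj : ∀ j, Function.Injective (TK C j) := fun j =>
    Function.LeftInverse.injective (TKinv_TK C j)
  have one : ∀ j, TK C j (geWord C l) = geWord C l := by
    intro j
    induction l with
    | nil => simp [geWord]
    | cons i l ih => rw [geWord_cons, map_mul, ih, TK_e]
  induction ν using intVec_induction with
  | zero => simp [leKpmu_zero]
  | add ν j h =>
    rw [leKpmu_add, Units.val_mul, map_mul (psi C), leKpmu_single, hk, Module.End.mul_apply, h]
    exact one j
  | sub ν j h =>
    rw [leKpmu_add, Units.val_mul, map_mul (psi C), leKpmu_single, hk, Module.End.mul_apply] at h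
    exact inj j (h.trans (one j).symm)

open Classical in
/-- The torus automorphism multiplying `E_i` by `2`. -/
noncomputable def dil (i : I) : Uge C →ₐ[QVT] Uge C :=
  ((geGen_satisfies C).scale (fun j => if j = i then 2 else 1) (β := fun _ => 1)
    (fun _ => one_ne_zero)).liftGe

open Classical in
theorem dil_e (i j : I) : dil C i (geGen C (.e j)) = (if j = i then 2 else 1 : QVT) • geGen C (.e j) :=
  BorelSat.liftGe_gen _ _

theorem dil_k (i j : I) : dil C i (geGen C (.k j)) = geGen C (.k j) :=
  (BorelSat.liftGe_gen _ _).trans (one_smul _ _)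

theorem dil_ki (i j : I) : dil C i (geGen C (.ki j)) = geGen C (.ki j) :=
  (BorelSat.liftGe_gen _ _).trans (by simp [scaleGen])

theorem counitGe_dil (i : I) (x : Uge C) : counitGe C (dil C i x) = counitGe C x := by
  refine DFunLike.congr_fun (f := (counitGe C).comp (dil C i)) (g := counitGe C)
    (Uge_algHom_ext C fun a => ?_) x
  cases a <;> simp [dil_e, dil_k, dil_ki, counitGe_e, -ite_smul]

theorem TK_dil (i k : I) (x : Uge C) : TK C k (dil C i x) = dil C i (TK C k x) := by
  refine DFunLike.congr_fun (f := (TK C k).comp (dil C i)) (g := (dil C i).comp (TK C k))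
    (Uge_algHom_ext C fun a => ?_) x
  cases a <;> simp [dil_e, dil_k, dil_ki, TK_e, TK_k, TK_ki, -ite_smul]

open Classical in
theorem TF_dil (i k : I) (x : Uge C) :
    TF C k (dil C i x) = (if k = i then 2 else 1 : QVT) • dil C i (TF C k x) := by
  induction x using Uge_induction with
  | one => simp [TF_one]
  | add x y hx hy => simp only [map_add, hx, hy, smul_add]
  | smul c x hx => simp only [map_smul, hx, smul_comm c]
  | mul a x hx =>
    have key : ∀ a, TF C k (dil C i (geGen C a)) =
        (if k = i then 2 else 1 : QVT) • dil C i (TF C k (geGen C a)) := by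
      intro a
      cases a with
      | e j =>
        by_cases h : j = k
        · subst h
          rw [TF_e, map_smul, dil_e, map_smul, TF_e, dil_k]
        · rw [TF_e_ne C h, dil_e, map_smul, TF_e_ne C h, map_zero, smul_zero, smul_zero]
      | k j => rw [dil_k, TF_k, map_zero, smul_zero]
      | ki j => rw [dil_ki, TF_ki, map_zero, smul_zero]
    rw [map_mul, TF_mul, hx, key, TF_mul, map_add, map_mul, map_mul, smul_add, TK_dil,
      mul_smul_comm, smul_mul_assoc]

open Classical in
theorem dil_geWord (i : I) (l : List I) : dil C i (geWord C l) = (2 : QVT) ^ wordDeg l i • geWord C l := by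
  induction l with
  | nil => simp [geWord, wordDeg]
  | cons j l ih =>
    rw [geWord_cons, map_mul, ih, dil_e, wordDeg_cons, smul_mul_smul_comm, Pi.add_apply, pow_add]
    by_cases h : j = i
    · subst h; simp
    · simp [h, Ne.symm h]

open Classical in
theorem psi_leWord_dil (i : I) (l : List I) (x : Uge C) : psi C (leWord C l) (dil C i x) =
    (2 : QVT) ^ wordDeg l i • dil C i (psi C (leWord C l) x) := by
  induction l with
  | nil => simp [leWord, wordDeg]
  | cons j l ih =>
    rw [leWord_cons, map_mul, Module.End.mul_apply, ih, map_smul, psi_gen, psiGen, TF_dil,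
      Module.End.mul_apply, wordDeg_cons, smul_smul, Pi.add_apply, pow_add, mul_comm]
    by_cases h : j = i
    · subst h; simp
    · simp [h, Ne.symm h]

theorem two_pow_injective : Function.Injective fun n : ℕ => (2 : QVT) ^ n := by
  have h0 : CharZero QVT := inferInstanceAs (CharZero (RatFunc (RatFunc ℚ)))
  intro m n h
  have h' : ((2 ^ m : ℕ) : QVT) = ((2 ^ n : ℕ) : QVT) := by push_cast; exact h
  exact Nat.pow_right_injective le_rfl (Nat.cast_injective h')

/-- Multiplying `E_i` by `2` is an automorphism that scales the first word by `2` to the power of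
its degree at `i`, and moving it across the pairing scales by `2` to the power of the degree of the
second word. Distinct powers of `2` are distinct in characteristic zero. In this way the degree is
detected without a direct sum decomposition. -/
theorem phi_eq_zero_of_deg_ne {l l' : List I} (h : wordDeg l ≠ wordDeg l') :
    phi C (geWord C l) (leWord C l') = 0 := by
  obtain ⟨i, hi⟩ := Function.ne_iff.mp h
  have h1 : phi C (dil C i (geWord C l)) (leWord C l') =
      (2 : QVT) ^ wordDeg l' i * phi C (geWord C l) (leWord C l') := by
    rw [phi_apply, psi_leWord_dil, map_smul, counitGe_dil]; rfl
  rw [dil_geWord, map_smul, LinearMap.smul_apply, smul_eq_mul] at h1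
  by_contra h0
  exact hi (two_pow_injective (mul_right_cancel₀ h0 h1))

theorem phi_K_mul_word (μ ν : I → ℤ) (l l' : List I) :
    phi C (geKmu C μ * geWord C l) (leKpmu C ν * leWord C l') =
      C.brace μ ν * C.brace μ (intDeg (wordDeg l')) * C.brace (intDeg (wordDeg l)) ν *
        phi C (geWord C l) (leWord C l') := by
  -- Moving `K'_ν` past the operator of the second word produces the degree of `l'`, whereas the
  -- axiom asks for that of `l`. The two agree unless both sides vanish.
  have h1 : phi C (geKmu C μ * geWord C l) (leKpmu C ν * leWord C l') =
      C.brace μ ν * C.brace μ (intDeg (wordDeg l')) * C.brace (intDeg (wordDeg l')) ν *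
        phi C (geWord C l) (leWord C l') := by
    have hK : counitGe C (geKmu C μ) = 1 := by
      have hk : ∀ j, counitGe C (geK C j) = 1 := fun j => counitGe_k C j
      classical
      induction μ using intVec_induction with
      | zero => simp [geKmu_zero]
      | add μ j h => rw [geKmu_add, Units.val_mul, map_mul, h, geKmu_single, hk, one_mul]
      | sub μ j h => rwa [geKmu_add, Units.val_mul, map_mul, geKmu_single, hk, one_mul] at h
    rw [phi_apply, map_mul (psi C), Module.End.mul_apply, psi_leWord_Kmu, map_smul, psi_Kpmu_Kmu,
      psi_Kpmu_leWord, psi_Kpmu_geWord, mul_smul_comm, map_smul, map_smul, map_smul, map_mul, hK,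
      one_mul, phi_apply]
    simp only [smul_eq_mul]
    ring
  by_cases h : wordDeg l = wordDeg l'
  · rw [h1, h]
  · rw [h1, phi_eq_zero_of_deg_ne C h, mul_zero, mul_zero]

theorem phi_K_mul (μ ν : I → ℤ) (α β : I → ℕ) (x : UplusW C α) (y : UminusW C β) :
    phi C (geKmu C μ * plusIncl C α x) (leKpmu C ν * minusIncl C β y) =
      C.brace μ ν * C.brace μ (fun i => β i) * C.brace (fun i => α i) ν *
        phi C (plusIncl C α x) (minusIncl C β y) := by
  refine UplusW_induction C (p := fun x => phi C (geKmu C μ * x) (leKpmu C ν * minusIncl C β y) =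
      C.brace μ ν * C.brace μ (fun i => β i) * C.brace (fun i => α i) ν *
        phi C x (minusIncl C β y)) ?_ ?_ ?_ ?_ x
  · intro l hl
    refine UminusW_induction C (p := fun y => phi C (geKmu C μ * geWord C l) (leKpmu C ν * y) =
      C.brace μ ν * C.brace μ (fun i => β i) * C.brace (fun i => α i) ν *
        phi C (geWord C l) y) ?_ ?_ ?_ ?_ y
    · rintro l' rfl
      subst hl
      exact phi_K_mul_word C μ ν l l'
    · simp
    · intro x y hx hy
      rw [mul_add, map_add, hx, hy, map_add, mul_add]
    · intro c x hx
      rw [mul_smul_comm, map_smul, hx, map_smul, smul_eq_mul, smul_eq_mul]; ring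
  · simp
  · intro x y hx hy
    rw [mul_add, map_add, LinearMap.add_apply, hx, hy, map_add, LinearMap.add_apply, mul_add]
  · intro c x hx
    rw [mul_smul_comm, map_smul, LinearMap.smul_apply, hx, map_smul, LinearMap.smul_apply,
      smul_eq_mul, smul_eq_mul]; ring

theorem phi_isSkewHopfPairing : IsSkewHopfPairing C (phi C) where
  one_left y := by
    rw [phi_apply, psi_one, map_smul, map_one, smul_eq_mul, mul_one]; rfl
  one_right x := by
    rw [phi_apply, map_one]; rfl
  mul_right x := ⟨comulGe C x, map_comulGe C x, phi_mul_right C x⟩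
  mul_left y := ⟨comulLe C y, map_comulLe C y, fun x x' => phi_mul_left C x x' y⟩
  E_F i := by
    change phi C (geGen C (.e i)) (leGen C (.e i)) = _
    rw [phi_apply, psi_gen, psiGen, TF_e, map_smul, counitGe_k, smul_eq_mul, mul_one, cp]
  E_F_ne i j h := by
    change phi C (geGen C (.e i)) (leGen C (.e j)) = _
    rw [phi_apply, psi_gen, psiGen, TF_e_ne C h, map_zero]
  K_mul := phi_K_mul C

end Pairing

end TwoParam

/-! ### Arbitrary skew-Hopf pairings: graded pieces and values on generators. -/

namespace TwoParam

universe u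

variable {I : Type u} [Fintype I] (C : CartanDatum I)

theorem comulGe_counit_left (x : Uge C) :
    Algebra.TensorProduct.lid QVT (Uge C)
      (Algebra.TensorProduct.map (counitGe C) (AlgHom.id QVT (Uge C)) (comulGe C x)) = x := by
  refine DFunLike.congr_fun (f := ((Algebra.TensorProduct.lid QVT (Uge C)).toAlgHom.comp
    (Algebra.TensorProduct.map (counitGe C) (AlgHom.id QVT (Uge C)))).comp (comulGe C))
    (g := AlgHom.id QVT _) (Uge_algHom_ext C fun a => ?_) x
  cases a <;> simp [comulGe_gen, comulGeGen, counitGe_e, counitGe_k, counitGe_ki]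

theorem comulLe_counit_right (x : Ule C) :
    Algebra.TensorProduct.rid QVT QVT (Ule C)
      (Algebra.TensorProduct.map (AlgHom.id QVT (Ule C)) (counitLe C) (comulLe C x)) = x := by
  refine DFunLike.congr_fun (f := ((Algebra.TensorProduct.rid QVT QVT (Ule C)).toAlgHom.comp
    (Algebra.TensorProduct.map (AlgHom.id QVT (Ule C)) (counitLe C))).comp (comulLe C))
    (g := AlgHom.id QVT _) (Ule_algHom_ext C fun a => ?_) x
  cases a <;> simp [comulLe_gen, comulLeGen, counitLe_e, counitLe_k, counitLe_ki]

theorem comulLe_counit_left (x : Ule C) :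
    Algebra.TensorProduct.lid QVT (Ule C)
      (Algebra.TensorProduct.map (counitLe C) (AlgHom.id QVT (Ule C)) (comulLe C x)) = x := by
  refine DFunLike.congr_fun (f := ((Algebra.TensorProduct.lid QVT (Ule C)).toAlgHom.comp
    (Algebra.TensorProduct.map (counitLe C) (AlgHom.id QVT (Ule C)))).comp (comulLe C))
    (g := AlgHom.id QVT _) (Ule_algHom_ext C fun a => ?_) x
  cases a <;> simp [comulLe_gen, comulLeGen, counitLe_e, counitLe_k, counitLe_ki]

section Graded

/-- The span of the monomials in the `F_i` of degree `γ ∈ ℤ[I]`. -/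
noncomputable def minusZ (γ : I → ℤ) : Submodule QVT (Ule C) :=
  Submodule.span QVT {y | ∃ l : List I, intDeg (wordDeg l) = γ ∧ y = leWord C l}

/-- The span of the monomials in the `E_i` of degree `γ ∈ ℤ[I]`. -/
noncomputable def plusZ (γ : I → ℤ) : Submodule QVT (Uge C) :=
  Submodule.span QVT {y | ∃ l : List I, intDeg (wordDeg l) = γ ∧ y = geWord C l}

variable {C}

theorem leWord_mem {γ : I → ℤ} {l : List I} (h : intDeg (wordDeg l) = γ) : leWord C l ∈ minusZ C γ :=
  Submodule.subset_span ⟨l, h, rfl⟩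

theorem geWord_mem {γ : I → ℤ} {l : List I} (h : intDeg (wordDeg l) = γ) : geWord C l ∈ plusZ C γ :=
  Submodule.subset_span ⟨l, h, rfl⟩

open Classical in
theorem F_mul_mem {γ γ' : I → ℤ} (j : I) (h : γ' = Pi.single j 1 + γ) {y : Ule C}
    (hy : y ∈ minusZ C γ) : leGen C (.e j) * y ∈ minusZ C γ' := by
  induction hy using Submodule.span_induction with
  | mem y hy =>
    obtain ⟨l, rfl, rfl⟩ := hy
    rw [← leWord_cons]
    exact leWord_mem (by rw [intDeg_cons, h])
  | zero => simp
  | add x y _ _ hx hy => rw [mul_add]; exact add_mem hx hy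
  | smul c x _ hx => rw [mul_smul_comm]; exact Submodule.smul_mem _ _ hx

open Classical in
theorem E_mul_mem {γ γ' : I → ℤ} (j : I) (h : γ' = Pi.single j 1 + γ) {y : Uge C}
    (hy : y ∈ plusZ C γ) : geGen C (.e j) * y ∈ plusZ C γ' := by
  induction hy using Submodule.span_induction with
  | mem y hy =>
    obtain ⟨l, rfl, rfl⟩ := hy
    rw [← geWord_cons]
    exact geWord_mem (by rw [intDeg_cons, h])
  | zero => simp
  | add x y _ _ hx hy => rw [mul_add]; exact add_mem hx hy
  | smul c x _ hx => rw [mul_smul_comm]; exact Submodule.smul_mem _ _ hx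

theorem wordDeg_append {I : Type*} (l l' : List I) :
    wordDeg (l ++ l') = wordDeg l + wordDeg l' := by
  simp [wordDeg]

open Classical in
theorem intDeg_concat {I : Type*} (l : List I) (j : I) :
    intDeg (wordDeg (l ++ [j])) = Pi.single j 1 + intDeg (wordDeg l) := by
  rw [← intDeg_cons, wordDeg_append, wordDeg_cons, wordDeg_cons, add_comm (wordDeg l)]
  simp [wordDeg]

open Classical in
theorem mul_F_mem {γ γ' : I → ℤ} (j : I) (h : γ' = Pi.single j 1 + γ) {y : Ule C}
    (hy : y ∈ minusZ C γ) : y * leGen C (.e j) ∈ minusZ C γ' := by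
  induction hy using Submodule.span_induction with
  | mem y hy =>
    obtain ⟨l, rfl, rfl⟩ := hy
    have : leWord C l * leGen C (.e j) = leWord C (l ++ [j]) := by simp [leWord]
    rw [this]
    exact leWord_mem (by rw [intDeg_concat, h])
  | zero => simp
  | add x y _ _ hx hy => rw [add_mul]; exact add_mem hx hy
  | smul c x _ hx => rw [smul_mul_assoc]; exact Submodule.smul_mem _ _ hx

open Classical in
theorem mul_E_mem {γ γ' : I → ℤ} (j : I) (h : γ' = Pi.single j 1 + γ) {y : Uge C}
    (hy : y ∈ plusZ C γ) : y * geGen C (.e j) ∈ plusZ C γ' := by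
  induction hy using Submodule.span_induction with
  | mem y hy =>
    obtain ⟨l, rfl, rfl⟩ := hy
    have : geWord C l * geGen C (.e j) = geWord C (l ++ [j]) := by simp [geWord]
    rw [this]
    exact geWord_mem (by rw [intDeg_concat, h])
  | zero => simp
  | add x y _ _ hx hy => rw [add_mul]; exact add_mem hx hy
  | smul c x _ hx => rw [smul_mul_assoc]; exact Submodule.smul_mem _ _ hx

open Classical in
theorem Kp_mul_minusZ (i : I) {γ : I → ℤ} {y : Ule C} (hy : y ∈ minusZ C γ) :
    leGen C (.k i) * y = C.brace γ (Pi.single i 1) • (y * leGen C (.k i)) := by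
  induction hy using Submodule.span_induction with
  | mem y hy =>
    obtain ⟨l, rfl, rfl⟩ := hy
    induction l with
    | nil => simp [leWord, intDeg_nil, C.brace_zero_left]
    | cons j l ih =>
      rw [leWord_cons, ← mul_assoc, (leGen_satisfies C).k_e, smul_mul_assoc, mul_assoc, ih,
        mul_smul_comm, smul_smul, intDeg_cons, C.brace_add_left, C.brace_single, C.transpose_br,
        mul_assoc]
  | zero => simp
  | add x y _ _ hx hy => rw [mul_add, hx, hy, add_mul, smul_add]
  | smul c x _ hx => rw [mul_smul_comm, hx, smul_mul_assoc, smul_comm]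

open Classical in
theorem K_mul_plusZ (i : I) {γ : I → ℤ} {y : Uge C} (hy : y ∈ plusZ C γ) :
    geGen C (.k i) * y = C.brace (Pi.single i 1) γ • (y * geGen C (.k i)) := by
  induction hy using Submodule.span_induction with
  | mem y hy =>
    obtain ⟨l, rfl, rfl⟩ := hy
    induction l with
    | nil => simp [geWord, intDeg_nil, C.brace_zero_right]
    | cons j l ih =>
      rw [geWord_cons, ← mul_assoc, (geGen_satisfies C).k_e, smul_mul_assoc, mul_assoc, ih,
        mul_smul_comm, smul_smul, intDeg_cons, C.brace_add_right, C.brace_single, mul_assoc]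
  | zero => simp
  | add x y _ _ hx hy => rw [mul_add, hx, hy, add_mul, smul_add]
  | smul c x _ hx => rw [mul_smul_comm, hx, smul_mul_assoc, smul_comm]

theorem intDeg_injective {I : Type*} : Function.Injective (intDeg (I := I)) := by
  intro a b h
  ext i
  exact Int.ofNat.inj (congrFun h i)

theorem coe_mem_UminusW {ν : I → ℕ} {y : Ule C} (hy : y ∈ minusZ C (intDeg ν)) :
    (y : U C) ∈ UminusW C ν := by
  induction hy using Submodule.span_induction with
  | mem y hy =>
    obtain ⟨l, hl, rfl⟩ := hy
    exact Submodule.subset_span ⟨l, intDeg_injective hl, coe_leWord C l⟩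
  | zero => exact zero_mem _
  | add x y _ _ hx hy => exact add_mem hx hy
  | smul c x _ hx => exact Submodule.smul_mem _ c hx

theorem coe_mem_UplusW {ν : I → ℕ} {y : Uge C} (hy : y ∈ plusZ C (intDeg ν)) :
    (y : U C) ∈ UplusW C ν := by
  induction hy using Submodule.span_induction with
  | mem y hy =>
    obtain ⟨l, hl, rfl⟩ := hy
    exact Submodule.subset_span ⟨l, intDeg_injective hl, coe_geWord C l⟩
  | zero => exact zero_mem _
  | add x y _ _ hx hy => exact add_mem hx hy
  | smul c x _ hx => exact Submodule.smul_mem _ c hx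

theorem minusIncl_mem {ν : I → ℕ} (y : UminusW C ν) : minusIncl C ν y ∈ minusZ C (intDeg ν) := by
  refine UminusW_induction C (p := fun y => y ∈ minusZ C (intDeg ν)) ?_ ?_ ?_ ?_ y
  · rintro l rfl; exact leWord_mem rfl
  · exact zero_mem _
  · exact fun _ _ => add_mem
  · exact fun c _ => Submodule.smul_mem _ c

theorem plusIncl_mem {ν : I → ℕ} (y : UplusW C ν) : plusIncl C ν y ∈ plusZ C (intDeg ν) := by
  refine UplusW_induction C (p := fun y => y ∈ plusZ C (intDeg ν)) ?_ ?_ ?_ ?_ y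
  · rintro l rfl; exact geWord_mem rfl
  · exact zero_mem _
  · exact fun _ _ => add_mem
  · exact fun c _ => Submodule.smul_mem _ c

/-- Degrees are taken in `ℤ[I]` so that subtracting a simple root needs no side condition. Outside
`ℕ[I]` there are no words, and the graded piece is zero. -/
theorem eq_zero_of_mem_minusZ {γ : I → ℤ} {i : I} (h : γ i < 0) {y : Ule C}
    (hy : y ∈ minusZ C γ) : y = 0 := by
  induction hy using Submodule.span_induction with
  | mem y hy =>
    obtain ⟨l, rfl, rfl⟩ := hy
    simp only [intDeg] at h
    omega
  | zero => rfl
  | add x y _ _ hx hy => rw [hx, hy, add_zero]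
  | smul c x _ hx => rw [hx, smul_zero]

theorem eq_zero_of_mem_plusZ {γ : I → ℤ} {i : I} (h : γ i < 0) {y : Uge C}
    (hy : y ∈ plusZ C γ) : y = 0 := by
  induction hy using Submodule.span_induction with
  | mem y hy =>
    obtain ⟨l, rfl, rfl⟩ := hy
    simp only [intDeg] at h
    omega
  | zero => rfl
  | add x y _ _ hx hy => rw [hx, hy, add_zero]
  | smul c x _ hx => rw [hx, smul_zero]

end Graded

namespace IsSkewHopfPairing

variable {C} {φ : Uge C →ₗ[QVT] Ule C →ₗ[QVT] QVT} (h : IsSkewHopfPairing C φ)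

include h

/-- The axiom only provides some lift of `Δ(x)` to the tensor square of `U_{≥0}`; injectivity of the
inclusion identifies it with `comulGe`. -/
theorem apply_mul_right (x : Uge C) (y y' : Ule C) :
    φ x (y * y') = tensorPairing φ (comulGe C x) (y ⊗ₜ y') := by
  obtain ⟨z, hz, hφ⟩ := h.mul_right x
  have : z = comulGe C x := map_val_injective (Uge C) (hz.trans (map_comulGe C x).symm)
  rw [hφ, this]

theorem apply_mul_left (x x' : Uge C) (y : Ule C) : φ (x * x') y =
    tensorPairing φ (x ⊗ₜ x') (TensorProduct.comm QVT (Ule C) (Ule C) (comulLe C y)) := by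
  obtain ⟨z, hz, hφ⟩ := h.mul_left y
  have : z = comulLe C y := map_val_injective (Ule C) (hz.trans (map_comulLe C y).symm)
  rw [hφ, this]

open Classical in
theorem K_mul_word (μ ν : I → ℤ) (l l' : List I) :
    φ (geKmu C μ * geWord C l) (leKpmu C ν * leWord C l') =
      C.brace μ ν * C.brace μ (intDeg (wordDeg l')) * C.brace (intDeg (wordDeg l)) ν *
        φ (geWord C l) (leWord C l') := by
  have h1 := h.K_mul μ ν (wordDeg l) (wordDeg l')
    ⟨geWord C l, coe_mem_UplusW (geWord_mem rfl)⟩ ⟨leWord C l', coe_mem_UminusW (leWord_mem rfl)⟩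
  exact h1

/-- This and the next two values come from the torus axiom applied to words of length at most one,
where the remaining factor is a counit. -/
theorem k_k (i j : I) : φ (geGen C (.k i)) (leGen C (.k j)) = C.br i j := by
  classical
  have h1 := h.K_mul_word (Pi.single i 1) (Pi.single j 1) [] []
  rw [geKmu_single, leKpmu_single, intDeg_nil, C.brace_zero_left, C.brace_zero_right,
    C.brace_single] at h1
  simp only [geWord, leWord, List.map_nil, List.prod_nil, mul_one] at h1
  refine h1.trans ?_
  rw [h.one_left, OneMemClass.coe_one, map_one, mul_one]

theorem k_e (i j : I) : φ (geGen C (.k i)) (leGen C (.e j)) = 0 := by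
  classical
  have h1 := h.K_mul_word (Pi.single i 1) 0 [] [j]
  rw [geKmu_single, leKpmu_zero] at h1
  simp only [geWord, leWord, List.map_nil, List.prod_nil, mul_one, List.map_cons, List.prod_cons,
    Units.val_one, one_mul] at h1
  refine h1.trans ?_
  rw [h.one_left]
  exact mul_eq_zero_of_right _ (counitLe_e C j)

theorem e_k (i j : I) : φ (geGen C (.e i)) (leGen C (.k j)) = 0 := by
  classical
  have h1 := h.K_mul_word 0 (Pi.single j 1) [i] []
  rw [leKpmu_single, geKmu_zero] at h1
  simp only [geWord, leWord, List.map_nil, List.prod_nil, mul_one, List.map_cons, List.prod_cons,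
    Units.val_one, one_mul] at h1
  refine h1.trans ?_
  rw [h.one_right]
  exact mul_eq_zero_of_right _ (counitGe_e C i)

theorem e_e (i : I) : φ (geGen C (.e i)) (leGen C (.e i)) = Pairing.cp C i := h.E_F i

theorem e_e_ne {i j : I} (hij : i ≠ j) : φ (geGen C (.e i)) (leGen C (.e j)) = 0 := h.E_F_ne i j hij

theorem one_apply (y : Ule C) : φ 1 y = counitLe C y := h.one_left y

theorem apply_one (x : Uge C) : φ x 1 = counitGe C x := h.one_right x

theorem E_apply_mul (i : I) (y y' : Ule C) : φ (geGen C (.e i)) (y * y') =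
    φ (geGen C (.e i)) y * counitLe C y' + φ (geGen C (.k i)) y * φ (geGen C (.e i)) y' := by
  rw [h.apply_mul_right, comulGe_gen, comulGeGen, map_add, LinearMap.add_apply, tensorPairing_tmul,
    tensorPairing_tmul, h.one_apply]

theorem mul_apply_F (i : I) (x x' : Uge C) : φ (x * x') (leGen C (.e i)) =
    φ x (leGen C (.e i)) * counitGe C x' + φ x (leGen C (.k i)) * φ x' (leGen C (.e i)) := by
  rw [h.apply_mul_left, comulLe_gen, comulLeGen, map_add, map_add, TensorProduct.comm_tmul,
    TensorProduct.comm_tmul, tensorPairing_tmul, tensorPairing_tmul, h.apply_one]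

theorem E_apply_F_mul (i j : I) (y : Ule C) : φ (geGen C (.e i)) (leGen C (.e j) * y) =
    φ (geGen C (.e i)) (leGen C (.e j)) * counitLe C y := by
  rw [h.E_apply_mul, h.k_e, zero_mul, add_zero]

theorem E_apply_K_mul (i j : I) (y : Ule C) : φ (geGen C (.e i)) (leGen C (.k j) * y) =
    C.br i j * φ (geGen C (.e i)) y := by
  rw [h.E_apply_mul, h.e_k, h.k_k, zero_mul, zero_add]

theorem E_mul_apply_F (i j : I) (x : Uge C) : φ (geGen C (.e j) * x) (leGen C (.e i)) =
    φ (geGen C (.e j)) (leGen C (.e i)) * counitGe C x := by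
  rw [h.mul_apply_F, h.e_k, zero_mul, add_zero]

theorem K_mul_apply_F (i j : I) (x : Uge C) : φ (geGen C (.k j) * x) (leGen C (.e i)) =
    C.br j i * φ x (leGen C (.e i)) := by
  rw [h.mul_apply_F, h.k_e, h.k_k, zero_mul, zero_add]

end IsSkewHopfPairing

/-! ### Adjoints of multiplication by `E_i` and `F_i`. -/

section Adjoint

variable {C} (φ : Uge C →ₗ[QVT] Ule C →ₗ[QVT] QVT)

/-- The adjoint `y ↦ y₁ (E_i, y₂)` of left multiplication by `E_i`. -/
noncomputable def adjEl (i : I) : Ule C →ₗ[QVT] Ule C :=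
  (TensorProduct.rid QVT (Ule C)).toLinearMap ∘ₗ (φ (geGen C (.e i))).lTensor (Ule C) ∘ₗ
    (comulLe C).toLinearMap

/-- The adjoint `y ↦ (E_i, y₁) y₂` of right multiplication by `E_i`. -/
noncomputable def adjEr (i : I) : Ule C →ₗ[QVT] Ule C :=
  (TensorProduct.lid QVT (Ule C)).toLinearMap ∘ₗ (φ (geGen C (.e i))).rTensor (Ule C) ∘ₗ
    (comulLe C).toLinearMap

/-- The adjoint `x ↦ (x₁, F_i) x₂` of left multiplication by `F_i`. -/
noncomputable def adjFl (i : I) : Uge C →ₗ[QVT] Uge C :=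
  (TensorProduct.lid QVT (Uge C)).toLinearMap ∘ₗ (φ.flip (leGen C (.e i))).rTensor (Uge C) ∘ₗ
    (comulGe C).toLinearMap

/-- The adjoint `x ↦ x₁ (x₂, F_i)` of right multiplication by `F_i`. -/
noncomputable def adjFr (i : I) : Uge C →ₗ[QVT] Uge C :=
  (TensorProduct.rid QVT (Uge C)).toLinearMap ∘ₗ (φ.flip (leGen C (.e i))).lTensor (Uge C) ∘ₗ
    (comulGe C).toLinearMap

theorem adjEl_apply (i : I) (y : Ule C) : adjEl φ i y =
    TensorProduct.rid QVT (Ule C) ((φ (geGen C (.e i))).lTensor (Ule C) (comulLe C y)) := rfl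

theorem adjEr_apply (i : I) (y : Ule C) : adjEr φ i y =
    TensorProduct.lid QVT (Ule C) ((φ (geGen C (.e i))).rTensor (Ule C) (comulLe C y)) := rfl

theorem adjFl_apply (i : I) (x : Uge C) : adjFl φ i x =
    TensorProduct.lid QVT (Uge C) ((φ.flip (leGen C (.e i))).rTensor (Uge C) (comulGe C x)) := rfl

theorem adjFr_apply (i : I) (x : Uge C) : adjFr φ i x =
    TensorProduct.rid QVT (Uge C) ((φ.flip (leGen C (.e i))).lTensor (Uge C) (comulGe C x)) := rfl

theorem adjEl_one (h : IsSkewHopfPairing C φ) (i : I) : adjEl φ i 1 = 0 := by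
  simp [adjEl_apply, Algebra.TensorProduct.one_def, h.apply_one, counitGe_e]

theorem adjEr_one (h : IsSkewHopfPairing C φ) (i : I) : adjEr φ i 1 = 0 := by
  simp [adjEr_apply, Algebra.TensorProduct.one_def, h.apply_one, counitGe_e]

theorem adjFl_one (h : IsSkewHopfPairing C φ) (i : I) : adjFl φ i 1 = 0 := by
  simp [adjFl_apply, Algebra.TensorProduct.one_def, h.one_apply, counitLe_e]

theorem adjFr_one (h : IsSkewHopfPairing C φ) (i : I) : adjFr φ i 1 = 0 := by
  simp [adjFr_apply, Algebra.TensorProduct.one_def, h.one_apply, counitLe_e]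

variable {φ} (h : IsSkewHopfPairing C φ)

include h

theorem apply_adjEl (i : I) (x : Uge C) (y : Ule C) :
    φ x (adjEl φ i y) = φ (geGen C (.e i) * x) y := by
  rw [h.apply_mul_left, adjEl_apply]
  generalize comulLe C y = z
  induction z using TensorProduct.induction_on with
  | zero => simp
  | add z w hz hw => simp only [map_add, hz, hw]
  | tmul a b => simp [tensorPairing_tmul]

theorem apply_adjEr (i : I) (x : Uge C) (y : Ule C) :
    φ x (adjEr φ i y) = φ (x * geGen C (.e i)) y := by
  rw [h.apply_mul_left, adjEr_apply]
  generalize comulLe C y = z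
  induction z using TensorProduct.induction_on with
  | zero => simp
  | add z w hz hw => simp only [map_add, hz, hw]
  | tmul a b => simp [tensorPairing_tmul, mul_comm]

theorem apply_adjFl (i : I) (x : Uge C) (y : Ule C) :
    φ (adjFl φ i x) y = φ x (leGen C (.e i) * y) := by
  rw [h.apply_mul_right, adjFl_apply]
  generalize comulGe C x = z
  induction z using TensorProduct.induction_on with
  | zero => simp
  | add z w hz hw => simp only [map_add, LinearMap.add_apply, hz, hw]
  | tmul a b => simp [tensorPairing_tmul]

theorem apply_adjFr (i : I) (x : Uge C) (y : Ule C) :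
    φ (adjFr φ i x) y = φ x (y * leGen C (.e i)) := by
  rw [h.apply_mul_right, adjFr_apply]
  generalize comulGe C x = z
  induction z using TensorProduct.induction_on with
  | zero => simp
  | add z w hz hw => simp only [map_add, LinearMap.add_apply, hz, hw]
  | tmul a b => simp [tensorPairing_tmul, mul_comm]

/-- Expand `Δ(F_j y) = (1 ⊗ F_j + F_j ⊗ K'_j) Δ(y)` and pair the second factor with `E_i`. The first
term yields `(E_i, F_j) ε(y₂)` and the second `{i,j} (E_i, y₂)`. The other three recursions arise in
the same way. -/
theorem adjEl_F_mul (i j : I) (y : Ule C) : adjEl φ i (leGen C (.e j) * y) =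
    φ (geGen C (.e i)) (leGen C (.e j)) • y + C.br i j • (leGen C (.e j) * adjEl φ i y) := by
  -- Recovering `y` from `Δ(y)` through the counit makes both sides linear in `Δ(y)`, which can then
  -- be generalised to an arbitrary tensor and reduced to pure ones.
  have hz := comulLe_counit_right C y
  rw [adjEl_apply, adjEl_apply, map_mul, comulLe_gen, comulLeGen]
  generalize comulLe C y = z at hz ⊢
  subst hz
  induction z using TensorProduct.induction_on with
  | zero => simp
  | add z w hz hw => simp only [map_add, mul_add, smul_add, hz, hw]; abel
  | tmul a b => simp [add_mul, h.E_apply_F_mul, h.E_apply_K_mul, smul_smul]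

/-- The torus factor `K'_j` survives here because it sits in the factor that is not paired. For this
reason `adjEr` does not preserve `U⁻`, and a factor `K'_i⁻¹` is needed later. -/
theorem adjEr_F_mul (i j : I) (y : Ule C) : adjEr φ i (leGen C (.e j) * y) =
    leGen C (.e j) * adjEr φ i y +
      φ (geGen C (.e i)) (leGen C (.e j)) • (leGen C (.k j) * y) := by
  have hz := comulLe_counit_left C y
  rw [adjEr_apply, adjEr_apply, map_mul, comulLe_gen, comulLeGen]
  generalize comulLe C y = z at hz ⊢
  subst hz
  induction z using TensorProduct.induction_on with
  | zero => simp
  | add z w hz hw => simp only [map_add, mul_add, smul_add, hz, hw]; abel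
  | tmul a b => simp [add_mul, h.E_apply_F_mul, smul_smul]

theorem adjFl_E_mul (i j : I) (x : Uge C) : adjFl φ i (geGen C (.e j) * x) =
    φ (geGen C (.e j)) (leGen C (.e i)) • x + C.br j i • (geGen C (.e j) * adjFl φ i x) := by
  have hz := comulGe_counit_left C x
  rw [adjFl_apply, adjFl_apply, map_mul, comulGe_gen, comulGeGen]
  generalize comulGe C x = z at hz ⊢
  subst hz
  induction z using TensorProduct.induction_on with
  | zero => simp
  | add z w hz hw => simp only [map_add, mul_add, smul_add, hz, hw]; abel
  | tmul a b => simp [add_mul, h.E_mul_apply_F, h.K_mul_apply_F, smul_smul]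

theorem adjFr_E_mul (i j : I) (x : Uge C) : adjFr φ i (geGen C (.e j) * x) =
    geGen C (.e j) * adjFr φ i x +
      φ (geGen C (.e j)) (leGen C (.e i)) • (geGen C (.k j) * x) := by
  have hz := comulGe_counit_right C x
  rw [adjFr_apply, adjFr_apply, map_mul, comulGe_gen, comulGeGen]
  generalize comulGe C x = z at hz ⊢
  subst hz
  induction z using TensorProduct.induction_on with
  | zero => simp
  | add z w hz hw => simp only [map_add, mul_add, smul_add, hz, hw]; abel
  | tmul a b => simp [add_mul, h.E_mul_apply_F, smul_smul]

end Adjoint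

end TwoParam

/-! ### Commutators of `E_i` with `U⁻` and of `F_i` with `U⁺`. -/

namespace TwoParam

universe u

variable {I : Type u} [Fintype I] {C : CartanDatum I}

section Torus

theorem F_mul_K (i j : I) : U.F C j * U.K C i = C.br i j • (U.K C i * U.F C j) := by
  rw [U.K_mul_F, ← C.br_inv, smul_smul, mul_inv_cancel₀ (C.br_ne_zero i j), one_smul]

theorem E_mul_Kp (i j : I) : U.E C j * U.Kp C i = C.br j i • (U.Kp C i * U.E C j) := by
  rw [U.Kp_mul_E, ← C.br_swap_inv, smul_smul, mul_inv_cancel₀ (C.br_ne_zero j i), one_smul]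

open Classical in
theorem minusZ_mul_K (i : I) {γ : I → ℤ} {y : Ule C} (hy : y ∈ minusZ C γ) :
    (y : U C) * U.K C i = C.brace (Pi.single i 1) γ • (U.K C i * y) := by
  induction hy using Submodule.span_induction with
  | mem y hy =>
    obtain ⟨l, rfl, rfl⟩ := hy
    rw [coe_leWord]
    induction l with
    | nil => simp [intDeg_nil, C.brace_zero_right]
    | cons j l ih =>
      rw [List.map_cons, List.prod_cons, mul_assoc, ih, mul_smul_comm, ← mul_assoc, F_mul_K,
        smul_mul_assoc, smul_smul, intDeg_cons, C.brace_add_right, C.brace_single, mul_assoc,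
        mul_comm (C.brace _ _)]
  | zero => simp
  | add x y _ _ hx hy => push_cast; rw [mul_add, add_mul, hx, hy, smul_add]
  | smul c x _ hx => push_cast; rw [mul_smul_comm, smul_mul_assoc, hx, smul_comm]

open Classical in
theorem plusZ_mul_Kp (i : I) {γ : I → ℤ} {y : Uge C} (hy : y ∈ plusZ C γ) :
    (y : U C) * U.Kp C i = C.brace γ (Pi.single i 1) • (U.Kp C i * y) := by
  induction hy using Submodule.span_induction with
  | mem y hy =>
    obtain ⟨l, rfl, rfl⟩ := hy
    rw [coe_geWord]
    induction l with
    | nil => simp [intDeg_nil, C.brace_zero_left]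
    | cons j l ih =>
      rw [List.map_cons, List.prod_cons, mul_assoc, ih, mul_smul_comm, ← mul_assoc, E_mul_Kp,
        smul_mul_assoc, smul_smul, intDeg_cons, C.brace_add_left, C.brace_single, mul_assoc,
        mul_comm (C.brace _ _)]
  | zero => simp
  | add x y _ _ hx hy => push_cast; rw [mul_add, add_mul, hx, hy, smul_add]
  | smul c x _ hx => push_cast; rw [mul_smul_comm, smul_mul_assoc, hx, smul_comm]

end Torus

section Commutator

variable {φ : Uge C →ₗ[QVT] Ule C →ₗ[QVT] QVT} (h : IsSkewHopfPairing C φ)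

include h

/-- The normalisation `(E_i, F_i) = (v_i⁻¹ - v_i)⁻¹` is minus the coefficient in the defining
commutator, so the cases `i = j` and `i ≠ j` take a common form in terms of the pairing. -/
theorem E_mul_F_eq (i j : I) : U.E C i * U.F C j = U.F C j * U.E C i -
    φ (geGen C (.e i)) (leGen C (.e j)) • (U.K C i - U.Kp C j) := by
  by_cases hij : i = j
  · subst hij
    rw [h.e_e, Pairing.cp, ← neg_sub (C.vi i), inv_neg, neg_smul, sub_neg_eq_add, ← sub_eq_iff_eq_add']
    exact (U.satisfies C).E_F i
  · rw [h.e_e_ne hij, zero_smul, sub_zero, ← sub_eq_zero]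
    exact (U.satisfies C).E_F_ne i j hij

/-- Induction on the word. Passing `E_i` over the first letter `F_j` creates `-(E_i, F_j)(K_i -
K'_j)`: the `K'_j` part is the new term in the recursion for `adjEr`, the `K_i` part the one for
`adjEl`. The factor `{i,j}` in the latter recursion is the cost of moving `F_j` past `K_i`. -/
theorem E_mul_word (i : I) (l : List I) : U.E C i * (leWord C l : U C) =
    leWord C l * U.E C i + adjEr φ i (leWord C l) - U.K C i * adjEl φ i (leWord C l) := by
  induction l with
  | nil => simp [leWord, adjEr_one φ h, adjEl_one φ h]
  | cons j l ih =>
    rw [leWord_cons, adjEr_F_mul h, adjEl_F_mul h]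
    push_cast
    change U.E C i * (U.F C j * (leWord C l : U C)) = U.F C j * (leWord C l : U C) * U.E C i +
      (U.F C j * (adjEr φ i (leWord C l) : U C) + φ (geGen C (.e i)) (leGen C (.e j)) •
        (U.Kp C j * (leWord C l : U C))) -
      U.K C i * (φ (geGen C (.e i)) (leGen C (.e j)) • (leWord C l : U C) + C.br i j •
        (U.F C j * (adjEl φ i (leWord C l) : U C)))
    rw [← mul_assoc, E_mul_F_eq h, sub_mul, mul_assoc, ih, mul_sub, mul_add, mul_add,
      mul_smul_comm (C.br i j), ← mul_assoc (U.K C i), ← smul_mul_assoc (C.br i j), ← F_mul_K,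
      smul_mul_assoc, sub_mul, smul_sub, mul_smul_comm]
    simp only [mul_assoc]
    abel

/-- The mirror image of `E_mul_word`: `F_i` enters from the right, `K_j` is absorbed by `adjFr`, and
the remaining `K'_i` stands in front of `adjFl`. -/
theorem word_mul_F (i : I) (l : List I) : (geWord C l : U C) * U.F C i =
    U.F C i * geWord C l - adjFr φ i (geWord C l) + U.Kp C i * adjFl φ i (geWord C l) := by
  induction l with
  | nil => simp [geWord, adjFr_one φ h, adjFl_one φ h]
  | cons j l ih =>
    rw [geWord_cons, adjFr_E_mul h, adjFl_E_mul h]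
    push_cast
    change U.E C j * (geWord C l : U C) * U.F C i = U.F C i * (U.E C j * (geWord C l : U C)) -
      (U.E C j * (adjFr φ i (geWord C l) : U C) + φ (geGen C (.e j)) (leGen C (.e i)) •
        (U.K C j * (geWord C l : U C))) +
      U.Kp C i * (φ (geGen C (.e j)) (leGen C (.e i)) • (geWord C l : U C) + C.br j i •
        (U.E C j * (adjFl φ i (geWord C l) : U C)))
    rw [mul_assoc, ih, mul_add, mul_sub, ← mul_assoc, E_mul_F_eq h, mul_add,
      mul_smul_comm (C.br j i), ← mul_assoc (U.Kp C i), ← smul_mul_assoc (C.br j i), ← E_mul_Kp,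
      sub_mul, smul_mul_assoc, sub_mul, smul_sub, mul_smul_comm]
    simp only [mul_assoc]
    abel

/-- The commutator of `E_i` with an element of `U⁻`. -/
theorem E_mul_minusZ (i : I) {γ : I → ℤ} {y : Ule C} (hy : y ∈ minusZ C γ) :
    U.E C i * (y : U C) = y * U.E C i + adjEr φ i y - U.K C i * adjEl φ i y := by
  induction hy using Submodule.span_induction with
  | mem y hy => obtain ⟨l, -, rfl⟩ := hy; exact E_mul_word h i l
  | zero => simp
  | add x y _ _ hx hy =>
    simp only [map_add]; push_cast; rw [mul_add, add_mul, hx, hy, mul_add]; abel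
  | smul c x _ hx =>
    simp only [map_smul]; push_cast
    rw [mul_smul_comm, smul_mul_assoc, hx, mul_smul_comm, smul_sub, smul_add]

/-- The commutator of `F_i` with an element of `U⁺`. -/
theorem plusZ_mul_F (i : I) {γ : I → ℤ} {x : Uge C} (hx : x ∈ plusZ C γ) :
    (x : U C) * U.F C i = U.F C i * x - adjFr φ i x + U.Kp C i * adjFl φ i x := by
  induction hx using Submodule.span_induction with
  | mem y hy => obtain ⟨l, -, rfl⟩ := hy; exact word_mul_F h i l
  | zero => simp
  | add x y _ _ hx hy =>
    simp only [map_add]; push_cast; rw [mul_add, add_mul, hx, hy, mul_add]; abel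
  | smul c x _ hx =>
    simp only [map_smul]; push_cast
    rw [mul_smul_comm, smul_mul_assoc, hx, mul_smul_comm, smul_add, smul_sub]

end Commutator

/-! ### Degrees of the adjoints, and the correction by torus elements. -/

section Degree

open Classical

variable {φ : Uge C →ₗ[QVT] Ule C →ₗ[QVT] QVT} (h : IsSkewHopfPairing C φ)

include h

theorem adjEl_mem (i : I) {γ : I → ℤ} {y : Ule C} (hy : y ∈ minusZ C γ) :
    adjEl φ i y ∈ minusZ C (γ - Pi.single i 1) := by
  induction hy using Submodule.span_induction with
  | mem y hy =>
    obtain ⟨l, rfl, rfl⟩ := hy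
    induction l with
    | nil => simp [leWord, adjEl_one φ h]
    | cons j l ih =>
      rw [leWord_cons, adjEl_F_mul h]
      refine add_mem ?_ (Submodule.smul_mem _ _ (F_mul_mem j ?_ ih))
      · by_cases hij : i = j
        · subst hij
          exact Submodule.smul_mem _ _ (leWord_mem (by rw [intDeg_cons, add_sub_cancel_left]))
        · rw [h.e_e_ne hij, zero_smul]; exact zero_mem _
      · rw [intDeg_cons, add_sub_assoc]
  | zero => simp
  | add x y _ _ hx hy => rw [map_add]; exact add_mem hx hy
  | smul c x _ hx => rw [map_smul]; exact Submodule.smul_mem _ _ hx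

theorem adjFl_mem (i : I) {γ : I → ℤ} {x : Uge C} (hx : x ∈ plusZ C γ) :
    adjFl φ i x ∈ plusZ C (γ - Pi.single i 1) := by
  induction hx using Submodule.span_induction with
  | mem y hy =>
    obtain ⟨l, rfl, rfl⟩ := hy
    induction l with
    | nil => simp [geWord, adjFl_one φ h]
    | cons j l ih =>
      rw [geWord_cons, adjFl_E_mul h]
      refine add_mem ?_ (Submodule.smul_mem _ _ (E_mul_mem j ?_ ih))
      · by_cases hij : j = i
        · subst hij
          exact Submodule.smul_mem _ _ (geWord_mem (by rw [intDeg_cons, add_sub_cancel_left]))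
        · rw [h.e_e_ne hij, zero_smul]; exact zero_mem _
      · rw [intDeg_cons, add_sub_assoc]
  | zero => simp
  | add x y _ _ hx hy => rw [map_add]; exact add_mem hx hy
  | smul c x _ hx => rw [map_smul]; exact Submodule.smul_mem _ _ hx

/-- Each nonzero contribution in the recursion for `adjEr` carries exactly one factor `K'_i`. It can
be moved to the right at the cost of a scalar, where it cancels against `K'_i⁻¹` and leaves an
element of `U⁻` of lowered degree. -/
theorem adjEr_mul_mem (i : I) {γ : I → ℤ} {y : Ule C} (hy : y ∈ minusZ C γ) :
    adjEr φ i y * leGen C (.ki i) ∈ minusZ C (γ - Pi.single i 1) := by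
  induction hy using Submodule.span_induction with
  | mem y hy =>
    obtain ⟨l, rfl, rfl⟩ := hy
    induction l with
    | nil => simp [leWord, adjEr_one φ h]
    | cons j l ih =>
      rw [leWord_cons, adjEr_F_mul h, add_mul, mul_assoc]
      refine add_mem (F_mul_mem j ?_ ih) ?_
      · rw [intDeg_cons, add_sub_assoc]
      · by_cases hij : i = j
        · subst hij
          rw [Kp_mul_minusZ i (leWord_mem rfl), smul_mul_assoc, smul_mul_assoc, mul_assoc,
            (leGen_satisfies C).k_ki, mul_one]
          exact Submodule.smul_mem _ _ (Submodule.smul_mem _ _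
            (leWord_mem (by rw [intDeg_cons, add_sub_cancel_left])))
        · rw [h.e_e_ne hij, zero_smul, zero_mul]; exact zero_mem _
  | zero => simp
  | add x y _ _ hx hy => rw [map_add, add_mul]; exact add_mem hx hy
  | smul c x _ hx => rw [map_smul, smul_mul_assoc]; exact Submodule.smul_mem _ _ hx

theorem adjFr_mul_mem (i : I) {γ : I → ℤ} {x : Uge C} (hx : x ∈ plusZ C γ) :
    adjFr φ i x * geGen C (.ki i) ∈ plusZ C (γ - Pi.single i 1) := by
  induction hx using Submodule.span_induction with
  | mem y hy =>
    obtain ⟨l, rfl, rfl⟩ := hy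
    induction l with
    | nil => simp [geWord, adjFr_one φ h]
    | cons j l ih =>
      rw [geWord_cons, adjFr_E_mul h, add_mul, mul_assoc]
      refine add_mem (E_mul_mem j ?_ ih) ?_
      · rw [intDeg_cons, add_sub_assoc]
      · by_cases hij : j = i
        · subst hij
          rw [K_mul_plusZ j (geWord_mem rfl), smul_mul_assoc, smul_mul_assoc, mul_assoc,
            (geGen_satisfies C).k_ki, mul_one]
          exact Submodule.smul_mem _ _ (Submodule.smul_mem _ _
            (geWord_mem (by rw [intDeg_cons, add_sub_cancel_left])))
        · rw [h.e_e_ne hij, zero_smul, zero_mul]; exact zero_mem _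
  | zero => simp
  | add x y _ _ hx hy => rw [map_add, add_mul]; exact add_mem hx hy
  | smul c x _ hx => rw [map_smul, smul_mul_assoc]; exact Submodule.smul_mem _ _ hx

theorem apply_Kp_mul (i : I) {γ δ : I → ℤ} {x : Uge C} (hx : x ∈ plusZ C γ) {y : Ule C}
    (hy : y ∈ minusZ C δ) :
    φ x (leGen C (.k i) * y) = C.brace γ (Pi.single i 1) * φ x y := by
  induction hx using Submodule.span_induction with
  | mem x hx =>
    obtain ⟨l, rfl, rfl⟩ := hx
    induction hy using Submodule.span_induction with
    | mem y hy =>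
      obtain ⟨l', rfl, rfl⟩ := hy
      have h1 := h.K_mul_word 0 (Pi.single i 1) l l'
      rwa [geKmu_zero, leKpmu_single, C.brace_zero_left, C.brace_zero_left, Units.val_one, one_mul,
        one_mul, one_mul] at h1
    | zero => simp
    | add x y _ _ hx hy => rw [mul_add, map_add, hx, hy, map_add, mul_add]
    | smul c x _ hx => rw [mul_smul_comm, map_smul, hx, map_smul, mul_smul_comm]
  | zero => simp
  | add x y _ _ hx hy => rw [map_add, LinearMap.add_apply, hx, hy, LinearMap.add_apply, mul_add]
  | smul c x _ hx => rw [map_smul, LinearMap.smul_apply, hx, LinearMap.smul_apply, mul_smul_comm]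

theorem K_mul_apply (i : I) {γ δ : I → ℤ} {x : Uge C} (hx : x ∈ plusZ C γ) {y : Ule C}
    (hy : y ∈ minusZ C δ) :
    φ (geGen C (.k i) * x) y = C.brace (Pi.single i 1) δ * φ x y := by
  induction hx using Submodule.span_induction with
  | mem x hx =>
    obtain ⟨l, rfl, rfl⟩ := hx
    induction hy using Submodule.span_induction with
    | mem y hy =>
      obtain ⟨l', rfl, rfl⟩ := hy
      have h1 := h.K_mul_word (Pi.single i 1) 0 l l'
      rwa [leKpmu_zero, geKmu_single, C.brace_zero_right, C.brace_zero_right, Units.val_one, one_mul,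
        one_mul, mul_one] at h1
    | zero => simp
    | add x y _ _ hx hy => rw [map_add, hx, hy, map_add, mul_add]
    | smul c x _ hx => rw [map_smul, hx, map_smul, mul_smul_comm]
  | zero => simp
  | add x y _ _ hx hy => rw [mul_add, map_add, LinearMap.add_apply, hx, hy, map_add,
      LinearMap.add_apply, mul_add]
  | smul c x _ hx => rw [mul_smul_comm, map_smul, LinearMap.smul_apply, hx, map_smul,
      LinearMap.smul_apply, mul_smul_comm]

/-- The factor `K'_i⁻¹` does not affect the pairing with `U⁺`. Putting `K'_i` in front multiplies
the pairing by `{γ,i}` by the torus axiom, and moving it to the right through an element of `U⁻` of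
the same degree `γ` produces the same scalar. -/
theorem apply_adjEr_mul (i : I) {γ : I → ℤ} {x : Uge C} (hx : x ∈ plusZ C γ) {y : Ule C}
    (hy : y ∈ minusZ C (Pi.single i 1 + γ)) :
    φ x (adjEr φ i y * leGen C (.ki i)) = φ (x * geGen C (.e i)) y := by
  have hr := adjEr_mul_mem h i hy
  rw [add_sub_cancel_left] at hr
  have h1 := apply_Kp_mul h i hx hr
  rw [Kp_mul_minusZ i hr, map_smul, smul_eq_mul, mul_assoc, (leGen_satisfies C).ki_k, mul_one,
    apply_adjEr h] at h1
  exact (mul_left_cancel₀ (C.brace_ne_zero _ _) h1).symm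

theorem adjFr_mul_apply (i : I) {γ : I → ℤ} {x : Uge C} (hx : x ∈ plusZ C (Pi.single i 1 + γ))
    {y : Ule C} (hy : y ∈ minusZ C γ) :
    φ (adjFr φ i x * geGen C (.ki i)) y = φ x (y * leGen C (.e i)) := by
  have hr := adjFr_mul_mem h i hx
  rw [add_sub_cancel_left] at hr
  have h1 := K_mul_apply h i hr hy
  rw [K_mul_plusZ i hr, map_smul, LinearMap.smul_apply, smul_eq_mul, mul_assoc,
    (geGen_satisfies C).ki_k, mul_one, apply_adjFr h] at h1
  exact (mul_left_cancel₀ (C.brace_ne_zero _ _) h1).symm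

end Degree

end TwoParam

/-! ### Expansions in dual bases and adjoint operators on the canonical element. -/

namespace TwoParam

universe u

variable {I : Type u} [Fintype I] {C : CartanDatum I}

section DualBasis

variable {φ : Uge C →ₗ[QVT] Ule C →ₗ[QVT] QVT} {ν : I → ℕ} {ι : Type*} [Fintype ι] [DecidableEq ι]
  {b : Module.Basis ι QVT (UminusW C ν)} {bs : Module.Basis ι QVT (UplusW C ν)}

theorem minus_expansion
    (hd : ∀ a a', φ (plusIncl C ν (bs a)) (minusIncl C ν (b a')) = if a = a' then 1 else 0)
    {y : Ule C} (hy : y ∈ minusZ C (intDeg ν)) :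
    (y : U C) = ∑ a, φ (plusIncl C ν (bs a)) y • (b a : U C) := by
  obtain ⟨y', rfl⟩ : ∃ y', minusIncl C ν y' = y := ⟨⟨y, coe_mem_UminusW hy⟩, rfl⟩
  have h1 : ∀ a, φ (plusIncl C ν (bs a)) (minusIncl C ν y') = b.repr y' a := by
    intro a
    conv_lhs => rw [← b.sum_repr y', map_sum, map_sum]
    simp only [map_smul, hd, smul_eq_mul, mul_ite, mul_one, mul_zero, Finset.sum_ite_eq,
      Finset.mem_univ, if_true]
  have h2 := congrArg (UminusW C ν).subtype (b.sum_repr y')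
  rw [map_sum] at h2
  simp only [h1]
  exact h2.symm

theorem plus_expansion
    (hd : ∀ a a', φ (plusIncl C ν (bs a)) (minusIncl C ν (b a')) = if a = a' then 1 else 0)
    {x : Uge C} (hx : x ∈ plusZ C (intDeg ν)) :
    (x : U C) = ∑ a, φ x (minusIncl C ν (b a)) • (bs a : U C) := by
  obtain ⟨x', rfl⟩ : ∃ x', plusIncl C ν x' = x := ⟨⟨x, coe_mem_UplusW hx⟩, rfl⟩
  have h1 : ∀ a, φ (plusIncl C ν x') (minusIncl C ν (b a)) = bs.repr x' a := by
    intro a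
    conv_lhs => rw [← bs.sum_repr x', map_sum, map_sum, LinearMap.sum_apply]
    simp only [map_smul, LinearMap.smul_apply, hd, smul_eq_mul, mul_ite, mul_one, mul_zero,
      Finset.sum_ite_eq', Finset.mem_univ, if_true]
  have h2 := congrArg (UplusW C ν).subtype (bs.sum_repr x')
  rw [map_sum] at h2
  simp only [h1]
  exact h2.symm

/-- For adjoint maps `L` and `M`, applying `L` to the first factor of the canonical element is
applying `M` to the second. -/
theorem sum_transfer {ν' : I → ℕ} {ι' : Type*} [Fintype ι'] [DecidableEq ι']
    {b' : Module.Basis ι' QVT (UminusW C ν')} {bs' : Module.Basis ι' QVT (UplusW C ν')}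
    (hd : ∀ a a', φ (plusIncl C ν (bs a)) (minusIncl C ν (b a')) = if a = a' then 1 else 0)
    (hd' : ∀ a a', φ (plusIncl C ν' (bs' a)) (minusIncl C ν' (b' a')) = if a = a' then 1 else 0)
    {L : Ule C → Ule C} {M : Uge C → Uge C}
    (hL : ∀ y ∈ minusZ C (intDeg ν'), L y ∈ minusZ C (intDeg ν))
    (hM : ∀ x ∈ plusZ C (intDeg ν), M x ∈ plusZ C (intDeg ν'))
    (hLM : ∀ x ∈ plusZ C (intDeg ν), ∀ y ∈ minusZ C (intDeg ν'), φ x (L y) = φ (M x) y) :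
    ∑ a, (L (minusIncl C ν' (b' a)) : U C) ⊗ₜ[QVT] (bs' a : U C) =
      ∑ a, (b a : U C) ⊗ₜ[QVT] (M (plusIncl C ν (bs a)) : U C) := by
  -- Expanding `L` in the basis `b` and `M` in the basis `bs'` gives the same coefficients `φ(M
  -- b*_c, b'_a)`, so both sides are the same double sum.
  have h1 : ∀ a, (L (minusIncl C ν' (b' a)) : U C) ⊗ₜ[QVT] (bs' a : U C) =
      ∑ c, φ (M (plusIncl C ν (bs c))) (minusIncl C ν' (b' a)) • ((b c : U C) ⊗ₜ[QVT] (bs' a : U C)) := by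
    intro a
    rw [minus_expansion hd (hL _ (minusIncl_mem _)), TensorProduct.sum_tmul]
    refine Finset.sum_congr rfl fun c _ => ?_
    rw [hLM _ (plusIncl_mem _) _ (minusIncl_mem _), TensorProduct.smul_tmul']
  have h2 : ∀ c, (b c : U C) ⊗ₜ[QVT] (M (plusIncl C ν (bs c)) : U C) =
      ∑ a, φ (M (plusIncl C ν (bs c))) (minusIncl C ν' (b' a)) • ((b c : U C) ⊗ₜ[QVT] (bs' a : U C)) := by
    intro c
    rw [plus_expansion hd' (hM _ (plusIncl_mem _)), TensorProduct.tmul_sum]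
    exact Finset.sum_congr rfl fun a _ => TensorProduct.tmul_smul _ _ _
  simp only [h1, h2]
  exact Finset.sum_comm

/-- Only the empty word has degree zero, so every element of the piece is the scalar `φ(1, y)`.
Moving these scalars to the second factor leaves the expansion of `1` in the dual basis. -/
theorem quasiRComp_zero {b : Module.Basis ι QVT (UminusW C 0)} {bs : Module.Basis ι QVT (UplusW C 0)}
    (h : IsSkewHopfPairing C φ)
    (hd : ∀ a a', φ (plusIncl C 0 (bs a)) (minusIncl C 0 (b a')) = if a = a' then 1 else 0) :
    quasiRComp C b bs = 1 ⊗ₜ 1 := by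
  have h0 : intDeg (0 : I → ℕ) = 0 := rfl
  have hone : (1 : Uge C) ∈ plusZ C (intDeg 0) := by
    have := geWord_mem (C := C) (γ := intDeg 0) (l := []) (by rw [h0, intDeg_nil])
    simpa [geWord] using this
  have hone' : (1 : Ule C) ∈ minusZ C (intDeg 0) := by
    have := leWord_mem (C := C) (γ := intDeg 0) (l := []) (by rw [h0, intDeg_nil])
    simpa [leWord] using this
  have hb : ∀ y : UminusW C 0, (y : U C) = φ 1 (minusIncl C 0 y) • (1 : U C) := by
    intro y
    have := UminusW_induction C (α := 0) (p := fun y => (y : U C) = φ 1 y • (1 : U C)) ?_ ?_ ?_ ?_ y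
    · exact this
    · intro l hl
      have : l = [] := by
        rw [← List.length_eq_zero_iff, ← tr_wordDeg, hl]; simp [tr]
      subst this
      simp [leWord, h.one_apply]
    · simp
    · intro x y hx hy
      rw [map_add, add_smul, ← hx, ← hy]; rfl
    · intro c x hx
      rw [map_smul, smul_assoc, ← hx]; rfl
  rw [quasiRComp]
  have h1 : ∀ a, (b a : U C) ⊗ₜ[QVT] (bs a : U C) =
      1 ⊗ₜ[QVT] (φ 1 (minusIncl C 0 (b a)) • (bs a : U C)) := by
    intro a
    conv_lhs => rw [hb (b a)]
    rw [TensorProduct.smul_tmul]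
  simp only [h1]
  rw [← TensorProduct.tmul_sum, ← plus_expansion hd hone]
  rfl

end DualBasis

/-! ### The homogeneous components of the intertwining relation. -/

section Component

open Classical

variable {φ : Uge C →ₗ[QVT] Ule C →ₗ[QVT] QVT} {ν ν' : I → ℕ} {ι ι' : Type*} [Fintype ι]
  [DecidableEq ι] [Fintype ι'] [DecidableEq ι']
  {b : Module.Basis ι QVT (UminusW C ν)} {bs : Module.Basis ι QVT (UplusW C ν)}
  {b' : Module.Basis ι' QVT (UminusW C ν')} {bs' : Module.Basis ι' QVT (UplusW C ν')}

theorem intDeg_add_single {I : Type*} (i : I) (ν : I → ℕ) :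
    intDeg (Pi.single i 1 + ν) = Pi.single i 1 + intDeg ν := by
  ext j
  by_cases hj : j = i
  · subst hj; simp [intDeg]
  · simp [intDeg, hj]

omit [DecidableEq ι] in
-- The two factors have opposite degrees `-ν` and `ν`, so the scalars `{i,ν}` produced on the two
-- sides cancel.
theorem K_tmul_K_comm (i : I) :
    Commute (U.K C i ⊗ₜ[QVT] U.K C i) (quasiRComp C b bs) := by
  rw [quasiRComp]
  refine Commute.sum_right _ _ _ fun a _ => ?_
  have h1 := minusZ_mul_K i (minusIncl_mem (b a))
  have h2 : U.K C i * (bs a : U C) = _ := congrArg Subtype.val (K_mul_plusZ i (plusIncl_mem (bs a)))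
  change (b a : U C) * U.K C i = _ • (U.K C i * (b a : U C)) at h1
  change U.K C i * (bs a : U C) = _ • ((bs a : U C) * U.K C i) at h2
  rw [Commute, SemiconjBy, Algebra.TensorProduct.tmul_mul_tmul, Algebra.TensorProduct.tmul_mul_tmul,
    h1, h2, TensorProduct.smul_tmul]

omit [DecidableEq ι] in
theorem Kp_tmul_Kp_comm (i : I) :
    Commute (U.Kp C i ⊗ₜ[QVT] U.Kp C i) (quasiRComp C b bs) := by
  rw [quasiRComp]
  refine Commute.sum_right _ _ _ fun a _ => ?_
  have h1 := plusZ_mul_Kp i (plusIncl_mem (bs a))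
  have h2 : U.Kp C i * (b a : U C) = _ := congrArg Subtype.val (Kp_mul_minusZ i (minusIncl_mem (b a)))
  change (bs a : U C) * U.Kp C i = _ • (U.Kp C i * (bs a : U C)) at h1
  change U.Kp C i * (b a : U C) = _ • ((b a : U C) * U.Kp C i) at h2
  rw [Commute, SemiconjBy, Algebra.TensorProduct.tmul_mul_tmul, Algebra.TensorProduct.tmul_mul_tmul,
    h1, h2, TensorProduct.smul_tmul]

variable (h : IsSkewHopfPairing C φ)

include h

/-- The commutator formula applied to the first factors of `Θ_{ν'}` leaves the sum of `adjEr φ i b'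
⊗ b'*` minus the sum of `K_i adjEl φ i b' ⊗ b'*`. By adjunction these become `Θ_ν (K'_i ⊗ E_i)` and
`(K_i ⊗ E_i) Θ_ν`: the left adjoint produces left multiplication by `E_i`, the right adjoint right
multiplication. -/
theorem E_quasiRComp (i : I) (hν : ν' = Pi.single i 1 + ν)
    (hd : ∀ a a', φ (plusIncl C ν (bs a)) (minusIncl C ν (b a')) = if a = a' then 1 else 0)
    (hd' : ∀ a a', φ (plusIncl C ν' (bs' a)) (minusIncl C ν' (b' a')) = if a = a' then 1 else 0) :
    (U.E C i ⊗ₜ[QVT] 1) * quasiRComp C b' bs' + (U.K C i ⊗ₜ[QVT] U.E C i) * quasiRComp C b bs =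
      quasiRComp C b' bs' * (U.E C i ⊗ₜ[QVT] 1) +
        quasiRComp C b bs * (U.Kp C i ⊗ₜ[QVT] U.E C i) := by
  have hdeg : intDeg ν' = Pi.single i 1 + intDeg ν := by rw [hν, intDeg_add_single]
  have hdeg' : intDeg ν' - Pi.single i 1 = intDeg ν := by rw [hdeg, add_sub_cancel_left]
  have h1 := sum_transfer hd hd' (L := adjEl φ i) (M := fun x => geGen C (.e i) * x)
    (fun y hy => hdeg' ▸ adjEl_mem h i hy) (fun x hx => E_mul_mem i hdeg hx)
    (fun x _ y _ => apply_adjEl h i x y)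
  -- The factor `K'_i⁻¹` brings the values of `adjEr` back into `U⁻`, where the dual basis applies;
  -- it is removed afterwards by multiplying on the right by `K'_i ⊗ 1`.
  have h2 := sum_transfer hd hd' (L := fun y => adjEr φ i y * leGen C (.ki i))
    (M := fun x => x * geGen C (.e i))
    (fun y hy => hdeg' ▸ adjEr_mul_mem h i hy) (fun x hx => mul_E_mem i hdeg hx)
    (fun x hx y hy => apply_adjEr_mul h i hx (hdeg ▸ hy))
  have h1' : (U.K C i ⊗ₜ[QVT] U.E C i) * quasiRComp C b bs =
      ∑ a, (U.K C i * (adjEl φ i (minusIncl C ν' (b' a)) : U C)) ⊗ₜ[QVT] (bs' a : U C) := by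
    have := congrArg (fun z => (U.K C i ⊗ₜ[QVT] 1) * z) h1
    simp only [Finset.mul_sum, Algebra.TensorProduct.tmul_mul_tmul, one_mul] at this
    rw [this, quasiRComp, Finset.mul_sum]
    exact Finset.sum_congr rfl fun a _ => Algebra.TensorProduct.tmul_mul_tmul _ _ _ _
  have h2' : quasiRComp C b bs * (U.Kp C i ⊗ₜ[QVT] U.E C i) =
      ∑ a, (adjEr φ i (minusIncl C ν' (b' a)) : U C) ⊗ₜ[QVT] (bs' a : U C) := by
    have := congrArg (fun z => z * (U.Kp C i ⊗ₜ[QVT] 1)) h2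
    simp only [Finset.sum_mul, Algebra.TensorProduct.tmul_mul_tmul, mul_one] at this
    rw [quasiRComp, Finset.sum_mul]
    refine Eq.trans (Finset.sum_congr rfl fun a _ => Algebra.TensorProduct.tmul_mul_tmul _ _ _ _)
      (this.symm.trans (Finset.sum_congr rfl fun a _ => ?_))
    have h3 : adjEr φ i (minusIncl C ν' (b' a)) * leGen C (.ki i) * leGen C (.k i) =
        adjEr φ i (minusIncl C ν' (b' a)) := by
      rw [mul_assoc, (leGen_satisfies C).ki_k, mul_one]
    exact congrArg (· ⊗ₜ[QVT] (bs' a : U C)) (congrArg Subtype.val h3)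
  rw [h1', h2', quasiRComp, Finset.mul_sum, Finset.sum_mul, ← Finset.sum_add_distrib,
    ← Finset.sum_add_distrib]
  refine Finset.sum_congr rfl fun a _ => ?_
  rw [Algebra.TensorProduct.tmul_mul_tmul, Algebra.TensorProduct.tmul_mul_tmul, one_mul, mul_one,
    ← TensorProduct.add_tmul, ← TensorProduct.add_tmul]
  have h4 := E_mul_minusZ h i (minusIncl_mem (b' a))
  change U.E C i * (b' a : U C) = (b' a : U C) * U.E C i + _ - _ at h4
  rw [h4, sub_add_cancel]

/-- As for `E_i` with the tensor factors exchanged: the commutator formula is applied to the second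
factors of `Θ_{ν'}`, and the adjoints of multiplication by `F_i` move it to the first factors of
`Θ_ν`. -/
theorem F_quasiRComp (i : I) (hν : ν' = Pi.single i 1 + ν)
    (hd : ∀ a a', φ (plusIncl C ν (bs a)) (minusIncl C ν (b a')) = if a = a' then 1 else 0)
    (hd' : ∀ a a', φ (plusIncl C ν' (bs' a)) (minusIncl C ν' (b' a')) = if a = a' then 1 else 0) :
    (1 ⊗ₜ[QVT] U.F C i) * quasiRComp C b' bs' + (U.F C i ⊗ₜ[QVT] U.Kp C i) * quasiRComp C b bs =
      quasiRComp C b' bs' * (1 ⊗ₜ[QVT] U.F C i) +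
        quasiRComp C b bs * (U.F C i ⊗ₜ[QVT] U.K C i) := by
  have hdeg : intDeg ν' = Pi.single i 1 + intDeg ν := by rw [hν, intDeg_add_single]
  have hdeg' : intDeg ν' - Pi.single i 1 = intDeg ν := by rw [hdeg, add_sub_cancel_left]
  have h1 := sum_transfer hd' hd (L := fun y => leGen C (.e i) * y) (M := adjFl φ i)
    (fun y hy => F_mul_mem i hdeg hy) (fun x hx => hdeg' ▸ adjFl_mem h i hx)
    (fun x _ y _ => (apply_adjFl h i x y).symm)
  have h2 := sum_transfer hd' hd (L := fun y => y * leGen C (.e i))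
    (M := fun x => adjFr φ i x * geGen C (.ki i))
    (fun y hy => mul_F_mem i hdeg hy) (fun x hx => hdeg' ▸ adjFr_mul_mem h i hx)
    (fun x hx y hy => (adjFr_mul_apply h i (hdeg ▸ hx) hy).symm)
  have h1' : (U.F C i ⊗ₜ[QVT] U.Kp C i) * quasiRComp C b bs =
      ∑ a, (b' a : U C) ⊗ₜ[QVT] (U.Kp C i * (adjFl φ i (plusIncl C ν' (bs' a)) : U C)) := by
    have := congrArg (fun z => (1 ⊗ₜ[QVT] U.Kp C i) * z) h1
    simp only [Finset.mul_sum, Algebra.TensorProduct.tmul_mul_tmul, one_mul] at this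
    rw [← this, quasiRComp, Finset.mul_sum]
    exact Finset.sum_congr rfl fun a _ => Algebra.TensorProduct.tmul_mul_tmul _ _ _ _
  have h2' : quasiRComp C b bs * (U.F C i ⊗ₜ[QVT] U.K C i) =
      ∑ a, (b' a : U C) ⊗ₜ[QVT] (adjFr φ i (plusIncl C ν' (bs' a)) : U C) := by
    have := congrArg (fun z => z * (1 ⊗ₜ[QVT] U.K C i)) h2
    simp only [Finset.sum_mul, Algebra.TensorProduct.tmul_mul_tmul, mul_one] at this
    rw [quasiRComp, Finset.sum_mul]
    refine Eq.trans (Finset.sum_congr rfl fun a _ => Algebra.TensorProduct.tmul_mul_tmul _ _ _ _)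
      (this.trans (Finset.sum_congr rfl fun a _ => ?_))
    have h3 : adjFr φ i (plusIncl C ν' (bs' a)) * geGen C (.ki i) * geGen C (.k i) =
        adjFr φ i (plusIncl C ν' (bs' a)) := by
      rw [mul_assoc, (geGen_satisfies C).ki_k, mul_one]
    exact congrArg ((b' a : U C) ⊗ₜ[QVT] ·) (congrArg Subtype.val h3)
  rw [h1', h2', quasiRComp, Finset.mul_sum, Finset.sum_mul, ← Finset.sum_add_distrib,
    ← Finset.sum_add_distrib]
  refine Finset.sum_congr rfl fun a _ => ?_
  rw [Algebra.TensorProduct.tmul_mul_tmul, Algebra.TensorProduct.tmul_mul_tmul, one_mul, mul_one,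
    ← TensorProduct.tmul_add, ← TensorProduct.tmul_add]
  have h4 := plusZ_mul_F h i (plusIncl_mem (bs' a))
  change (bs' a : U C) * U.F C i = U.F C i * (bs' a : U C) - _ + _ at h4
  rw [h4]
  congr 1
  abel

omit [DecidableEq ι] in
-- Both correction terms in the commutator formula would have a negative coordinate at `i`, hence
-- vanish. These `ν` are exactly those not of the form `i + ν₀`, so no component identity covers
-- them.
theorem E_quasiRComp_of_eq_zero (i : I) (hν : ν i = 0) :
    (U.E C i ⊗ₜ[QVT] 1) * quasiRComp C b bs = quasiRComp C b bs * (U.E C i ⊗ₜ[QVT] 1) := by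
  rw [quasiRComp, Finset.mul_sum, Finset.sum_mul]
  refine Finset.sum_congr rfl fun a _ => ?_
  rw [Algebra.TensorProduct.tmul_mul_tmul, Algebra.TensorProduct.tmul_mul_tmul, one_mul, mul_one]
  have hneg : (intDeg ν - Pi.single i 1 : I → ℤ) i < 0 := by simp [intDeg, hν]
  have h4 := E_mul_minusZ h i (minusIncl_mem (b a))
  have h5 := eq_zero_of_mem_minusZ hneg (adjEl_mem h i (minusIncl_mem (b a)))
  -- Only the multiple of `adjEr` by `K'_i⁻¹` is known to be homogeneous in `U⁻`; its vanishing
  -- suffices because `K'_i` is invertible.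
  have h6 : adjEr φ i (minusIncl C ν (b a)) = 0 := by
    rw [← mul_one (adjEr φ i _), ← (leGen_satisfies C).ki_k i, ← mul_assoc,
      eq_zero_of_mem_minusZ hneg (adjEr_mul_mem h i (minusIncl_mem (b a))), zero_mul]
  rw [h5, h6] at h4
  simp only [ZeroMemClass.coe_zero, mul_zero, add_zero, sub_zero] at h4
  exact congrArg (· ⊗ₜ[QVT] (bs a : U C)) h4

omit [DecidableEq ι] in
theorem F_quasiRComp_of_eq_zero (i : I) (hν : ν i = 0) :
    (1 ⊗ₜ[QVT] U.F C i) * quasiRComp C b bs = quasiRComp C b bs * (1 ⊗ₜ[QVT] U.F C i) := by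
  rw [quasiRComp, Finset.mul_sum, Finset.sum_mul]
  refine Finset.sum_congr rfl fun a _ => ?_
  rw [Algebra.TensorProduct.tmul_mul_tmul, Algebra.TensorProduct.tmul_mul_tmul, one_mul, mul_one]
  have hneg : (intDeg ν - Pi.single i 1 : I → ℤ) i < 0 := by simp [intDeg, hν]
  have h4 := plusZ_mul_F h i (plusIncl_mem (bs a))
  have h5 := eq_zero_of_mem_plusZ hneg (adjFl_mem h i (plusIncl_mem (bs a)))
  have h6 : adjFr φ i (plusIncl C ν (bs a)) = 0 := by
    rw [← mul_one (adjFr φ i _), ← (geGen_satisfies C).ki_k i, ← mul_assoc,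
      eq_zero_of_mem_plusZ hneg (adjFr_mul_mem h i (plusIncl_mem (bs a))), zero_mul]
  rw [h5, h6] at h4
  simp only [ZeroMemClass.coe_zero, mul_zero, add_zero, sub_zero] at h4
  exact congrArg ((b a : U C) ⊗ₜ[QVT] ·) h4.symm

end Component

end TwoParam

namespace TwoParam

universe u

variable {I : Type u} [Fintype I] (C : CartanDatum I)

/-! ### The bar involution and the homomorphism `Δ̄`. -/

section Bar

theorem barQ_C (a : RatFunc ℚ) : barQ (RatFunc.C a : RatFunc (RatFunc ℚ)) =
    (RatFunc.C a : RatFunc (RatFunc ℚ)) := by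
  have : barQ (RatFunc.C a : RatFunc (RatFunc ℚ)) =
      RatFunc.liftRingHom (R := RatFunc ℚ) (L := RatFunc (RatFunc ℚ))
        (Polynomial.aeval (R := RatFunc ℚ) ((RatFunc.X : RatFunc (RatFunc ℚ))⁻¹)).toRingHom
        (nonZeroDivisors_le_comap_nonZeroDivisors_of_injective _ evalInv_injective)
        (algebraMap (Polynomial (RatFunc ℚ)) (RatFunc (RatFunc ℚ)) (Polynomial.C a)) := by
    rw [RatFunc.algebraMap_C]; rfl
  rw [this, RatFunc.liftRingHom_algebraMap]
  exact Polynomial.aeval_C (R := RatFunc ℚ) ((RatFunc.X : RatFunc (RatFunc ℚ))⁻¹) a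

/-- A ring endomorphism of `ℚ(t)(v)` is determined by its values on `ℚ(t)` and at `v`. Involutivity
makes `Δ̄` linear over `ℚ(v,t)`, although it is assembled from semilinear maps. -/
theorem barQ_barQ (c : QVT) : barQ (barQ c) = c := by
  have h : (barQ.comp barQ : RatFunc (RatFunc ℚ) →+* RatFunc (RatFunc ℚ)) = RingHom.id _ := by
    refine IsLocalization.ringHom_ext (nonZeroDivisors (Polynomial (RatFunc ℚ))) ?_
    refine Polynomial.ringHom_ext (fun a => ?_) ?_
    · change barQ (barQ (algebraMap (Polynomial (RatFunc ℚ)) (RatFunc (RatFunc ℚ))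
        (Polynomial.C a))) = algebraMap (Polynomial (RatFunc ℚ)) (RatFunc (RatFunc ℚ)) (Polynomial.C a)
      rw [RatFunc.algebraMap_C, barQ_C, barQ_C]
    · change barQ (barQ (algebraMap (Polynomial (RatFunc ℚ)) (RatFunc (RatFunc ℚ)) Polynomial.X)) =
        algebraMap (Polynomial (RatFunc ℚ)) (RatFunc (RatFunc ℚ)) Polynomial.X
      rw [RatFunc.algebraMap_X]
      change barQ (barQ vv) = vv
      rw [barQ_vv, map_inv₀, barQ_vv, inv_inv]
  exact DFunLike.congr_fun h c

theorem bar_one : bar C 1 = 1 := map_one (bar_satisfies C).lift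

theorem map_bar_mul (z w : U C ⊗[QVT] U C) :
    TensorProduct.map (bar C) (bar C) (z * w) =
      TensorProduct.map (bar C) (bar C) z * TensorProduct.map (bar C) (bar C) w := by
  induction z using TensorProduct.induction_on with
  | zero => simp
  | add z z' hz hz' => rw [add_mul, map_add, hz, hz', map_add, add_mul]
  | tmul a b =>
    induction w using TensorProduct.induction_on with
    | zero => simp
    | add z z' hz hz' => rw [mul_add, map_add, hz, hz', map_add, mul_add]
    | tmul c d =>
      rw [Algebra.TensorProduct.tmul_mul_tmul, TensorProduct.map_tmul, TensorProduct.map_tmul,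
        TensorProduct.map_tmul, Algebra.TensorProduct.tmul_mul_tmul, bar_mul, bar_mul]

theorem comulBar_mul (x y : U C) : comulBar C (x * y) = comulBar C x * comulBar C y := by
  rw [comulBar, bar_mul, map_mul, map_bar_mul]; rfl

theorem comulBar_add (x y : U C) : comulBar C (x + y) = comulBar C x + comulBar C y := by
  simp only [comulBar, map_add]

theorem comulBar_algebraMap (c : QVT) : comulBar C (algebraMap QVT (U C) c) = algebraMap QVT _ c := by
  rw [Algebra.algebraMap_eq_smul_one, comulBar, map_smulₛₗ, bar_one, map_smul, map_one,
    Algebra.TensorProduct.one_def, map_smulₛₗ, barQ_barQ, TensorProduct.map_tmul, bar_one,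
    Algebra.algebraMap_eq_smul_one, Algebra.TensorProduct.one_def]

/-- Values of `Δ̄` on generators. -/
noncomputable def comulBarGen : Gen I → U C ⊗[QVT] U C
  | .E i => U.E C i ⊗ₜ 1 + U.Kp C i ⊗ₜ U.E C i
  | .F i => 1 ⊗ₜ U.F C i + U.F C i ⊗ₜ U.K C i
  | .K i => U.K C i ⊗ₜ U.K C i
  | .Ki i => U.Ki C i ⊗ₜ U.Ki C i
  | .Kp i => U.Kp C i ⊗ₜ U.Kp C i
  | .Kpi i => U.Kpi C i ⊗ₜ U.Kpi C i

theorem bar_tmul_bar (a b : Gen I) :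
    TensorProduct.map (bar C) (bar C) (U.gen C a ⊗ₜ[QVT] U.gen C b) =
      (show U C from barGen C a) ⊗ₜ[QVT] (show U C from barGen C b) := by
  rw [TensorProduct.map_tmul, bar_gen, bar_gen]

theorem comulBar_gen (a : Gen I) : comulBar C (U.gen C a) = comulBarGen C a := by
  rw [comulBar, bar_gen]
  cases a with
  | E i =>
    change TensorProduct.map (bar C) (bar C) (comul C (U.gen C (.E i))) = _
    rw [comul_gen, comulGen, map_add, U.K, U.E, bar_tmul_bar, TensorProduct.map_tmul, bar_gen,
      bar_one]
    rfl
  | F i =>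
    change TensorProduct.map (bar C) (bar C) (comul C (U.gen C (.F i))) = _
    rw [comul_gen, comulGen, map_add, U.Kp, U.F, bar_tmul_bar, TensorProduct.map_tmul, bar_gen,
      bar_one]
    rfl
  | K i =>
    change TensorProduct.map (bar C) (bar C) (comul C (U.gen C (.Kp i))) = _
    rw [comul_gen, comulGen, U.Kp, bar_tmul_bar]; rfl
  | Ki i =>
    change TensorProduct.map (bar C) (bar C) (comul C (U.gen C (.Kpi i))) = _
    rw [comul_gen, comulGen, U.Kpi, bar_tmul_bar]; rfl
  | Kp i =>
    change TensorProduct.map (bar C) (bar C) (comul C (U.gen C (.K i))) = _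
    rw [comul_gen, comulGen, U.K, bar_tmul_bar]; rfl
  | Kpi i =>
    change TensorProduct.map (bar C) (bar C) (comul C (U.gen C (.Ki i))) = _
    rw [comul_gen, comulGen, U.Ki, bar_tmul_bar]; rfl

end Bar

/-! ### Convergence of `Θ`. -/

section Convergence

instance : NonarchimedeanRing (U C ⊗[QVT] U C) := (HFil_basis C).nonarchimedean

variable {C}

theorem quasiRComp_mem_HFil {ν : I → ℕ} {ι : Type*} [Fintype ι]
    (b : Module.Basis ι QVT (UminusW C ν)) (bs : Module.Basis ι QVT (UplusW C ν)) {N : ℕ}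
    (hN : N ≤ tr ν) : quasiRComp C b bs ∈ HFil C N := by
  refine Submodule.sum_mem _ fun a _ => tmul_mem_HFil_left C ?_ _
  rw [← one_mul (b a : U C), ← one_mul (1 : U C)]
  exact Submodule.mul_mem_mul (Submodule.mul_mem_mul (one_mem (Uplus C)) (one_mem (Uzero C)))
    (Submodule.mem_iSup_of_mem ν (Submodule.mem_iSup_of_mem hN (b a).2))

theorem finite_tr_lt (N : ℕ) : {ν : I → ℕ | tr ν < N}.Finite := by
  classical
  refine (Set.finite_Iic (fun _ : I => N)).subset fun ν hν i => ?_
  exact (Finset.single_le_sum (f := ν) (fun _ _ => Nat.zero_le _) (Finset.mem_univ i)).trans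
    (le_of_lt hν)

/-- In a complete nonarchimedean group a family is summable once it tends to zero along the cofinite
filter. Each `H_N` contains all but finitely many `Θ_ν`, since `I` is finite and so only finitely
many `ν` have `tr ν < N`. -/
theorem summable_quasiRComp {ι : (I → ℕ) → Type*} [∀ ν, Fintype (ι ν)]
    (b : ∀ ν, Module.Basis (ι ν) QVT (UminusW C ν))
    (bs : ∀ ν, Module.Basis (ι ν) QVT (UplusW C ν)) :
    Summable (fun ν => (quasiRComp C (b ν) (bs ν) : UUhat C)) := by
  refine NonarchimedeanAddGroup.summable_of_tendsto_cofinite_zero ?_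
  have h1 : Filter.Tendsto (fun ν => quasiRComp C (b ν) (bs ν)) Filter.cofinite
      (nhds (0 : U C ⊗[QVT] U C)) := by
    refine ((HFil_basis C).hasBasis_nhds_zero.tendsto_right_iff).mpr fun N _ => ?_
    rw [Filter.eventually_cofinite]
    refine (finite_tr_lt N).subset fun ν hν => ?_
    by_contra hlt
    exact hν (quasiRComp_mem_HFil (b ν) (bs ν) (not_lt.mp hlt))
  exact ((UniformSpace.Completion.continuous_coe _).tendsto' 0 0 UniformSpace.Completion.coe_zero).comp h1

end Convergence

/-! ### Summing the component identities. -/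

section Intertwine

variable {R : Type*} [Ring R] [TopologicalSpace R] [IsTopologicalRing R] [T2Space R]

theorem tsum_intertwine {α : Type*} {f : α → R} (hf : Summable f) {p q : R}
    (h : ∀ a, p * f a = f a * q) : p * ∑' a, f a = (∑' a, f a) * q := by
  rw [← hf.tsum_mul_left, ← hf.tsum_mul_right]
  exact tsum_congr h

open Classical in
-- The commutators `p f(ν) - f(ν) p` vanish off the image of the injective shift `ν ↦ i + ν`, so
-- summing them over all `ν` is the same as summing over shifted indices. There the component
-- identity turns them into `f(ν) q' - q f(ν)`, whose sum supplies the missing terms.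
theorem tsum_intertwine_shift {I : Type*} {f : (I → ℕ) → R} (hf : Summable f) (i : I) {p q q' : R}
    (h : ∀ ν, p * f (Pi.single i 1 + ν) + q * f ν = f (Pi.single i 1 + ν) * p + f ν * q')
    (h0 : ∀ ν, ν i = 0 → p * f ν = f ν * p) :
    (p + q) * ∑' ν, f ν = (∑' ν, f ν) * (p + q') := by
  have hinj : Function.Injective fun ν : I → ℕ => Pi.single i 1 + ν := add_right_injective _
  have hsupp : Function.support (fun ν => p * f ν - f ν * p) ⊆
      Set.range fun ν : I → ℕ => Pi.single i 1 + ν := by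
    intro ν hν
    have hi : ν i ≠ 0 := fun hi => hν (sub_eq_zero.mpr (h0 ν hi))
    refine ⟨ν - Pi.single i 1, add_tsub_cancel_of_le fun j => ?_⟩
    by_cases hj : j = i
    · subst hj; rw [Pi.single_eq_same]; exact Nat.one_le_iff_ne_zero.mpr hi
    · rw [Pi.single_eq_of_ne hj]; exact Nat.zero_le _
  have h1 := hinj.tsum_eq hsupp
  have h2 : ∀ ν, p * f (Pi.single i 1 + ν) - f (Pi.single i 1 + ν) * p = f ν * q' - q * f ν := by
    intro ν
    rw [sub_eq_sub_iff_add_eq_add, h ν, add_comm]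
  simp only [h2] at h1
  rw [(hf.mul_right q').tsum_sub (hf.mul_left q), (hf.mul_left p).tsum_sub (hf.mul_right p),
    hf.tsum_mul_left, hf.tsum_mul_left, hf.tsum_mul_right, hf.tsum_mul_right] at h1
  rw [add_mul, mul_add, ← sub_eq_zero]
  rw [← sub_eq_zero] at h1
  rw [← neg_eq_zero, ← h1]
  abel

end Intertwine

/-! ### The intertwining relation on generators and on all of `U`. -/

section Main

variable {C} {φ : Uge C →ₗ[QVT] Ule C →ₗ[QVT] QVT}
  {ι : (I → ℕ) → Type*} [∀ ν, Fintype (ι ν)]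
  (b : ∀ ν, Module.Basis (ι ν) QVT (UminusW C ν)) (bs : ∀ ν, Module.Basis (ι ν) QVT (UplusW C ν))

open UniformSpace.Completion in
theorem coe_mul_quasiR {z z' : U C ⊗[QVT] U C}
    (hz : ∀ ν, z * quasiRComp C (b ν) (bs ν) = quasiRComp C (b ν) (bs ν) * z') :
    (z : UUhat C) * quasiR C b bs = quasiR C b bs * (z' : UUhat C) :=
  tsum_intertwine (summable_quasiRComp b bs) fun ν => by rw [← coe_mul, hz, coe_mul]

open Classical UniformSpace.Completion in
theorem coe_mul_quasiR_shift (i : I) {p q q' : U C ⊗[QVT] U C}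
    (hp : ∀ ν, p * quasiRComp C (b (Pi.single i 1 + ν)) (bs (Pi.single i 1 + ν)) +
        q * quasiRComp C (b ν) (bs ν) =
      quasiRComp C (b (Pi.single i 1 + ν)) (bs (Pi.single i 1 + ν)) * p +
        quasiRComp C (b ν) (bs ν) * q')
    (h0 : ∀ ν, ν i = 0 → p * quasiRComp C (b ν) (bs ν) = quasiRComp C (b ν) (bs ν) * p) :
    ((p + q : U C ⊗[QVT] U C) : UUhat C) * quasiR C b bs =
      quasiR C b bs * ((p + q' : U C ⊗[QVT] U C) : UUhat C) := by
  rw [coe_add, coe_add]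
  refine tsum_intertwine_shift (summable_quasiRComp b bs) i (fun ν => ?_) fun ν hν => ?_
  · rw [← coe_mul, ← coe_mul, ← coe_mul, ← coe_mul, ← coe_add, ← coe_add, hp]
  · rw [← coe_mul, ← coe_mul, h0 ν hν]

theorem commute_of_inverse {R : Type*} [Monoid R] {x x' y : R} (h1 : x' * x = 1) (h2 : x * x' = 1)
    (h : Commute x y) : Commute x' y := by
  have := h.units_inv_left (u := ⟨x, x', h2, h1⟩)
  exact this

/-- For torus elements the relation holds term by term. For `E_i` and `F_i` it mixes neighbouring
degrees: `E_i ⊗ 1` and `1 ⊗ F_i` act on `Θ_{i+ν}`, while the other summand of the coproduct acts on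
`Θ_ν`. -/
theorem comul_mul_quasiR_gen [∀ ν, DecidableEq (ι ν)] (h : IsSkewHopfPairing C φ)
    (hd : ∀ ν (a a' : ι ν),
      φ (plusIncl C ν (bs ν a)) (minusIncl C ν (b ν a')) = if a = a' then 1 else 0) (a : Gen I) :
    (comul C (U.gen C a) : UUhat C) * quasiR C b bs =
      quasiR C b bs * (comulBar C (U.gen C a) : UUhat C) := by
  classical
  rw [comul_gen, comulBar_gen]
  cases a with
  | E i =>
    exact coe_mul_quasiR_shift b bs i (fun ν => E_quasiRComp h i rfl (hd ν) (hd _))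
      fun ν hν => E_quasiRComp_of_eq_zero h i hν
  | F i =>
    exact coe_mul_quasiR_shift b bs i (fun ν => F_quasiRComp h i rfl (hd ν) (hd _))
      fun ν hν => F_quasiRComp_of_eq_zero h i hν
  | K i => exact coe_mul_quasiR b bs fun ν => (K_tmul_K_comm i).eq
  | Ki i =>
    refine coe_mul_quasiR b bs fun ν => (commute_of_inverse ?_ ?_ (K_tmul_K_comm i)).eq
    · exact (comul_satisfies C).Ki_K i
    · exact (comul_satisfies C).K_Ki i
  | Kp i => exact coe_mul_quasiR b bs fun ν => (Kp_tmul_Kp_comm i).eq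
  | Kpi i =>
    refine coe_mul_quasiR b bs fun ν => (commute_of_inverse ?_ ?_ (Kp_tmul_Kp_comm i)).eq
    · exact (comul_satisfies C).Kpi_Kp i
    · exact (comul_satisfies C).Kp_Kpi i

open UniformSpace.Completion in
-- The elements `u` for which the relation holds form a subalgebra, because `Δ` and `Δ̄` are both
-- additive, multiplicative and linear over scalars.
theorem comul_mul_quasiR [∀ ν, DecidableEq (ι ν)] (h : IsSkewHopfPairing C φ)
    (hd : ∀ ν (a a' : ι ν),
      φ (plusIncl C ν (bs ν a)) (minusIncl C ν (b ν a')) = if a = a' then 1 else 0) (u : U C) :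
    (comul C u : UUhat C) * quasiR C b bs = quasiR C b bs * (comulBar C u : UUhat C) := by
  have hu : u ∈ Algebra.adjoin QVT (Set.range (U.gen C)) := by rw [adjoin_gen]; trivial
  induction hu using Algebra.adjoin_induction with
  | mem x hx => obtain ⟨a, rfl⟩ := hx; exact comul_mul_quasiR_gen b bs h hd a
  | algebraMap c =>
    rw [AlgHom.commutes, comulBar_algebraMap]
    exact coe_mul_quasiR b bs fun ν => Algebra.commutes _ _
  | add x y _ _ hx hy =>
    rw [map_add, comulBar_add, coe_add, coe_add, add_mul, hx, hy, mul_add]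
  | mul x y _ _ hx hy =>
    rw [map_mul, comulBar_mul, coe_mul, coe_mul, mul_assoc, hy, ← mul_assoc, hx, mul_assoc]

end Main

end TwoParam

theorem mainTheorem4 {I : Type*} [Fintype I] (C : CartanDatum I) :
    (∃ φ : Uge C →ₗ[QVT] Ule C →ₗ[QVT] QVT, IsSkewHopfPairing C φ) ∧
    ∀ φ : Uge C →ₗ[QVT] Ule C →ₗ[QVT] QVT, IsSkewHopfPairing C φ →
    ∀ (ι : (I → ℕ) → Type*) [∀ ν, Fintype (ι ν)] [∀ ν, DecidableEq (ι ν)]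
      (b : ∀ ν, Module.Basis (ι ν) QVT (UminusW C ν))
      (bs : ∀ ν, Module.Basis (ι ν) QVT (UplusW C ν)),
      (∀ ν (a a' : ι ν),
        φ (plusIncl C ν (bs ν a)) (minusIncl C ν (b ν a')) = if a = a' then 1 else 0) →
      quasiRComp C (b 0) (bs 0) = 1 ⊗ₜ 1 ∧
      Summable (fun ν => (quasiRComp C (b ν) (bs ν) : UUhat C)) ∧
      ∀ u : U C, (comul C u : UUhat C) * quasiR C b bs = quasiR C b bs * (comulBar C u : UUhat C) := by
  refine ⟨⟨_, Pairing.phi_isSkewHopfPairing C⟩, fun φ h ι _ _ b bs hd => ⟨?_, ?_, ?_⟩⟩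
  · exact quasiRComp_zero h (hd 0)
  · exact summable_quasiRComp b bs
  · exact comul_mul_quasiR b bs h hd
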